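/- Let $M=\mathbb H^3/\Gamma$ be a complete orientable hyperbolic 3-manifold of finite volume, with $\Gamma\subset \mathrm{PSL}_2(\mathbb C)$ discrete and torsion-free, and let $k(M)$ be its invariant trace field, i.e. the field generated over $\mathbb Q$ by the traces of the elements of $\Gamma^2=\langle\gamma^2\mid\gamma\in\Gamma\rangle$. In every cusp of $M$ choose an oriented essential simple closed curve on the cusp torus (the meridian), equivalently, for every parabolic fixed point $P$ of $\Gamma$, a primitive element $\mu_P$ of the parabolic subgroup of $\Gamma$ fixing $P$, with $\mu_{\gamma P}=\gamma\mu_P\gamma^{-1}$ for $\gamma\in\Gamma$. Let $H_P$ be the horosphere at $P$ on which $\mu_P$ has translation length $1$, with the complex affine coordinate (unique up to translation) in which $\mu_P$ is translation by $1$. For $P\ne Q\ne R$ the translation parameter $u(H_P,H_Q,H_R)\in\mathbb C$ is the translation, in the coordinate of $H_Q$, from the point where the geodesic $PQ$ meets $H_Q$ to the point where the geodesic $QR$ meets it. For $P\neq Q$ the intercusp parameter is $w(H_P,H_Q)=e^{-(d+i\theta)}$, where $d$ is the (signed) distance from $H_P$ to $H_Q$ along the geodesic $PQ$ and $\theta$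 is the angle of the rotation in $H_Q$ that takes the meridional direction of $H_P$, parallel translated along $PQ$, to the meridional direction of $H_Q$. 1. Let $\mathcal T$ be an ideal triangulation of $M$ (topological, with finitely many tetrahedra) all of whose edges are essential, i.e. the four ideal vertices of each tetrahedron lifted to $\mathbb H^3$ are distinct parabolic fixed points. For distinct ideal vertices $P,Q$ of a lifted tetrahedron let $A_{PQ}\in \mathrm{SL}_2(\mathbb C)$ (unique up to sign) satisfy $A_{PQ}(\infty)=P$, $A_{PQ}(0)=Q$ and $A_{PQ}\begin{pmatrix}1&1\\0&1\end{pmatrix}A_{PQ}^{-1}=\pm\mu_P$. Zickert's labels of the truncated tetrahedra are $$A_{PQ}^{-1}A_{QP}=\begin{pmatrix}0&-\alpha^{-1}\\ \alpha&0\end{pmatrix},\qquad A_{QP}^{-1}A_{QR}=\pm\begin{pmatrix}1&u\\0&1\end{pmatrix}$$ on the long edge from $P$ to $Q$ and on the short edge at $Q$ from $QP$ to $QR$. Then the numbers $\alpha^2$ of all long edges together with the numbers $u$ of all short edges generate $k(M)$ over $\mathbb Q$. 2. Suppose that $M$ is homeomorphic to the complement $S^3\setminus L$ of an oriented tame link $L$,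 that the meridians are the standard meridians of $L$ (oriented by the right hand rule), and that $L$ has a connected, reduced diagram $D$ with at least one crossing such that each crossing arc (the vertical arc from the overpass to the underpass of a crossing) is properly homotopic to a geodesic in $M$, i.e. its lifts to $\mathbb H^3$ join two distinct parabolic fixed points. The crossing label of a crossing is $-w(H_P,H_Q)$, where a lift of the crossing arc joins $P$ and $Q$. For a region $R$ of $D$ and an edge $e$ of $D$ (an arc of $L$ between consecutive crossings) on the boundary of $R$, lift $R$ to $\mathbb H^3$; let $P$ be the parabolic fixed point at which the lift of $e$ lies, and let the lifted crossing arcs of $R$ at the beginning and at the end of $e$ join $P$ to $Q$ and to $Q'$ respectively. The edge label of $e$ on the side of $R$ is $u(H_Q,H_P,H_{Q'})$. Then the edge labels of all pairs $(R,e)$ and the crossing labels of all crossings generate $k(M)$ over $\mathbb Q$. -/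

import Mathlib

open Filter Topology Set MeasureTheory
open scoped OnePoint

noncomputable section

namespace CuspedHyp

/-! ## Hyperbolic 3-space and its orientation-preserving isometries -/

/-- The upper half-space model `ℂ × ℝ_{>0}` of hyperbolic 3-space. -/
abbrev H3 : Type := {p : ℂ × ℝ // 0 < p.2}

/-- `SL₂(ℂ)`. -/
abbrev SL2 : Type := Matrix.SpecialLinearGroup (Fin 2) ℂ

/-- `PSL₂(ℂ)`, the group of orientation-preserving isometries of `H3`. -/
abbrev PSL2 : Type := Matrix.ProjectiveSpecialLinearGroup (Fin 2) ℂ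

/-- The isometry of a matrix. -/
def toPSL : SL2 →* PSL2 := QuotientGroup.mk' _

/-- `|c z + d|² + |c|² t²`. -/
def denom (A : SL2) (p : ℂ × ℝ) : ℝ :=
  Complex.normSq (A.1 1 0 * p.1 + A.1 1 1) + Complex.normSq (A.1 1 0) * p.2 ^ 2

lemma denom_pos (A : SL2) (p : H3) : 0 < denom A p.1 := by
  have hd : A.1 0 0 * A.1 1 1 - A.1 0 1 * A.1 1 0 = 1 := by
    rw [← Matrix.det_fin_two]; exact A.2
  by_cases hc : A.1 1 0 = 0
  · have h : A.1 1 1 ≠ 0 := by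
      intro h
      simp [hc, h] at hd
    simpa [denom, hc] using h
  · have h1 : 0 < Complex.normSq (A.1 1 0) := Complex.normSq_pos.2 hc
    have h2 : 0 < p.1.2 ^ 2 := pow_pos p.2 2
    have h3 := Complex.normSq_nonneg (A.1 1 0 * p.1.1 + A.1 1 1)
    unfold denom
    positivity

/-- The isometric (Poincaré) extension of the Möbius transformation `z ↦ (a z + b) / (c z + d)`
to upper half-space. -/
def sl2Act (A : SL2) (p : H3) : H3 :=
  ⟨(((A.1 0 0 * p.1.1 + A.1 0 1) * (starRingEnd ℂ) (A.1 1 0 * p.1.1 + A.1 1 1)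
      + A.1 0 0 * (starRingEnd ℂ) (A.1 1 0) * (p.1.2 : ℂ) ^ 2) / (denom A p.1 : ℂ),
    p.1.2 / denom A p.1), div_pos p.2 (denom_pos A p)⟩

lemma denom_cast (A : SL2) (p : ℂ × ℝ) : (denom A p : ℂ) =
    (A.1 1 0 * p.1 + A.1 1 1) * (starRingEnd ℂ) (A.1 1 0 * p.1 + A.1 1 1)
      + A.1 1 0 * (starRingEnd ℂ) (A.1 1 0) * (p.2 : ℂ) ^ 2 := by
  simp only [denom, Complex.ofReal_add, Complex.ofReal_mul, Complex.ofReal_pow,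
    Complex.normSq_eq_conj_mul_self]
  ring

lemma det_rel (A : SL2) : A.1 0 0 * A.1 1 1 - A.1 0 1 * A.1 1 0 = 1 := by
  rw [← Matrix.det_fin_two]; exact A.2

/-- The numerator of the first coordinate of `sl2Act A p`. -/
def numer (A : SL2) (p : ℂ × ℝ) : ℂ :=
  (A.1 0 0 * p.1 + A.1 0 1) * (starRingEnd ℂ) (A.1 1 0 * p.1 + A.1 1 1)
    + A.1 0 0 * (starRingEnd ℂ) (A.1 1 0) * (p.2 : ℂ) ^ 2

lemma numer_conj (A : SL2) (p : ℂ × ℝ) :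
    numer A p * (starRingEnd ℂ) (numer A p) + (p.2 : ℂ) ^ 2 =
      (denom A p : ℂ) * ((A.1 0 0 * p.1 + A.1 0 1) * (starRingEnd ℂ) (A.1 0 0 * p.1 + A.1 0 1)
        + A.1 0 0 * (starRingEnd ℂ) (A.1 0 0) * (p.2 : ℂ) ^ 2) := by
  have h1 := det_rel A
  have h2 := congrArg (starRingEnd ℂ) h1
  rw [denom_cast]
  simp only [numer, map_add, map_mul, map_sub, map_one, map_pow, Complex.conj_conj,
    Complex.conj_ofReal] at h2 ⊢
  linear_combination (-(p.2 : ℂ) ^ 2) * h1 + (-(p.2 : ℂ) ^ 2) *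
    (A.1 0 0 * A.1 1 1 - A.1 0 1 * A.1 1 0) * h2

lemma mul_entry (A B : SL2) (i j : Fin 2) :
    (A * B).1 i j = A.1 i 0 * B.1 0 j + A.1 i 1 * B.1 1 j := by
  simp [Matrix.mul_apply, Fin.sum_univ_two]

lemma denom_mul (A B : SL2) (p : H3) :
    denom (A * B) p.1 = denom A (sl2Act B p).1 * denom B p.1 := by
  have hB' : (denom B p.1 : ℂ) ≠ 0 := by exact_mod_cast (denom_pos B p).ne'
  have hn := numer_conj B p.1
  have hD := denom_cast B p.1
  have e : (sl2Act B p).1 = (numer B p.1 / (denom B p.1 : ℂ), p.1.2 / denom B p.1) := rfl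
  have key : ((denom (A * B) p.1 : ℝ) : ℂ) =
      ((denom A (sl2Act B p).1 * denom B p.1 : ℝ) : ℂ) := by
    rw [Complex.ofReal_mul, denom_cast, denom_cast A, e]
    simp only [mul_entry, map_add, map_mul, map_div₀, Complex.ofReal_div, Complex.conj_ofReal]
    field_simp
    simp only [numer, map_add, map_mul, map_pow, Complex.conj_conj,
      Complex.conj_ofReal] at hn hD ⊢
    linear_combination (-A.1 1 0 * (starRingEnd ℂ) (A.1 1 0)) * hn
      - (denom B p.1 : ℂ) * A.1 1 1 * (starRingEnd ℂ) (A.1 1 1) * hD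
  exact_mod_cast key

lemma sl2Act_one (p : H3) : sl2Act 1 p = p := by
  have : denom 1 p.1 = 1 := by simp [denom]
  apply Subtype.ext
  apply Prod.ext <;> simp [sl2Act, this]

lemma sl2Act_mul (A B : SL2) (p : H3) : sl2Act (A * B) p = sl2Act A (sl2Act B p) := by
  have hB := (denom_pos B p).ne'
  have hB' : (denom B p.1 : ℂ) ≠ 0 := by exact_mod_cast hB
  have hA := (denom_pos A (sl2Act B p)).ne'
  have hA' : (denom A (sl2Act B p).1 : ℂ) ≠ 0 := by exact_mod_cast hA
  have hn := numer_conj B p.1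
  have hD := denom_cast B p.1
  have e : (sl2Act B p).1 = (numer B p.1 / (denom B p.1 : ℂ), p.1.2 / denom B p.1) := rfl
  have e' : (sl2Act A (sl2Act B p)).1 = (numer A (sl2Act B p).1 / (denom A (sl2Act B p).1 : ℂ),
    (p.1.2 / denom B p.1) / denom A (sl2Act B p).1) := rfl
  have e'' : (sl2Act (A * B) p).1 = (numer (A * B) p.1 / (denom (A * B) p.1 : ℂ),
    p.1.2 / denom (A * B) p.1) := rfl
  apply Subtype.ext
  rw [e', e'', denom_mul]
  refine Prod.ext ?_ ?_
  · simp only [Complex.ofReal_mul]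
    rw [div_eq_div_iff (mul_ne_zero hA' hB') hA']
    suffices h : numer (A * B) p.1 = numer A (sl2Act B p).1 * (denom B p.1 : ℂ) by
      rw [h]; ring
    rw [e]
    simp only [numer, mul_entry, map_add, map_mul, map_div₀, Complex.ofReal_div,
      Complex.conj_ofReal]
    field_simp
    simp only [numer, map_add, map_mul, map_pow, Complex.conj_conj,
      Complex.conj_ofReal] at hn hD ⊢
    linear_combination (-A.1 0 0 * (starRingEnd ℂ) (A.1 1 0)) * hn
      - (denom B p.1 : ℂ) * A.1 0 1 * (starRingEnd ℂ) (A.1 1 1) * hD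
  · simp only
    field_simp

lemma sl2Act_center {A : SL2} (hA : A ∈ Subgroup.center SL2) (p : H3) : sl2Act A p = p := by
  obtain ⟨r, hr, hA⟩ := Matrix.SpecialLinearGroup.mem_center_iff.1 hA
  have h00 : A.1 0 0 = r := by rw [← hA]; simp
  have h11 : A.1 1 1 = r := by rw [← hA]; simp
  have h01 : A.1 0 1 = 0 := by rw [← hA]; simp
  have h10 : A.1 1 0 = 0 := by rw [← hA]; simp
  have hr2 : r ^ 2 = 1 := by simpa using hr
  have hN : Complex.normSq r = 1 := by
    rcases eq_or_eq_neg_of_sq_eq_sq r 1 (by rw [hr2, one_pow]) with h | h <;> simp [h]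
  have hd : denom A p.1 = 1 := by simp [denom, h10, h11, hN]
  have hc : r * (starRingEnd ℂ) r = 1 := by rw [Complex.mul_conj, hN]; simp
  apply Subtype.ext
  apply Prod.ext
  · simp only [sl2Act, hd, h00, h01, h10, h11]
    simp
    linear_combination p.1.1 * hc
  · simp [sl2Act, hd]

/-- The homomorphism `SL₂(ℂ) → Sym(H3)`. -/
def sl2Perm : SL2 →* Equiv.Perm H3 where
  toFun A := ⟨sl2Act A, sl2Act A⁻¹,
    fun p => by rw [← sl2Act_mul, inv_mul_cancel, sl2Act_one],
    fun p => by rw [← sl2Act_mul, mul_inv_cancel, sl2Act_one]⟩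
  map_one' := Equiv.ext sl2Act_one
  map_mul' A B := Equiv.ext (sl2Act_mul A B)

/-- The action of `PSL₂(ℂ)` on hyperbolic space; `toPSL A` acts by `sl2Act A`. -/
instance : MulAction PSL2 H3 :=
  MulAction.compHom H3 (QuotientGroup.lift (Subgroup.center SL2) sl2Perm
    (fun _ hA => Equiv.ext (sl2Act_center hA)))

lemma toPSL_smul (A : SL2) (p : H3) : toPSL A • p = sl2Act A p := rfl

/-- The action of `PSL₂(ℂ)` on the sphere at infinity `ℂ ∪ {∞}` by Möbius transformations. -/
instance : MulAction PSL2 (OnePoint ℂ) := (OnePoint.equivProjectivization ℂ).mulAction PSL2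

lemma toPSL_smul_boundary (A : SL2) (P : OnePoint ℂ) :
    toPSL A • P = (A : GL (Fin 2) ℂ) • P := by
  rfl

/-- The hyperbolic volume `dx dy dt / t³` on upper half-space. -/
def hypVolume : Measure H3 :=
  ((volume : Measure (ℂ × ℝ)).comap Subtype.val).withDensity
    fun p => ENNReal.ofReal (1 / p.1.2 ^ 3)

/-- `H3 / Γ` is a complete orientable hyperbolic 3-manifold of finite volume: `Γ` acts freely and
properly discontinuously, and the translates of some set of finite volume cover `H3`. -/
structure IsFiniteVolumeManifoldGroup (Γ : Subgroup PSL2) : Prop where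
  free : ∀ g ∈ Γ, ∀ x : H3, g • x = x → g = 1
  properlyDiscontinuous : ProperlyDiscontinuousSMul Γ H3
  finiteVolume : ∃ F : Set H3, MeasurableSet F ∧ hypVolume F < ⊤ ∧ ∀ x, ∃ g ∈ Γ, g • x ∈ F

/-- The manifold `M = H3 / Γ`, with the quotient topology. -/
abbrev Manifold (Γ : Subgroup PSL2) : Type := Quotient (MulAction.orbitRel Γ H3)

/-- The universal covering `H3 → M`. -/
def toManifold (Γ : Subgroup PSL2) (x : H3) : Manifold Γ := Quotient.mk _ x

/-- `Γ²`, the subgroup generated by the squares of the elements of `Γ`. -/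
def squareSubgroup (Γ : Subgroup PSL2) : Subgroup PSL2 :=
  Subgroup.closure {h | ∃ g ∈ Γ, h = g ^ 2}

/-- The invariant trace field `k(M)`: the field generated over `ℚ` by the traces (defined up to
sign, both signs are listed) of the elements of `Γ²`. -/
def invariantTraceField (Γ : Subgroup PSL2) : IntermediateField ℚ ℂ :=
  IntermediateField.adjoin ℚ {x | ∃ A : SL2, toPSL A ∈ squareSubgroup Γ ∧ x = A.1.trace}

/-! ## Cusps and meridians -/

/-- Parabolic isometries. -/
def IsParabolic (g : PSL2) : Prop := g ≠ 1 ∧ ∃ A : SL2, toPSL A = g ∧ A.1.trace = 2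

/-- `P` is the centre of a horosphere covering a cusp cross-section of `H3 / Γ`, i.e. a parabolic
fixed point of `Γ`. -/
def IsCusp (Γ : Subgroup PSL2) (P : OnePoint ℂ) : Prop :=
  ∃ g ∈ Γ, IsParabolic g ∧ g • P = P

/-- A choice of an oriented meridian in the cross-section of every cusp of `M`. For each cusp `P` of
`Γ`, `meridian P` is the covering transformation which translates the horospheres at `P` along the
meridian. That the meridian is an essential simple closed curve on the torus means that `meridian P`
is a primitive element of the parabolic subgroup fixing `P`; that it is chosen in `M` means
equivariance. (Values at points which are not cusps are irrelevant.) -/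
structure MeridianSystem (Γ : Subgroup PSL2) where
  meridian : OnePoint ℂ → PSL2
  mem : ∀ P, IsCusp Γ P → meridian P ∈ Γ
  parabolic : ∀ P, IsCusp Γ P → IsParabolic (meridian P)
  fixes : ∀ P, IsCusp Γ P → meridian P • P = P
  primitive : ∀ P, IsCusp Γ P → ∀ g ∈ Γ, ∀ n : ℕ, g ^ n = meridian P → n = 1
  equivariant : ∀ P, IsCusp Γ P → ∀ g ∈ Γ, meridian (g • P) = g * meridian P * g⁻¹

/-- The translation `z ↦ z + u`. -/
def translation (u : ℂ) : SL2 := ⟨!![1, u; 0, 1], by simp [Matrix.det_fin_two]⟩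

/-- The point `(z, t)` of upper half-space. -/
def point (z : ℂ) (t : ℝ) (ht : 0 < t) : H3 := ⟨(z, t), ht⟩

/-- `A` carries `∞` to `P` and the translation `z ↦ z + 1` to the meridian at `P`. Then `A` carries
the plane `t = 1` to the horosphere `H_P` at `P` on which the meridian has length one, and
`z ↦ A • (z, 1)` is the complex affine coordinate on `H_P` (unique up to translations) in which the
meridional translation is the number one. -/
def IsFrame {Γ : Subgroup PSL2} (m : MeridianSystem Γ) (P : OnePoint ℂ) (A : SL2) : Prop :=
  toPSL A • (∞ : OnePoint ℂ) = P ∧ toPSL (A * translation 1 * A⁻¹) = m.meridian P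

/-! ## Intercusp and translation parameters -/

/-- `u` is the translation parameter `u(H₁, H₂, H₃)` of the horospheres with centres `P₁, P₂, P₃`:
the geodesics from `P₂` to `P₁` and to `P₃` meet `H₂` in the points with coordinates `x` and `y`,
and `u` is the translation from the first point to the second. -/
def IsTranslationParameter {Γ : Subgroup PSL2} (m : MeridianSystem Γ) (P₁ P₂ P₃ : OnePoint ℂ)
    (u : ℂ) : Prop :=
  ∃ A : SL2, IsFrame m P₂ A ∧ ∃ x y : ℂ, toPSL A • (x : OnePoint ℂ) = P₁ ∧
    toPSL A • (y : OnePoint ℂ) = P₃ ∧ u = y - x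

/-- `d + i θ` is the complex distance of the horospheres `H₁, H₂` with centres `P₁ ≠ P₂`.
The coordinates `A` on `H₁` and `B` on `H₂` are such that the geodesic `P₁P₂` meets `H₁` and `H₂` in
the points with coordinate `0`. In the position where `A = 1`, the geodesic is the vertical line
over `0`, which meets `H₁` at height `1` and `H₂` at height `exp (-d)`. Parallel transport along it
preserves horizontal directions, so that `1 ∈ ℂ` is the transported meridional direction of `H₁`.
The meridional direction of `H₂` there, the derivative of its coordinate in the direction of `1`,
is obtained from it by the rotation through `θ` in `H₂`, which is the multiplication by
`exp (-i θ)` when viewed from `P₁` (orientations being those of the complex coordinates on the two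
horospheres). -/
def IsComplexDistance {Γ : Subgroup PSL2} (m : MeridianSystem Γ) (P₁ P₂ : OnePoint ℂ)
    (d θ : ℝ) : Prop :=
  ∃ A B : SL2, IsFrame m P₁ A ∧ IsFrame m P₂ B ∧
    toPSL A • ((0 : ℂ) : OnePoint ℂ) = P₂ ∧ toPSL B • ((0 : ℂ) : OnePoint ℂ) = P₁ ∧
    toPSL B • point 0 1 one_pos = toPSL A • point 0 (Real.exp (-d)) (Real.exp_pos _) ∧
    HasDerivAt (fun r : ℝ => (toPSL (A⁻¹ * B) • point (r : ℂ) 1 one_pos).1.1)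
      ((Real.exp (-d) : ℂ) * Complex.exp (-(θ * Complex.I))) 0

/-- `w` is the intercusp parameter `w(H₁, H₂) = exp (-(d + i θ))`. -/
def IsIntercuspParameter {Γ : Subgroup PSL2} (m : MeridianSystem Γ) (P₁ P₂ : OnePoint ℂ)
    (w : ℂ) : Prop :=
  ∃ d θ : ℝ, IsComplexDistance m P₁ P₂ d θ ∧ w = Complex.exp (-(d + θ * Complex.I))

/-! ## Approaching an ideal point -/

/-- Horoballs centred at `P`. -/
def IsHoroball (P : OnePoint ℂ) (B : Set H3) : Prop :=
  ∃ A : SL2, ∃ h : ℝ, 0 < h ∧ toPSL A • (∞ : OnePoint ℂ) = P ∧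
    B = {x | h < (toPSL A⁻¹ • x).1.2}

/-- `φ` runs into the cusp at `P`: it eventually enters every horoball at `P`. -/
def TendsToIdeal {α : Type*} (l : Filter α) (φ : α → H3) (P : OnePoint ℂ) : Prop :=
  ∀ B, IsHoroball P B → ∀ᶠ t in l, φ t ∈ B

/-! ## Ideal triangulations and Zickert's labels -/

/-- The tetrahedron without its vertices. -/
def idealSimplex : Set (Fin 4 → ℝ) := {x | x ∈ stdSimplex ℝ (Fin 4) ∧ ∀ k, x k ≠ 1}

/-- A (topological) ideal triangulation of `M = H3 / Γ`, given by a lift `map i` to the universal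
covering of each of its finitely many tetrahedra. The translates of the lifts under `Γ` cover `H3`,
are locally finite, have disjoint interiors, and are glued along faces by affine
identifications of the faces. The ends of the tetrahedra go out the cusps. Every edge is
essential: the ideal vertices of a lifted tetrahedron are distinct, so that it can be straightened
to an ideal simplex (possibly flat or negatively oriented). -/
structure IdealTriangulation (Γ : Subgroup PSL2) where
  n : ℕ
  map : Fin n → (Fin 4 → ℝ) → H3
  vertex : Fin n → Fin 4 → OnePoint ℂ
  continuousOn : ∀ i, ContinuousOn (map i) idealSimplex
  isCusp : ∀ i v, IsCusp Γ (vertex i v)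
  tendsTo : ∀ i v, TendsToIdeal (𝓝[idealSimplex] (Pi.single v 1)) (map i) (vertex i v)
  vertex_injective : ∀ i, Function.Injective (vertex i)
  covers : ∀ x : H3, ∃ g ∈ Γ, ∃ i, ∃ p ∈ idealSimplex, g • map i p = x
  locallyFinite : ∀ K : Set H3, IsCompact K →
    {q : Γ × Fin n | ∃ p ∈ idealSimplex, (q.1 : PSL2) • map q.2 p ∈ K}.Finite
  face_to_face : ∀ i j, ∀ g ∈ Γ, ∀ x ∈ idealSimplex, ∀ y ∈ idealSimplex,
    map i x = g • map j y → ∃ σ : Equiv.Perm (Fin 4), y = x ∘ σ ∧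
      ∀ x' ∈ idealSimplex, (∀ k, x k = 0 → x' k = 0) → map i x' = g • map j (x' ∘ σ)
  interior_disjoint : ∀ i j, ∀ g ∈ Γ, ∀ x ∈ idealSimplex, ∀ y ∈ idealSimplex,
    (∀ k, 0 < x k) → map i x = g • map j y → i = j ∧ g = 1 ∧ x = y

/-- Zickert's label of the long edge from the truncated vertex `P` to the truncated vertex `Q` is the
matrix with rows `(0, -α⁻¹)` and `(α, 0)`: the change from the frame at `P` with `Q` at `0` to the
frame at `Q` with `P` at `0`. -/
def IsLongLabel {Γ : Subgroup PSL2} (m : MeridianSystem Γ) (P Q : OnePoint ℂ) (α : ℂ) : Prop :=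
  ∃ A B : SL2, IsFrame m P A ∧ IsFrame m Q B ∧
    toPSL A • ((0 : ℂ) : OnePoint ℂ) = Q ∧ toPSL B • ((0 : ℂ) : OnePoint ℂ) = P ∧
    (A⁻¹ * B).1 = !![0, -α⁻¹; α, 0]

/-- Zickert's label of the short edge at the truncated vertex `Q`, from the edge `QP` to the edge
`QR`, is the matrix with rows `(1, u)` and `(0, 1)`: the change from the frame at `Q` with `P` at `0`
to the frame at `Q` with `R` at `0`. -/
def IsShortLabel {Γ : Subgroup PSL2} (m : MeridianSystem Γ) (P Q R : OnePoint ℂ) (u : ℂ) : Prop :=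
  ∃ A B : SL2, IsFrame m Q A ∧ IsFrame m Q B ∧
    toPSL A • ((0 : ℂ) : OnePoint ℂ) = P ∧ toPSL B • ((0 : ℂ) : OnePoint ℂ) = R ∧
    (A⁻¹ * B).1 = !![1, u; 0, 1]

/-- The parameters `α²` of all long edges and `u` of all short edges of the truncated tetrahedra. -/
def IdealTriangulation.zickertParameters {Γ : Subgroup PSL2} (T : IdealTriangulation Γ)
    (m : MeridianSystem Γ) : Set ℂ :=
  {x | ∃ i v₁ v₂, v₁ ≠ v₂ ∧ ∃ α, IsLongLabel m (T.vertex i v₁) (T.vertex i v₂) α ∧ x = α ^ 2} ∪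
  {u | ∃ i v₁ v₂ v₃, v₁ ≠ v₂ ∧ v₂ ≠ v₃ ∧ v₁ ≠ v₃ ∧
    IsShortLabel m (T.vertex i v₁) (T.vertex i v₂) (T.vertex i v₃) u}

/-! ## Link diagrams -/

/-- An oriented polygonal link in `ℝ³ = ℂ × ℝ` in regular position with respect to the projection
to `ℂ`, that is, a link diagram. Segment `i` runs from `vert i` to `vert (next i)`, and the cycles of
`next` are the components of the link. -/
structure LinkDiagram where
  n : ℕ
  next : Equiv.Perm (Fin n)
  vert : Fin n → ℂ × ℝ
  /-- Vertices do not project to multiple points. -/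
  vertex_regular : ∀ i j, ∀ t ∈ Ico (0 : ℝ) 1, (j, t) ≠ (i, 0) →
    (AffineMap.lineMap (vert j) (vert (next j)) t).1 ≠ (vert i).1
  /-- Points of the link with the same projection have different heights. -/
  embedded : ∀ a b : Fin n × ℝ, a.2 ∈ Ico (0 : ℝ) 1 → b.2 ∈ Ico (0 : ℝ) 1 → a ≠ b →
    AffineMap.lineMap (vert a.1) (vert (next a.1)) a.2 ≠
      AffineMap.lineMap (vert b.1) (vert (next b.1)) b.2
  /-- There are no triple points. -/
  no_triple : ∀ a b c : Fin n × ℝ,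
    a.2 ∈ Ico (0 : ℝ) 1 → b.2 ∈ Ico (0 : ℝ) 1 → c.2 ∈ Ico (0 : ℝ) 1 →
    a ≠ b → b ≠ c → a ≠ c →
    ¬ ((AffineMap.lineMap (vert a.1) (vert (next a.1)) a.2).1 =
          (AffineMap.lineMap (vert b.1) (vert (next b.1)) b.2).1 ∧
        (AffineMap.lineMap (vert b.1) (vert (next b.1)) b.2).1 =
          (AffineMap.lineMap (vert c.1) (vert (next c.1)) c.2).1)
  /-- There are finitely many double points; hence segments cross transversally at them. -/
  finite_double : {q : (Fin n × ℝ) × (Fin n × ℝ) |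
    q.1.2 ∈ Ico (0 : ℝ) 1 ∧ q.2.2 ∈ Ico (0 : ℝ) 1 ∧ q.1 ≠ q.2 ∧
      (AffineMap.lineMap (vert q.1.1) (vert (next q.1.1)) q.1.2).1 =
        (AffineMap.lineMap (vert q.2.1) (vert (next q.2.1)) q.2.2).1}.Finite

namespace LinkDiagram

variable (D : LinkDiagram)

/-- Parameters `(i, t)`, `0 ≤ t < 1`, of the points of the link. -/
abbrev Param : Type := Fin D.n × ℝ

/-- The point of the link at a parameter. -/
def pt (a : D.Param) : ℂ × ℝ := AffineMap.lineMap (D.vert a.1) (D.vert (D.next a.1)) a.2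

/-- The link. -/
def link : Set (ℂ × ℝ) := {p | ∃ a : D.Param, a.2 ∈ Ico (0 : ℝ) 1 ∧ D.pt a = p}

/-- The projection of the link to the plane. -/
def shadow : Set ℂ := Prod.fst '' D.link

/-- The complement of the link in `S³`. -/
abbrev Complement : Type :=
  {p : OnePoint (ℂ × ℝ) // p ∉ (fun x : ℂ × ℝ => (x : OnePoint (ℂ × ℝ))) '' D.link}

/-- `a` and `b` are the two points of the link over a crossing. The crossing arc from `a` to `b` is
the open vertical segment between them. -/
def IsCrossing (a b : D.Param) : Prop :=
  a.2 ∈ Ico (0 : ℝ) 1 ∧ b.2 ∈ Ico (0 : ℝ) 1 ∧ a ≠ b ∧ (D.pt a).1 = (D.pt b).1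

/-- The diagram is connected, has a crossing, and is reduced: it has no nugatory crossing, i.e. no
crossing whose removal disconnects it (equivalently, no crossing through which there is a simple
closed curve in the projection plane that meets the diagram nowhere else and transversally there). -/
structure IsReduced : Prop where
  connected : IsPreconnected D.shadow
  crossing : ∃ a b, D.IsCrossing a b
  reduced : ∀ a b, D.IsCrossing a b → IsPreconnected (D.shadow \ {(D.pt a).1})

/-- The parameter reached from `a` by following the oriented link; the length is measured by the
parameter, in which each segment has length one. -/
def walk (a : D.Param) (r : ℝ) : D.Param :=
  ((D.next ^ ⌊a.2 + r⌋₊) a.1, Int.fract (a.2 + r))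

/-- The walk of length `r` from `a` is an edge of the diagram: the part of the link between two
consecutive passages through crossings. -/
def IsEdge (a : D.Param) (r : ℝ) : Prop :=
  0 < r ∧ (∃ b, D.IsCrossing a b) ∧ (∃ b, D.IsCrossing (D.walk a r) b) ∧
    ∀ s ∈ Ioo 0 r, ¬ ∃ b, D.IsCrossing (D.walk a s) b

/-- `R` is a region of the diagram. -/
def IsRegion (R : Set ℂ) : Prop := ∃ z ∈ D.shadowᶜ, R = connectedComponentIn D.shadowᶜ z

/-- The edge is a side of the region `R`. -/
def IsSide (a : D.Param) (r : ℝ) (R : Set ℂ) : Prop :=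
  ∀ s ∈ Ioo 0 r, (D.pt (D.walk a s)).1 ∈ closure R

/-- The loop around the point `a` of the link at distance about `t` from it, in the plane
spanned by the vertical direction and the horizontal normal of the link. As `θ` increases it is
oriented by the right hand rule with respect to the direction of the link. -/
def meridianLoop (a : D.Param) (t θ : ℝ) : ℂ × ℝ :=
  ((D.pt a).1 + (t * Real.cos θ : ℝ) *
      (Complex.I * ((D.vert (D.next a.1)).1 - (D.vert a.1).1)),
    (D.pt a).2 + t * Real.sin θ)

variable {D} {Γ : Subgroup PSL2}

/-- The universal covering `H3 → M ≃ S³ ∖ L ⊆ S³`. -/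
def cover (f : Manifold Γ ≃ₜ D.Complement) (x : H3) : OnePoint (ℂ × ℝ) := (f (toManifold Γ x)).1

/-- The meridians in `m` are the standard meridians of the oriented link: whenever a small punctured
disc transverse to the link at a point `a` is lifted (in polar coordinates) to `H3` so that one of its
radii goes out to the cusp `P`, going once around the disc by the right hand rule is the covering
transformation `m.meridian P`. -/
def IsStandardMeridian (f : Manifold Γ ≃ₜ D.Complement) (m : MeridianSystem Γ) : Prop :=
  ∀ (a : D.Param) (ε : ℝ) (ψ : ℝ × ℝ → H3) (P : OnePoint ℂ) (θ₀ : ℝ),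
    a.2 ∈ Ioo (0 : ℝ) 1 → 0 < ε → ContinuousOn ψ (Ioc 0 ε ×ˢ univ) →
    (∀ t ∈ Ioc 0 ε, ∀ θ, cover f (ψ (t, θ)) = (D.meridianLoop a t θ : OnePoint (ℂ × ℝ))) →
    IsCusp Γ P → TendsToIdeal (𝓝[>] 0) (fun t => ψ (t, θ₀)) P →
    ∀ t ∈ Ioc 0 ε, ∀ θ, ψ (t, θ + 2 * Real.pi) = m.meridian P • ψ (t, θ)

/-- `c` is a lift to `H3` of the crossing arc from `a` to `b`. -/
def IsCrossingLift (f : Manifold Γ ≃ₜ D.Complement) (a b : D.Param) (c : ℝ → H3) : Prop :=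
  D.IsCrossing a b ∧ ContinuousOn c (Ioo 0 1) ∧ ∀ t ∈ Ioo (0 : ℝ) 1,
    cover f (c t) = (AffineMap.lineMap (D.pt a) (D.pt b) t : ℂ × ℝ)

/-- The path `c : (0,1) → H3` runs from the cusp `P` to the cusp `Q`. -/
def Joins (Γ : Subgroup PSL2) (c : ℝ → H3) (P Q : OnePoint ℂ) : Prop :=
  IsCusp Γ P ∧ IsCusp Γ Q ∧ TendsToIdeal (𝓝[>] 0) c P ∧ TendsToIdeal (𝓝[<] 1) c Q

/-- Every crossing arc is properly homotopic to a geodesic in `M`: its lifts run from one cusp to a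
different cusp, and can thus be pulled tight to the geodesic between the two. -/
def CrossingArcsEssential (f : Manifold Γ ≃ₜ D.Complement) : Prop :=
  ∀ a b c, IsCrossingLift f a b c → ∃ P Q, P ≠ Q ∧ Joins Γ c P Q

/-- Lifts `c`, `c'` of crossing arcs lie on the boundary of the same preimage `Π_R` in `H3` of the
region `R`: they are joined by a path which covers a path in `R × ℝ`. -/
def OnSameRegionLift (f : Manifold Γ ≃ₜ D.Complement) (R : Set ℂ) (c c' : ℝ → H3) : Prop :=
  ∃ γ : ℝ → H3, ContinuousOn γ (Icc 0 1) ∧ (∃ t ∈ Ioo (0 : ℝ) 1, γ 0 = c t) ∧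
    (∃ t ∈ Ioo (0 : ℝ) 1, γ 1 = c' t) ∧
    ∀ s ∈ Ioo (0 : ℝ) 1, ∃ z ∈ R, ∃ h : ℝ, cover f (γ s) = ((z, h) : ℂ × ℝ)

/-- The crossing labels: the negatives `-w(H_P, H_Q)` of the intercusp parameters of the crossing
arcs. -/
def crossingLabels (f : Manifold Γ ≃ₜ D.Complement) (m : MeridianSystem Γ) : Set ℂ :=
  {x | ∃ a b c P Q w, IsCrossingLift f a b c ∧ Joins Γ c P Q ∧
    IsIntercuspParameter m P Q w ∧ x = -w}

/-- The edge labels. An edge, from `a` to `D.walk a r`, which is a side of the region `R` is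
lifted to a side of a preimage `Π_R` of `R`, on the horosphere at `P`. The neighbouring sides of
`Π_R` are lifts `c`, `c'` of the crossing arcs at the two ends of the edge; they go from `P` to `Q` and
`Q'`. The label is the translation parameter `u(H_Q, H_P, H_Q')`, in the direction of the link. -/
def edgeLabels (f : Manifold Γ ≃ₜ D.Complement) (m : MeridianSystem Γ) : Set ℂ :=
  {u | ∃ a r R b b' c c' P Q Q', D.IsEdge a r ∧ D.IsRegion R ∧ D.IsSide a r R ∧
    IsCrossingLift f a b c ∧ IsCrossingLift f (D.walk a r) b' c' ∧ OnSameRegionLift f R c c' ∧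
    Joins Γ c P Q ∧ Joins Γ c' P Q' ∧ IsTranslationParameter m Q P Q' u}

end LinkDiagram

end CuspedHyp

end

noncomputable section

namespace CuspedHyp

/-! ## Möbius transformations -/

/-! Call an ordered pair (P, Q) of distinct cusps a flag. It has a frame, unique up to sign: a
matrix taking ∞ to P, 0 to Q and the translation by 1 to the meridian at P (`IsFlagFrame.unique`).
Since the meridians are equivariant, an element g of Γ takes the frame of (P, Q) to that of (gP,
gQ). Passing from (P, Q) to (Q, P) multiplies the frame by the antidiagonal matrix with entries -α⁻¹
and α, and the intercusp parameter is -α⁻² (`isIntercuspParameter_iff`). Passing from (P, Q) to (P,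
R) multiplies it by the translation by u, the translation parameter. So both statements are about
the same two kinds of numbers, α² and u.

These numbers lie in k(M). In the frame of (P, Q) the squares of the meridians at P and Q, which
belong to Γ², are the translation by 2 and a lower unipotent matrix with entry -2α²; their product
has trace 2 - 4α². With a third cusp R, the difference of two traces of elements of Γ² is linear in
u with coefficients in k(M) and nonzero leading coefficient (`translationParameter_mem`).

Conversely, let K contain the parameters and fix a base frame A₀. Both changes of flag are
proportional to matrices over K. Hence every flag that is reached from the base flag through
parameters in K has a frame A such that A₀⁻¹A is proportional to a matrix over K; such flags are
called rational. If (P, Q) and (gP, gQ) are rational, then A₀⁻¹gA₀ is proportional to a matrix over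
K. The square of a matrix of determinant 1 with this property has entries in K, because the square
of the scalar is a determinant over K. So once all of Γ is represented over K up to scalars, Γ² has
its traces in K (`invariantTraceField_le`). It remains to spread rationality, which is topology.

For a triangulation, the edges of one tetrahedron are related by its labels, and two lifted
tetrahedra that meet share an edge. As H3 is connected and the tetrahedra form a locally finite
closed cover, all of them are rational (`IdealTriangulation.le_rationalSubgroup`).

For a link, the points visible from above form a contractible open set, which has a lift σ to H3.
Below the strands hang walls; passing through a wall from left to right changes σ into gσ, and these
Wirtinger elements g generate Γ, since removing finitely many vertical lines does not disconnect
(`le_of_isWall_mem`). A wall is constant along an edge of the diagram, and next to a crossing it is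
the inverse of the meridian at the cusp from which the lifted crossing arc starts
(`IsSectorLift.wall_eq`). In particular the arcs at both ends of an edge start at the same cusp, so
edge labels carry rationality along edges. Crossing labels and the meridian of the overpass carry it
around a crossing. As the diagram is connected, all crossing arcs, hence all walls, hence Γ, are
rational. -/

lemma toPSL_smul_infty_eq_infty {A : SL2} :
    toPSL A • (∞ : OnePoint ℂ) = ∞ ↔ A.1 1 0 = 0 := by
  rw [toPSL_smul_boundary, OnePoint.smul_infty_eq_self_iff]
  rfl

lemma toPSL_smul_infty {A : SL2} (h : A.1 1 0 ≠ 0) :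
    toPSL A • (∞ : OnePoint ℂ) = ((A.1 0 0 / A.1 1 0 : ℂ) : OnePoint ℂ) := by
  rw [toPSL_smul_boundary, OnePoint.smul_infty_eq_ite]
  exact if_neg h

lemma toPSL_smul_coe {A : SL2} {z : ℂ} (h : A.1 1 0 * z + A.1 1 1 ≠ 0) :
    toPSL A • (z : OnePoint ℂ) =
      (((A.1 0 0 * z + A.1 0 1) / (A.1 1 0 * z + A.1 1 1) : ℂ) : OnePoint ℂ) := by
  rw [toPSL_smul_boundary, OnePoint.smul_some_eq_ite]
  exact if_neg h

lemma toPSL_smul_coe_eq_infty {A : SL2} {z : ℂ} :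
    toPSL A • (z : OnePoint ℂ) = ∞ ↔ A.1 1 0 * z + A.1 1 1 = 0 := by
  constructor
  · intro h
    by_contra h'
    rw [toPSL_smul_coe h'] at h
    exact OnePoint.coe_ne_infty _ h
  · intro h
    rw [toPSL_smul_boundary, OnePoint.smul_some_eq_ite]
    exact if_pos h

lemma toPSL_smul_infty_eq_zero {A : SL2} (h : toPSL A • (∞ : OnePoint ℂ) = ((0 : ℂ) : OnePoint ℂ)) :
    A.1 0 0 = 0 := by
  have hc : A.1 1 0 ≠ 0 := fun hc => by
    rw [toPSL_smul_infty_eq_infty.2 hc] at h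
    exact OnePoint.infty_ne_coe _ h
  rw [toPSL_smul_infty hc, OnePoint.coe_eq_coe, div_eq_zero_iff] at h
  exact h.resolve_right hc

lemma toPSL_translation_smul (u z : ℂ) :
    toPSL (translation u) • (z : OnePoint ℂ) = ((z + u : ℂ) : OnePoint ℂ) := by
  rw [toPSL_smul_coe] <;> simp [translation]

lemma toPSL_translation_smul_infty (u : ℂ) :
    toPSL (translation u) • (∞ : OnePoint ℂ) = ∞ :=
  toPSL_smul_infty_eq_infty.2 (by simp [translation])

lemma mem_center_iff {A : SL2} : A ∈ Subgroup.center SL2 ↔ A = 1 ∨ A = -1 := by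
  rw [Matrix.SpecialLinearGroup.mem_center_iff]
  constructor
  · rintro ⟨r, hr, h⟩
    have hr' : r ^ 2 = 1 := by simpa using hr
    rcases eq_or_eq_neg_of_sq_eq_sq r 1 (by rw [hr', one_pow]) with rfl | rfl
    · left; ext i j; rw [← h]; fin_cases i <;> fin_cases j <;> simp
    · right; ext i j; rw [← h]; fin_cases i <;> fin_cases j <;> simp
  · rintro (rfl | rfl)
    · exact ⟨1, by simp, by simp⟩
    · exact ⟨-1, by simp, by ext i j; fin_cases i <;> fin_cases j <;> simp⟩

lemma toPSL_eq_iff {A B : SL2} : toPSL A = toPSL B ↔ B = A ∨ B = -A := by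
  have : toPSL A = toPSL B ↔ A⁻¹ * B ∈ Subgroup.center SL2 := QuotientGroup.eq
  rw [this, mem_center_iff, inv_mul_eq_iff_eq_mul, inv_mul_eq_iff_eq_mul, mul_one, mul_neg, mul_one]

lemma toPSL_surjective : Function.Surjective toPSL := QuotientGroup.mk'_surjective _

lemma toPSL_neg (A : SL2) : toPSL (-A) = toPSL A := (toPSL_eq_iff.2 (Or.inr rfl)).symm

lemma translation_val (u : ℂ) : (translation u).1 = !![1, u; 0, 1] := rfl

lemma translation_add (u v : ℂ) : translation u * translation v = translation (u + v) := by
  ext i j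
  rw [mul_entry]
  fin_cases i <;> fin_cases j <;> simp [translation_val, add_comm]

lemma translation_zero : translation 0 = 1 := by
  ext i j; fin_cases i <;> fin_cases j <;> simp [translation]

lemma translation_neg (u : ℂ) : translation (-u) = (translation u)⁻¹ := by
  rw [eq_inv_iff_mul_eq_one, translation_add, neg_add_cancel, translation_zero]

lemma inv_entries (A : SL2) : (A⁻¹).1 = !![A.1 1 1, -A.1 0 1; -A.1 1 0, A.1 0 0] := by
  rw [Matrix.SpecialLinearGroup.SL2_inv_expl]
  rfl

lemma exists_smul_infty_eq (P : OnePoint ℂ) : ∃ A : SL2, toPSL A • (∞ : OnePoint ℂ) = P := by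
  induction P using OnePoint.rec with
  | infty => exact ⟨1, by simp⟩
  | coe z =>
    let A : SL2 := ⟨!![z, -1; 1, 0], by simp [Matrix.det_fin_two]⟩
    refine ⟨A, ?_⟩
    rw [toPSL_smul_infty] <;> simp [A]

/-! ## Frames -/

variable {Γ : Subgroup PSL2} (m : MeridianSystem Γ)

/-- The frame at `P` with `Q` at the coordinate `0`. -/
def IsFlagFrame (P Q : OnePoint ℂ) (A : SL2) : Prop :=
  IsFrame m P A ∧ toPSL A • ((0 : ℂ) : OnePoint ℂ) = Q

variable {m}

lemma toPSL_mul_smul {X : Type*} [MulAction PSL2 X] (A B : SL2) (x : X) :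
    toPSL (A * B) • x = toPSL A • toPSL B • x := by
  rw [map_mul, mul_smul]

/-- After P is moved to ∞, a representative of the meridian with trace 2 becomes upper triangular
with both diagonal entries 1, and only the length of the translation has to be normalised. -/
lemma IsFrame.exists {P : OnePoint ℂ} (hP : IsCusp Γ P) : ∃ A, IsFrame m P A := by
  obtain ⟨hne, G, hG, htr⟩ := m.parabolic P hP
  have hfix := m.fixes P hP
  obtain ⟨C, hC⟩ := exists_smul_infty_eq P
  set N := C⁻¹ * G * C with hN
  have hGN : G = C * N * C⁻¹ := by rw [hN]; group
  have hNinf : toPSL N • (∞ : OnePoint ℂ) = ∞ := by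
    rw [hN, toPSL_mul_smul, toPSL_mul_smul, hC, hG, hfix, map_inv, inv_smul_eq_iff, hC]
  have hc := toPSL_smul_infty_eq_infty.1 hNinf
  have htrN : N.1.trace = 2 := by
    rw [← htr, hN]
    have : (C⁻¹ * G * C).1 = (C⁻¹).1 * G.1 * C.1 := rfl
    rw [this, Matrix.trace_mul_comm, ← Matrix.mul_assoc]
    have : C.1 * (C⁻¹).1 = 1 := by
      rw [← Matrix.SpecialLinearGroup.coe_mul, mul_inv_cancel, Matrix.SpecialLinearGroup.coe_one]
    rw [this, one_mul]
  rw [Matrix.trace_fin_two] at htrN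
  have hdet := det_rel N
  rw [hc, mul_zero, sub_zero] at hdet
  have ha : N.1 0 0 = 1 := by
    have : (N.1 0 0 - 1) ^ 2 = 0 := by linear_combination -hdet + N.1 0 0 * htrN
    exact sub_eq_zero.1 (pow_eq_zero_iff two_ne_zero |>.1 this)
  have hd : N.1 1 1 = 1 := by linear_combination htrN - ha
  have hb : N.1 0 1 ≠ 0 := by
    intro hb
    apply hne
    have : N = 1 := by
      ext i j; fin_cases i <;> fin_cases j <;> simp [ha, hb, hc, hd]
    rw [← hG, hGN, this]; simp
  -- Conjugation by diag(s, s⁻¹) multiplies a translation by s², so s is a square root of the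
  -- translation length.
  obtain ⟨s, hs⟩ := IsAlgClosed.exists_pow_nat_eq (N.1 0 1) (n := 2) two_pos
  have hs0 : s ≠ 0 := by rintro rfl; apply hb; rw [← hs]; simp
  let D : SL2 := ⟨!![s, 0; 0, s⁻¹], by simp [Matrix.det_fin_two, hs0]⟩
  refine ⟨C * D, ?_, ?_⟩
  · rw [toPSL_mul_smul, toPSL_smul_infty_eq_infty.2 (by simp [D]), hC]
  · have : D * translation 1 = N * D := by
      have hD : D.1 = !![s, 0; 0, s⁻¹] := rfl
      ext i j
      rw [mul_entry, mul_entry]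
      fin_cases i <;> fin_cases j <;>
        simp [hD, translation_val, ha, hc, hd, ← hs, hs0, sq]
    have h2 : C * D * translation 1 * (C * D)⁻¹ = G := by
      rw [mul_assoc C, this, hGN]; group
    rw [h2, hG]

lemma IsFrame.mul_translation {P : OnePoint ℂ} {A : SL2} (hA : IsFrame m P A) (u : ℂ) :
    IsFrame m P (A * translation u) := by
  refine ⟨?_, ?_⟩
  · rw [toPSL_mul_smul, toPSL_translation_smul_infty, hA.1]
  · rw [← hA.2]
    congr 1
    have : translation u * translation 1 = translation 1 * translation u := by
      rw [translation_add, translation_add, add_comm]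
    rw [mul_assoc A, this]; group

lemma IsFrame.exists_coordinate {P Q : OnePoint ℂ} {A : SL2} (hA : IsFrame m P A) (h : P ≠ Q) :
    ∃ x : ℂ, toPSL A • (x : OnePoint ℂ) = Q := by
  rcases hx : (toPSL A)⁻¹ • Q with _ | x
  · exact absurd (hA.1.symm.trans ((inv_smul_eq_iff.1 hx).symm)) h
  · exact ⟨x, (inv_smul_eq_iff.1 hx).symm⟩

lemma IsFrame.ne_of_coordinate {P Q : OnePoint ℂ} {A : SL2} (hA : IsFrame m P A) {x : ℂ}
    (hx : toPSL A • (x : OnePoint ℂ) = Q) : P ≠ Q := by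
  rintro rfl
  have := hA.1.trans hx.symm
  exact OnePoint.infty_ne_coe _ (smul_left_cancel _ this)

lemma IsFlagFrame.ne {P Q : OnePoint ℂ} {A : SL2} (hA : IsFlagFrame m P Q A) : P ≠ Q :=
  hA.1.ne_of_coordinate hA.2

lemma IsFrame.flagFrame {P Q : OnePoint ℂ} {A : SL2} (hA : IsFrame m P A) {x : ℂ}
    (hx : toPSL A • (x : OnePoint ℂ) = Q) : IsFlagFrame m P Q (A * translation x) :=
  ⟨hA.mul_translation x, by rw [toPSL_mul_smul, toPSL_translation_smul, zero_add, hx]⟩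

lemma IsFlagFrame.exists {P Q : OnePoint ℂ} (hP : IsCusp Γ P) (h : P ≠ Q) :
    ∃ A, IsFlagFrame m P Q A := by
  obtain ⟨A, hA⟩ := IsFrame.exists (m := m) hP
  obtain ⟨x, hx⟩ := hA.exists_coordinate h
  exact ⟨_, hA.flagFrame hx⟩

/-- The change of frames fixes ∞ and commutes with the translation by 1 up to sign. The minus sign
would make a diagonal entry of a triangular matrix of determinant 1 vanish. -/
lemma IsFrame.unique {P : OnePoint ℂ} {A B : SL2} (hA : IsFrame m P A) (hB : IsFrame m P B) :
    ∃ u, A⁻¹ * B = translation u ∨ A⁻¹ * B = -translation u := by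
  set N := A⁻¹ * B with hN
  have hBN : B = A * N := by rw [hN]; group
  have hc : N.1 1 0 = 0 := by
    rw [← toPSL_smul_infty_eq_infty, hN, toPSL_mul_smul, hB.1, map_inv, inv_smul_eq_iff, hA.1]
  have hT : toPSL (N * translation 1 * N⁻¹) = toPSL (translation 1) := by
    have h := hB.2.trans hA.2.symm
    have h2 : B * translation 1 * B⁻¹ = A * (N * translation 1 * N⁻¹) * A⁻¹ := by
      rw [hBN]; group
    rw [h2, map_mul, map_mul, map_mul _ _ A⁻¹, map_mul _ A] at h
    exact mul_left_cancel (mul_right_cancel h)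
  have hdet := det_rel N
  rw [hc, mul_zero, sub_zero] at hdet
  have hE : translation 1 * N = N * translation 1 ∨ translation 1 * N = -(N * translation 1) := by
    rcases toPSL_eq_iff.1 hT with h | h
    · left; nth_rewrite 1 [h]; group
    · right; nth_rewrite 1 [h]; rw [neg_mul]; group
  have h01 : N.1 0 1 + N.1 1 1 = N.1 0 0 + N.1 0 1 := by
    rcases hE with h | h
    · have := congrArg (fun M : SL2 => M.1 0 1) h
      simpa only [mul_entry, translation_val, Matrix.of_apply, Matrix.cons_val', Matrix.cons_val_zero, Matrix.cons_val_one, Matrix.cons_val_fin_one, one_mul, mul_one, hc] using this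
    · exfalso
      have := congrArg (fun M : SL2 => M.1 0 0) h
      simp [-Matrix.SpecialLinearGroup.coe_mul, mul_entry, translation_val, hc] at this
      have h0 : N.1 0 0 = 0 := self_eq_neg.1 this
      rw [h0, zero_mul] at hdet
      exact zero_ne_one hdet
  have had : N.1 1 1 = N.1 0 0 := by linear_combination h01
  rw [had, ← sq] at hdet
  rcases eq_or_eq_neg_of_sq_eq_sq (N.1 0 0) 1 (by rw [hdet, one_pow]) with h | h
  · exact ⟨N.1 0 1, Or.inl (by
      ext i j; fin_cases i <;> fin_cases j <;> simp [translation, hc, had, h])⟩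
  · refine ⟨-N.1 0 1, Or.inr ?_⟩
    ext i j
    rw [Matrix.SpecialLinearGroup.coe_neg, translation_val]
    fin_cases i <;> fin_cases j <;> simp [hc, had, h]

lemma IsCusp.smul {P : OnePoint ℂ} (hP : IsCusp Γ P) {g : PSL2} (hg : g ∈ Γ) : IsCusp Γ (g • P) := by
  obtain ⟨h, hh, ⟨hne, A, hA, htr⟩, hfix⟩ := hP
  refine ⟨g * h * g⁻¹, mul_mem (mul_mem hg hh) (inv_mem hg), ⟨?_, ?_⟩, ?_⟩
  · intro h1
    exact hne (by simpa using h1)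
  · obtain ⟨G, rfl⟩ := toPSL_surjective g
    refine ⟨G * A * G⁻¹, by rw [map_mul, map_mul, map_inv, hA], ?_⟩
    have h1 : (G * A * G⁻¹).1 = G.1 * A.1 * (G⁻¹).1 := rfl
    have h2 : (G⁻¹).1 * G.1 = 1 := by
      rw [← Matrix.SpecialLinearGroup.coe_mul, inv_mul_cancel, Matrix.SpecialLinearGroup.coe_one]
    rw [h1, Matrix.trace_mul_comm, ← Matrix.mul_assoc, h2, one_mul, htr]
  · rw [mul_smul, mul_smul, inv_smul_smul, hfix]

/-- Equivariance of the meridians becomes equivariance of the frames, so that an element of Γ can be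
read off from the frames of a flag and of its image. -/
lemma IsFlagFrame.smul {P Q : OnePoint ℂ} {A G : SL2} (hA : IsFlagFrame m P Q A)
    (hP : IsCusp Γ P) (hG : toPSL G ∈ Γ) :
    IsFlagFrame m (toPSL G • P) (toPSL G • Q) (G * A) := by
  refine ⟨⟨?_, ?_⟩, ?_⟩
  · rw [toPSL_mul_smul, hA.1.1]
  · rw [m.equivariant P hP _ hG, ← hA.1.2, ← map_inv, ← map_mul, ← map_mul]
    congr 1; group
  · rw [toPSL_mul_smul, hA.2]

lemma IsFlagFrame.unique {P Q : OnePoint ℂ} {A B : SL2} (hA : IsFlagFrame m P Q A)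
    (hB : IsFlagFrame m P Q B) : B = A ∨ B = -A := by
  obtain ⟨u, hu⟩ := hA.1.unique hB.1
  have h0 : toPSL (A⁻¹ * B) • ((0 : ℂ) : OnePoint ℂ) = ((0 : ℂ) : OnePoint ℂ) := by
    rw [toPSL_mul_smul, hB.2, map_inv, inv_smul_eq_iff, hA.2]
  have hT : toPSL (A⁻¹ * B) = toPSL (translation u) := by
    rcases hu with h | h
    · rw [h]
    · rw [h, toPSL_neg]
  rw [hT, toPSL_translation_smul, OnePoint.coe_eq_coe, zero_add] at h0
  rw [h0, translation_zero, inv_mul_eq_iff_eq_mul, inv_mul_eq_iff_eq_mul] at hu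
  simpa using hu

/-- A nontrivial translation has no fixed point besides ∞. This recovers a cusp from its meridian,
where only elements of Γ can be compared. -/
lemma meridian_injOn {P Q : OnePoint ℂ} (hP : IsCusp Γ P) (hQ : IsCusp Γ Q)
    (h : m.meridian P = m.meridian Q) : P = Q := by
  by_contra hne
  obtain ⟨A, hA⟩ := IsFrame.exists (m := m) hP
  obtain ⟨x, hx⟩ := hA.exists_coordinate hne
  have hfix := m.fixes Q hQ
  rw [← h, ← hA.2, ← hx, ← toPSL_mul_smul, inv_mul_cancel_right, toPSL_mul_smul,
    toPSL_translation_smul] at hfix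
  have := OnePoint.coe_injective (smul_left_cancel _ hfix)
  simp at this

/-! ## Labels in terms of frames -/

/-- The change of frames along a long edge. -/
lemma IsFlagFrame.long {P Q : OnePoint ℂ} {A B : SL2} (hA : IsFlagFrame m P Q A)
    (hB : IsFlagFrame m Q P B) :
    ∃ α : ℂ, α ≠ 0 ∧ (A⁻¹ * B).1 = !![0, -α⁻¹; α, 0] := by
  set N := A⁻¹ * B with hN
  have h00 : N.1 0 0 = 0 := toPSL_smul_infty_eq_zero (by
    rw [hN, toPSL_mul_smul, hB.1.1, map_inv, inv_smul_eq_iff, hA.2])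
  have h11 : N.1 1 1 = 0 := by
    have := (toPSL_smul_coe_eq_infty (A := N) (z := 0)).1 (by
      rw [hN, toPSL_mul_smul, hB.2, map_inv, inv_smul_eq_iff, hA.1.1])
    simpa using this
  have hdet := det_rel N
  rw [h00, zero_mul, zero_sub] at hdet
  have hne : N.1 1 0 ≠ 0 := fun h => by simp [h] at hdet
  refine ⟨N.1 1 0, hne, ?_⟩
  have h01 : N.1 0 1 = -(N.1 1 0)⁻¹ := by field_simp; linear_combination -hdet
  ext i j
  fin_cases i <;> fin_cases j <;> simp [h00, h11, h01]

/-- The action of the change of frames on the points at height one. -/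
lemma sl2Act_antidiagonal {N : SL2} {α : ℂ} (hα : α ≠ 0) (hN : N.1 = !![0, -α⁻¹; α, 0]) (r : ℝ) :
    (sl2Act N (point (r : ℂ) 1 one_pos)).1 =
      (-(α ^ 2)⁻¹ * ((r / (1 + r ^ 2) : ℝ) : ℂ),
        (Complex.normSq α)⁻¹ * (1 + r ^ 2)⁻¹) := by
  have hns : Complex.normSq α ≠ 0 := (Complex.normSq_pos.2 hα).ne'
  have hr : (1 + r ^ 2 : ℝ) ≠ 0 := by positivity
  have hd : denom N (point (r : ℂ) 1 one_pos).1 = Complex.normSq α * (1 + r ^ 2) := by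
    simp [denom, hN, point]; ring
  have hconj : (starRingEnd ℂ) α ≠ 0 := by simpa using hα
  have hc : ((Complex.normSq α : ℝ) : ℂ) = α * (starRingEnd ℂ) α := (Complex.mul_conj α).symm
  have hr' : (1 + (r : ℂ) ^ 2) ≠ 0 := by exact_mod_cast hr
  refine Prod.ext ?_ ?_
  · simp only [sl2Act, hd]
    simp only [hN, point]
    push_cast
    rw [hc]
    simp
    field_simp
  · simp only [sl2Act, hd]
    simp only [point]
    field_simp

lemma hasDerivAt_antidiagonal {N : SL2} {α : ℂ} (hα : α ≠ 0) (hN : N.1 = !![0, -α⁻¹; α, 0]) :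
    HasDerivAt (fun r : ℝ => (toPSL N • point (r : ℂ) 1 one_pos).1.1) (-(α ^ 2)⁻¹) 0 := by
  have h1 : HasDerivAt (fun r : ℝ => r / (1 + r ^ 2)) 1 0 := by
    have := (hasDerivAt_id' (0 : ℝ)).fun_div ((hasDerivAt_pow 2 (0 : ℝ)).const_add 1) (by norm_num)
    simpa using this
  have h2 := (h1.ofReal_comp).const_mul (-(α ^ 2)⁻¹)
  simp only [Complex.ofReal_one, mul_one] at h2
  refine h2.congr_of_eventuallyEq (Eventually.of_forall fun r => ?_)
  simp only [toPSL_smul, sl2Act_antidiagonal hα hN]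

/-- The change of frames moves the point (r, 1) to one with complex coordinate -α⁻² r / (1 + r²),
whose derivative at 0 is -α⁻². By the definition of the complex distance this derivative is exp(-d)
exp(-iθ) = w. Conversely, any logarithm of -α⁻² supplies d and θ. -/
lemma isIntercuspParameter_iff {P Q : OnePoint ℂ} {w : ℂ} : IsIntercuspParameter m P Q w ↔
    ∃ A B : SL2, ∃ α : ℂ, IsFlagFrame m P Q A ∧ IsFlagFrame m Q P B ∧ α ≠ 0 ∧
      (A⁻¹ * B).1 = !![0, -α⁻¹; α, 0] ∧ w = -(α ^ 2)⁻¹ := by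
  constructor
  · rintro ⟨d, θ, ⟨A, B, hA, hB, hA0, hB0, -, hder⟩, rfl⟩
    obtain ⟨α, hα, hN⟩ := IsFlagFrame.long ⟨hA, hA0⟩ ⟨hB, hB0⟩
    refine ⟨A, B, α, ⟨hA, hA0⟩, ⟨hB, hB0⟩, hα, hN, ?_⟩
    rw [← hder.unique (hasDerivAt_antidiagonal hα hN), Complex.ofReal_exp, ← Complex.exp_add]
    push_cast
    ring_nf
  · rintro ⟨A, B, α, hA, hB, hα, hN, rfl⟩
    have hne : -(α ^ 2)⁻¹ ≠ 0 := by simpa using hα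
    obtain ⟨y, hy⟩ : ∃ y, Complex.exp y = -(α ^ 2)⁻¹ := ⟨_, Complex.exp_log hne⟩
    have hy' : Complex.exp (-((((-y.re : ℝ)) : ℂ) + ((-y.im : ℝ) : ℂ) * Complex.I)) =
        -(α ^ 2)⁻¹ := by
      rw [← hy]; congr 1; push_cast
      conv_rhs => rw [← Complex.re_add_im y]
      ring
    refine ⟨-y.re, -y.im, ⟨A, B, hA.1, hB.1, hA.2, hB.2, ?_, ?_⟩, hy'.symm⟩
    · rw [show B = A * (A⁻¹ * B) by group, toPSL_mul_smul]
      congr 1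
      have h0 := sl2Act_antidiagonal hα hN 0
      have hexp : Real.exp (y.re) = (Complex.normSq α)⁻¹ := by
        rw [← Complex.norm_exp, hy, norm_neg, norm_inv, norm_pow, Complex.normSq_eq_norm_sq]
      apply Subtype.ext
      rw [toPSL_smul]
      simpa [point, hexp] using h0
    · rw [Complex.ofReal_exp, ← Complex.exp_add]
      have h := hasDerivAt_antidiagonal hα hN
      rw [← hy'] at h
      convert h using 2
      push_cast; ring

lemma IsFlagFrame.exists_intercusp {P Q : OnePoint ℂ} (hP : IsCusp Γ P) (hQ : IsCusp Γ Q)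
    (h : P ≠ Q) : ∃ w, IsIntercuspParameter m P Q w := by
  obtain ⟨A, hA⟩ := IsFlagFrame.exists (m := m) hP h
  obtain ⟨B, hB⟩ := IsFlagFrame.exists (m := m) hQ h.symm
  obtain ⟨α, hα, hN⟩ := hA.long hB
  exact ⟨_, isIntercuspParameter_iff.2 ⟨A, B, α, hA, hB, hα, hN, rfl⟩⟩

end CuspedHyp

namespace CuspedHyp

/-! ## Matrices over a field up to scalars -/

variable (K : IntermediateField ℚ ℂ)

/-- The matrices in `SL₂(ℂ)` which are proportional to a matrix over `K`. -/
def projSubgroup : Subgroup SL2 where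
  carrier := {A | ∃ c : ℂ, c ≠ 0 ∧ ∀ i j, c * A.1 i j ∈ K}
  one_mem' := ⟨1, one_ne_zero, fun i j => by
    fin_cases i <;> fin_cases j <;> simp [one_mem, zero_mem]⟩
  mul_mem' := by
    rintro A B ⟨c, hc, hA⟩ ⟨d, hd, hB⟩
    refine ⟨c * d, mul_ne_zero hc hd, fun i j => ?_⟩
    rw [mul_entry]
    have : c * d * (A.1 i 0 * B.1 0 j + A.1 i 1 * B.1 1 j) =
        c * A.1 i 0 * (d * B.1 0 j) + c * A.1 i 1 * (d * B.1 1 j) := by ring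
    rw [this]
    exact add_mem (mul_mem (hA _ _) (hB _ _)) (mul_mem (hA _ _) (hB _ _))
  inv_mem' := by
    rintro A ⟨c, hc, hA⟩
    refine ⟨c, hc, fun i j => ?_⟩
    rw [inv_entries]
    fin_cases i <;> fin_cases j <;> simp [hA]

/-- The matrices in `SL₂(ℂ)` with entries in `K`. -/
def matSubgroup : Subgroup SL2 where
  carrier := {A | ∀ i j, A.1 i j ∈ K}
  one_mem' := fun i j => by
    fin_cases i <;> fin_cases j <;> simp [one_mem, zero_mem]
  mul_mem' := by
    rintro A B hA hB i j
    rw [mul_entry]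
    exact add_mem (mul_mem (hA _ _) (hB _ _)) (mul_mem (hA _ _) (hB _ _))
  inv_mem' := by
    rintro A hA i j
    have h00 := hA 0 0
    have h01 := hA 0 1
    have h10 := hA 1 0
    have h11 := hA 1 1
    rw [inv_entries]
    fin_cases i <;> fin_cases j <;> simp [h00, h01, h10, h11]

variable {K}

/-- If cA has entries in K then c² = det(cA) lies in K, and A² = c⁻² (cA)². This is the reason why
Γ², and not Γ, gives a field that the parameters control. -/
lemma sq_mem_matSubgroup {A : SL2} (hA : A ∈ projSubgroup K) : A ^ 2 ∈ matSubgroup K := by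
  obtain ⟨c, hc, h⟩ := hA
  have hdet : c ^ 2 ∈ K := by
    have h1 := det_rel A
    have : c ^ 2 = c * A.1 0 0 * (c * A.1 1 1) - c * A.1 0 1 * (c * A.1 1 0) := by
      linear_combination (-c ^ 2) * h1
    rw [this]
    exact sub_mem (mul_mem (h _ _) (h _ _)) (mul_mem (h _ _) (h _ _))
  intro i j
  rw [sq, mul_entry]
  have : A.1 i 0 * A.1 0 j + A.1 i 1 * A.1 1 j =
      (c ^ 2)⁻¹ * (c * A.1 i 0 * (c * A.1 0 j) + c * A.1 i 1 * (c * A.1 1 j)) := by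
    field_simp
  rw [this]
  exact mul_mem (inv_mem hdet) (add_mem (mul_mem (h _ _) (h _ _)) (mul_mem (h _ _) (h _ _)))

lemma neg_mem_projSubgroup {A : SL2} (hA : A ∈ projSubgroup K) : -A ∈ projSubgroup K := by
  obtain ⟨c, hc, h⟩ := hA
  refine ⟨c, hc, fun i j => ?_⟩
  rw [Matrix.SpecialLinearGroup.coe_neg, Matrix.neg_apply, mul_neg]
  exact neg_mem (h i j)

lemma translation_mem_projSubgroup {u : ℂ} (hu : u ∈ K) : translation u ∈ projSubgroup K :=
  ⟨1, one_ne_zero, fun i j => by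
    rw [translation_val]
    fin_cases i <;> fin_cases j <;> simp [hu, one_mem, zero_mem]⟩

lemma antidiagonal_mem_projSubgroup {N : SL2} {α : ℂ} (hα : α ≠ 0)
    (hN : N.1 = !![0, -α⁻¹; α, 0]) (hK : α ^ 2 ∈ K) : N ∈ projSubgroup K :=
  ⟨α, hα, fun i j => by
    rw [hN]
    rw [sq] at hK
    fin_cases i <;> fin_cases j <;> simp [hα, hK, one_mem, zero_mem]⟩

variable (K) in
/-- The isometries that are represented over `K`, up to scalars, in the frame `A₀`. -/
def rationalSubgroup (A₀ : SL2) : Subgroup PSL2 :=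
  ((projSubgroup K).map (MulAut.conj A₀).toMonoidHom).map toPSL

lemma toPSL_mem_rationalSubgroup {A₀ G : SL2} :
    toPSL G ∈ rationalSubgroup K A₀ ↔ A₀⁻¹ * G * A₀ ∈ projSubgroup K := by
  constructor
  · rintro ⟨_, ⟨N, hN, rfl⟩, h⟩
    have e : ∀ G', A₀⁻¹ * (MulAut.conj A₀).toMonoidHom G' * A₀ = G' := fun G' => by
      simp [mul_assoc]
    rcases toPSL_eq_iff.1 h with rfl | rfl
    · rw [e]; exact hN
    · rw [mul_neg, neg_mul, e]; exact neg_mem_projSubgroup hN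
  · intro h
    exact ⟨_, ⟨_, h, rfl⟩, by simp [mul_assoc]⟩

variable {Γ : Subgroup PSL2} {m : MeridianSystem Γ}

lemma trace_conj (A N : SL2) : (A * N * A⁻¹).1.trace = N.1.trace := by
  have h1 : (A * N * A⁻¹).1 = A.1 * N.1 * (A⁻¹).1 := rfl
  have h2 : (A⁻¹).1 * A.1 = 1 := by
    rw [← Matrix.SpecialLinearGroup.coe_mul, inv_mul_cancel, Matrix.SpecialLinearGroup.coe_one]
  rw [h1, Matrix.trace_mul_comm, ← Matrix.mul_assoc, h2, one_mul]

/-- If a group is represented over `K` up to scalars, its invariant trace field lies in `K`. -/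
theorem invariantTraceField_le {A₀ : SL2} (h : Γ ≤ rationalSubgroup K A₀) :
    invariantTraceField Γ ≤ K := by
  have key : squareSubgroup Γ ≤ ((matSubgroup K).map (MulAut.conj A₀).toMonoidHom).map toPSL := by
    rw [squareSubgroup, Subgroup.closure_le]
    rintro _ ⟨g, hg, rfl⟩
    obtain ⟨G, rfl⟩ := toPSL_surjective g
    have hG := sq_mem_matSubgroup (toPSL_mem_rationalSubgroup.1 (h hg))
    refine ⟨_, ⟨_, hG, rfl⟩, ?_⟩
    rw [← map_pow]
    congr 1
    simp [sq, mul_assoc]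
  rw [invariantTraceField, IntermediateField.adjoin_le_iff]
  rintro _ ⟨A, hA, rfl⟩
  obtain ⟨_, ⟨N, hN, rfl⟩, hNA⟩ := key hA
  have htr : ((MulAut.conj A₀).toMonoidHom N).1.trace ∈ K := by
    have : (MulAut.conj A₀).toMonoidHom N = A₀ * N * A₀⁻¹ := rfl
    rw [this, trace_conj, Matrix.trace_fin_two]
    exact add_mem (hN _ _) (hN _ _)
  rcases toPSL_eq_iff.1 hNA with rfl | rfl
  · exact htr
  · rw [Matrix.SpecialLinearGroup.coe_neg, Matrix.trace_neg]
    exact neg_mem htr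

/-! ## The parameters lie in the invariant trace field -/

lemma trace_mem_invariantTraceField {A : SL2} (hA : toPSL A ∈ squareSubgroup Γ) :
    A.1.trace ∈ invariantTraceField Γ :=
  IntermediateField.subset_adjoin _ _ ⟨A, hA, rfl⟩

lemma IsFrame.sq_mem {P : OnePoint ℂ} {A : SL2} (hA : IsFrame m P A) (hP : IsCusp Γ P) :
    toPSL (A * translation 2 * A⁻¹) ∈ squareSubgroup Γ := by
  refine Subgroup.subset_closure ⟨m.meridian P, m.mem P hP, ?_⟩
  rw [← hA.2, ← map_pow]
  congr 1
  have : translation 2 = translation 1 * translation 1 := by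
    rw [translation_add]; norm_num
  rw [this, sq]; group

/-- The lower triangular matrix with rows `(1, 0)` and `(-x, 1)`. -/
def lowerUnipotent (x : ℂ) : SL2 := ⟨!![1, 0; -x, 1], by simp [Matrix.det_fin_two]⟩

lemma lowerUnipotent_val (x : ℂ) : (lowerUnipotent x).1 = !![1, 0; -x, 1] := rfl

/-- When N is the change from the frame of (P, Q) to that of (Q, P), this computes the square of the
meridian at Q in the frame of (P, Q). -/
lemma antidiagonal_conj {N : SL2} {α : ℂ} (hα : α ≠ 0) (hN : N.1 = !![0, -α⁻¹; α, 0]) :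
    N * translation 2 * N⁻¹ = lowerUnipotent (2 * α ^ 2) := by
  rw [mul_inv_eq_iff_eq_mul]
  ext i j
  rw [mul_entry, mul_entry]
  fin_cases i <;> fin_cases j <;> simp [hN, translation_val, lowerUnipotent_val]
  field_simp

lemma IsFlagFrame.lower_mem {P Q : OnePoint ℂ} {A : SL2} (hA : IsFlagFrame m P Q A)
    (hQ : IsCusp Γ Q) : ∃ B : SL2, ∃ α : ℂ, α ≠ 0 ∧ IsFlagFrame m Q P B ∧
      (A⁻¹ * B).1 = !![0, -α⁻¹; α, 0] ∧
      toPSL (A * lowerUnipotent (2 * α ^ 2) * A⁻¹) ∈ squareSubgroup Γ := by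
  obtain ⟨B, hB⟩ := IsFlagFrame.exists (m := m) hQ hA.ne.symm
  obtain ⟨α, hα, hN⟩ := hA.long hB
  refine ⟨B, α, hα, hB, hN, ?_⟩
  rw [← antidiagonal_conj hα hN]
  convert hB.1.sq_mem hQ using 2
  group

/-- The product of the squared meridians at P and Q is represented by a matrix of trace 2 - 4α². -/
lemma sq_mem_of_isFlagFrame {P Q : OnePoint ℂ} {A B : SL2} {α : ℂ} (hA : IsFlagFrame m P Q A)
    (hB : IsFlagFrame m Q P B) (hα : α ≠ 0) (hN : (A⁻¹ * B).1 = !![0, -α⁻¹; α, 0])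
    (hP : IsCusp Γ P) (hQ : IsCusp Γ Q) : α ^ 2 ∈ invariantTraceField Γ := by
  have hL : toPSL (A * lowerUnipotent (2 * α ^ 2) * A⁻¹) ∈ squareSubgroup Γ := by
    rw [← antidiagonal_conj hα hN]
    convert hB.1.sq_mem hQ using 2
    group
  have h := trace_mem_invariantTraceField
    (show toPSL (A * (translation 2 * lowerUnipotent (2 * α ^ 2)) * A⁻¹) ∈ squareSubgroup Γ by
      convert mul_mem (hA.1.sq_mem hP) hL using 1
      rw [← map_mul]
      congr 1; group)
  rw [trace_conj, Matrix.trace_fin_two, mul_entry, mul_entry] at h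
  simp [translation_val, lowerUnipotent_val] at h
  have e : α ^ 2 = (2 - (1 + -(2 * (2 * α ^ 2)) + 1)) * (4 : ℂ)⁻¹ := by ring
  rw [e]
  exact mul_mem (sub_mem (ofNat_mem _ 2) h) (inv_mem (ofNat_mem _ 4))

/-- In the frame at Q with P at 0 and R at u, let X and Y be the squared meridians at P and R, with
x = 2α² and y = 2β². Multiplying XY by the translation by 2 adds twice its lower left entry to the
trace, that is 2(xyu - x - y). Since x and y are nonzero elements of k(M), so is u recovered inside
k(M). -/
lemma translationParameter_mem {P Q R : OnePoint ℂ} {u : ℂ}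
    (hu : IsTranslationParameter m P Q R u) (hP : IsCusp Γ P) (hQ : IsCusp Γ Q)
    (hR : IsCusp Γ R) : u ∈ invariantTraceField Γ := by
  obtain ⟨A₁, hA₁, x₁, y₁, hx, hy, rfl⟩ := hu
  set u := y₁ - x₁ with hu
  set A := A₁ * translation x₁ with hA
  have hAP : IsFlagFrame m Q P A := hA₁.flagFrame hx
  have hAR : IsFlagFrame m Q R (A * translation u) := by
    have : A * translation u = A₁ * translation y₁ := by
      rw [hA, hu, mul_assoc, translation_add]; congr 2; ring
    rw [this]
    exact hA₁.flagFrame hy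
  obtain ⟨B, α, hα, hB, hN, hLα⟩ := hAP.lower_mem hP
  obtain ⟨C, β, hβ, hC, hN', hLβ⟩ := hAR.lower_mem hR
  have hα2 := sq_mem_of_isFlagFrame hAP hB hα hN hQ hP
  have hβ2 := sq_mem_of_isFlagFrame hAR hC hβ hN' hQ hR
  set x := 2 * α ^ 2 with hx
  set y := 2 * β ^ 2 with hy
  have hxk : x ∈ invariantTraceField Γ := mul_mem (ofNat_mem _ 2) hα2
  have hyk : y ∈ invariantTraceField Γ := mul_mem (ofNat_mem _ 2) hβ2
  have hx0 : x ≠ 0 := by simp [hx, hα]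
  have hy0 : y ≠ 0 := by simp [hy, hβ]
  set Y : SL2 := translation u * lowerUnipotent y * (translation u)⁻¹ with hY
  have hYval : Y.1 = !![1 - u * y, u ^ 2 * y; -y, 1 + u * y] := by
    ext i j
    rw [hY, ← translation_neg, mul_entry, mul_entry, mul_entry]
    fin_cases i <;> fin_cases j <;> simp [translation_val, lowerUnipotent_val] <;> ring
  have h1 := trace_mem_invariantTraceField
    (show toPSL (A * (lowerUnipotent x * Y) * A⁻¹) ∈ squareSubgroup Γ by
      convert mul_mem hLα hLβ using 1
      rw [← map_mul]
      congr 1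
      rw [hY]; group)
  have h2 := trace_mem_invariantTraceField
    (show toPSL (A * (translation 2 * (lowerUnipotent x * Y)) * A⁻¹) ∈ squareSubgroup Γ by
      convert mul_mem (hAP.1.sq_mem hQ) (mul_mem hLα hLβ) using 1
      rw [← map_mul, ← map_mul]
      congr 1
      rw [hY]; group)
  clear_value Y
  rw [trace_conj, Matrix.trace_fin_two] at h1 h2
  simp only [mul_entry] at h1 h2
  simp [translation_val, lowerUnipotent_val, hYval] at h1 h2
  have h3 := sub_mem h2 h1
  have e : u = ((1 - u * y + 2 * (-(x * (1 - u * y)) - y) + (-(x * (u ^ 2 * y)) + (1 + u * y)) -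
      (1 - u * y + (-(x * (u ^ 2 * y)) + (1 + u * y))) + 2 * x + 2 * y) * (2 * (x * y))⁻¹) := by
    field_simp
    ring
  rw [e]
  refine mul_mem (add_mem (add_mem ?_ (mul_mem (ofNat_mem _ 2) hxk)) (mul_mem (ofNat_mem _ 2) hyk))
    (inv_mem (mul_mem (ofNat_mem _ 2) (mul_mem hxk hyk)))
  convert h3 using 1
  ring

lemma intercuspParameter_mem {P Q : OnePoint ℂ} {w : ℂ} (hw : IsIntercuspParameter m P Q w)
    (hP : IsCusp Γ P) (hQ : IsCusp Γ Q) : -w ∈ invariantTraceField Γ := by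
  obtain ⟨A, B, α, hA, hB, hα, hN, rfl⟩ := isIntercuspParameter_iff.1 hw
  rw [neg_neg]
  exact inv_mem (sq_mem_of_isFlagFrame hA hB hα hN hP hQ)

lemma IsShortLabel.translationParameter {P Q R : OnePoint ℂ} {u : ℂ}
    (h : IsShortLabel m P Q R u) : IsTranslationParameter m P Q R u := by
  obtain ⟨A, B, hA, hB, hA0, hB0, hN⟩ := h
  refine ⟨A, hA, 0, u, hA0, ?_, by ring⟩
  have : B = A * translation u := by
    rw [← inv_mul_eq_iff_eq_mul]
    exact Subtype.ext hN
  rw [← hB0, this, toPSL_mul_smul, toPSL_translation_smul, zero_add]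

lemma IsLongLabel.sq_mem {P Q : OnePoint ℂ} {α : ℂ} (h : IsLongLabel m P Q α)
    (hP : IsCusp Γ P) (hQ : IsCusp Γ Q) : α ^ 2 ∈ invariantTraceField Γ := by
  obtain ⟨A, B, hA, hB, hA0, hB0, hN⟩ := h
  have hα : α ≠ 0 := by
    rintro rfl
    have := det_rel (A⁻¹ * B)
    rw [hN] at this
    simp at this
  exact sq_mem_of_isFlagFrame ⟨hA, hA0⟩ ⟨hB, hB0⟩ hα hN hP hQ

/-! ## Frames that are equivalent over a field -/

variable (K m) in
/-- The frame at `P` with `Q` at `0` is equivalent to `A₀` over `K`. -/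
def IsRationalFlag (A₀ : SL2) (P Q : OnePoint ℂ) : Prop :=
  ∃ A, IsFlagFrame m P Q A ∧ A₀⁻¹ * A ∈ projSubgroup K

namespace IsRationalFlag

variable {A₀ : SL2} {P Q R : OnePoint ℂ}

lemma mem_projSubgroup (h : IsRationalFlag K m A₀ P Q) {A : SL2} (hA : IsFlagFrame m P Q A) :
    A₀⁻¹ * A ∈ projSubgroup K := by
  obtain ⟨B, hB, hBK⟩ := h
  rcases hB.unique hA with rfl | rfl
  · exact hBK
  · rw [mul_neg]; exact neg_mem_projSubgroup hBK

lemma of_mem {A B : SL2} (h : A₀⁻¹ * A ∈ projSubgroup K) (hB : IsFlagFrame m P Q B)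
    (hAB : A⁻¹ * B ∈ projSubgroup K) : IsRationalFlag K m A₀ P Q :=
  ⟨B, hB, by convert mul_mem h hAB using 1; group⟩

lemma swap (h : IsRationalFlag K m A₀ P Q)
    (hw : ∃ w, IsIntercuspParameter m P Q w ∧ w ∈ K) : IsRationalFlag K m A₀ Q P := by
  obtain ⟨w, hw, hK⟩ := hw
  obtain ⟨A, B, α, hA, hB, hα, hN, rfl⟩ := isIntercuspParameter_iff.1 hw
  refine of_mem (h.mem_projSubgroup hA) hB (antidiagonal_mem_projSubgroup hα hN ?_)
  simpa using hK

lemma turn (h : IsRationalFlag K m A₀ P Q)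
    (hu : ∃ u, IsTranslationParameter m Q P R u ∧ u ∈ K) : IsRationalFlag K m A₀ P R := by
  obtain ⟨u, ⟨A, hA, x, y, hx, hy, rfl⟩, hK⟩ := hu
  refine of_mem (h.mem_projSubgroup (hA.flagFrame hx)) (hA.flagFrame hy) ?_
  convert translation_mem_projSubgroup hK using 1
  rw [mul_inv_rev, ← translation_neg, mul_assoc, inv_mul_cancel_left, translation_add]
  congr 1; ring

/-- In the frame of the flag the meridian is the translation by 1, which is defined over every
field. -/
lemma meridian_mem (h : IsRationalFlag K m A₀ P Q) :
    m.meridian P ∈ rationalSubgroup K A₀ := by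
  obtain ⟨A, hA, hK⟩ := h
  rw [← hA.1.2, toPSL_mem_rationalSubgroup]
  convert mul_mem (mul_mem hK (translation_mem_projSubgroup (one_mem K))) (inv_mem hK) using 1
  group

lemma smul (h : IsRationalFlag K m A₀ P Q) (hP : IsCusp Γ P) {g : PSL2} (hg : g ∈ Γ)
    (hgK : g ∈ rationalSubgroup K A₀) : IsRationalFlag K m A₀ (g • P) (g • Q) := by
  obtain ⟨A, hA, hK⟩ := h
  obtain ⟨G, rfl⟩ := toPSL_surjective g
  refine ⟨G * A, hA.smul hP hg, ?_⟩
  convert mul_mem (toPSL_mem_rationalSubgroup.1 hgK) hK using 1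
  group

/-- The frames at a flag and at its image under g differ by g on the left, so g is the quotient of
two frames that are both equivalent to A₀. -/
lemma mem_rationalSubgroup (h : IsRationalFlag K m A₀ P Q) (hP : IsCusp Γ P) {g : PSL2}
    (hg : g ∈ Γ) (hgK : IsRationalFlag K m A₀ (g • P) (g • Q)) : g ∈ rationalSubgroup K A₀ := by
  obtain ⟨A, hA, hK⟩ := h
  obtain ⟨G, rfl⟩ := toPSL_surjective g
  rw [toPSL_mem_rationalSubgroup]
  convert mul_mem (hgK.mem_projSubgroup (hA.smul hP hg)) (inv_mem hK) using 1
  group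

end IsRationalFlag

lemma IsTranslationParameter.exists {P Q R : OnePoint ℂ} (hQ : IsCusp Γ Q) (hPQ : Q ≠ P)
    (hQR : Q ≠ R) : ∃ u, IsTranslationParameter m P Q R u := by
  obtain ⟨A, hA⟩ := IsFrame.exists (m := m) hQ
  obtain ⟨x, hx⟩ := hA.exists_coordinate hPQ
  obtain ⟨y, hy⟩ := hA.exists_coordinate hQR
  exact ⟨_, A, hA, x, y, hx, hy, rfl⟩

end CuspedHyp

namespace CuspedHyp

/-! ## Topology of hyperbolic space -/

lemma convex_upperHalfSpace : Convex ℝ {p : ℂ × ℝ | 0 < p.2} :=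
  convex_halfSpace_gt (LinearMap.snd ℝ ℂ ℝ).isLinear 0

lemma isOpen_upperHalfSpace : IsOpen {p : ℂ × ℝ | 0 < p.2} :=
  isOpen_lt continuous_const continuous_snd

instance : PreconnectedSpace H3 :=
  Subtype.preconnectedSpace convex_upperHalfSpace.isPreconnected

instance : LocallyCompactSpace H3 := isOpen_upperHalfSpace.locallyCompactSpace

lemma continuous_denom (A : SL2) : Continuous fun p : H3 => denom A p.1 := by
  unfold denom
  have := Complex.continuous_normSq
  fun_prop

lemma continuous_sl2Act (A : SL2) : Continuous (sl2Act A) := by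
  have hd := continuous_denom A
  have hd' : Continuous fun p : H3 => (denom A p.1 : ℂ) := Complex.continuous_ofReal.comp hd
  have hc : Continuous (starRingEnd ℂ) := Complex.continuous_conj
  refine Continuous.subtype_mk (Continuous.prodMk ?_ ?_) _
  · refine Continuous.div ?_ hd' (fun p => by exact_mod_cast (denom_pos A p).ne')
    fun_prop
  · exact Continuous.div (by fun_prop) hd (fun p => (denom_pos A p).ne')

instance : ContinuousConstSMul PSL2 H3 where
  continuous_const_smul g := by
    obtain ⟨G, rfl⟩ := toPSL_surjective g
    exact continuous_sl2Act G

/-! ## Horoballs and convergence to ideal points -/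

/-- A point of height t in coordinates with P at ∞ has height at most 1 / (|c|² t) in coordinates
with Q at ∞, where c ≠ 0 is the lower left entry of the change of coordinates. The two heights
cannot both be large. -/
lemma exists_disjoint_horoballs {P Q : OnePoint ℂ} (h : P ≠ Q) :
    ∃ B C, IsHoroball P B ∧ IsHoroball Q C ∧ Disjoint B C := by
  obtain ⟨A, hA⟩ := exists_smul_infty_eq P
  obtain ⟨C, hC⟩ := exists_smul_infty_eq Q
  set N := C⁻¹ * A with hN
  have hc : N.1 1 0 ≠ 0 := by
    intro hc
    apply h
    have := toPSL_smul_infty_eq_infty.2 hc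
    rw [hN, toPSL_mul_smul, map_inv, inv_smul_eq_iff, hA, hC] at this
    exact this
  have hpos := Complex.normSq_pos.2 hc
  refine ⟨_, _, ⟨A, 1, one_pos, hA, rfl⟩, ⟨C, (Complex.normSq (N.1 1 0))⁻¹, inv_pos.2 hpos, hC, rfl⟩,
    ?_⟩
  rw [Set.disjoint_left]
  intro x hx hx'
  simp only [Set.mem_ofPred_eq] at hx hx'
  have e : toPSL C⁻¹ • x = sl2Act N (toPSL A⁻¹ • x) := by
    rw [← toPSL_smul, ← toPSL_mul_smul, hN, mul_inv_cancel_right]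
  rw [e] at hx'
  set y := toPSL A⁻¹ • x
  have hden : Complex.normSq (N.1 1 0) * y.1.2 ^ 2 ≤ denom N y.1 := by
    unfold denom
    have := Complex.normSq_nonneg (N.1 1 0 * y.1.1 + N.1 1 1)
    linarith
  have hval : (sl2Act N y).1.2 = y.1.2 / denom N y.1 := rfl
  rw [hval, lt_div_iff₀ (denom_pos N y), inv_mul_lt_iff₀ hpos] at hx'
  have hy := y.2
  nlinarith [mul_pos hpos hy]

lemma IsHoroball.smul {P : OnePoint ℂ} {B : Set H3} (hB : IsHoroball P B) (g : PSL2) :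
    IsHoroball (g • P) {x | g⁻¹ • x ∈ B} := by
  obtain ⟨A, h, h0, hA, rfl⟩ := hB
  obtain ⟨G, rfl⟩ := toPSL_surjective g
  refine ⟨G * A, h, h0, by rw [toPSL_mul_smul, hA], ?_⟩
  ext x
  simp only [Set.mem_ofPred_eq]
  rw [mul_inv_rev, toPSL_mul_smul, map_inv toPSL G]

lemma exists_horoball_disjoint_of_isCompact {K : Set H3} (hK : IsCompact K) (P : OnePoint ℂ) :
    ∃ B, IsHoroball P B ∧ Disjoint B K := by
  obtain ⟨A, hA⟩ := exists_smul_infty_eq P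
  have hcont : Continuous fun x : H3 => (toPSL A⁻¹ • x).1.2 :=
    (continuous_snd.comp continuous_subtype_val).comp (continuous_const_smul _)
  obtain ⟨M, hM⟩ := (hK.image hcont).bddAbove
  refine ⟨_, ⟨A, max M 1, by positivity, hA, rfl⟩, ?_⟩
  rw [Set.disjoint_left]
  intro x hx hxK
  have := hM ⟨x, hxK, rfl⟩
  simp only [Set.mem_ofPred_eq] at hx this
  exact absurd (lt_of_le_of_lt (le_max_left M 1) hx) (not_lt.2 this)

namespace TendsToIdeal

variable {α β : Type*} {l l' : Filter α} {φ ψ : α → H3} {P Q : OnePoint ℂ}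

lemma eq [l.NeBot] (hP : TendsToIdeal l φ P) (hQ : TendsToIdeal l φ Q) : P = Q := by
  by_contra h
  obtain ⟨B, C, hB, hC, hBC⟩ := exists_disjoint_horoballs h
  obtain ⟨t, ht, ht'⟩ := ((hP B hB).and (hQ C hC)).exists
  exact Set.disjoint_left.1 hBC ht ht'

lemma smul (hP : TendsToIdeal l φ P) (g : PSL2) : TendsToIdeal l (fun t => g • φ t) (g • P) := by
  intro B hB
  have h := hB.smul g⁻¹
  rw [inv_smul_smul] at h
  filter_upwards [hP _ h] with t ht
  simpa using ht

lemma mono (hP : TendsToIdeal l φ P) (h : l' ≤ l) : TendsToIdeal l' φ P :=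
  fun B hB => h (hP B hB)

lemma congr (hP : TendsToIdeal l φ P) (h : φ =ᶠ[l] ψ) : TendsToIdeal l ψ P := by
  intro B hB
  filter_upwards [hP B hB, h] with t ht h
  rwa [← h]

lemma comp {k : Filter β} {u : β → α} (hP : TendsToIdeal l φ P) (hu : Tendsto u k l) :
    TendsToIdeal k (φ ∘ u) P :=
  fun B hB => hu (hP B hB)

lemma not_le_nhds [l.NeBot] (hP : TendsToIdeal l φ P) {x : H3} (h : Tendsto φ l (𝓝 x)) : False := by
  obtain ⟨K, hK, hKx⟩ := exists_compact_mem_nhds x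
  obtain ⟨B, hB, hBK⟩ := exists_horoball_disjoint_of_isCompact hK P
  obtain ⟨t, ht, ht'⟩ := ((hP B hB).and (h hKx)).exists
  exact Set.disjoint_left.1 hBK ht ht'

end TendsToIdeal

end CuspedHyp

namespace CuspedHyp

/-! ## Ideal triangulations -/

variable {Γ : Subgroup PSL2} {m : MeridianSystem Γ} {K : IntermediateField ℚ ℂ}

lemma IsFlagFrame.neg {P Q : OnePoint ℂ} {A : SL2} (hA : IsFlagFrame m P Q A) :
    IsFlagFrame m P Q (-A) := by
  obtain ⟨⟨h1, h2⟩, h3⟩ := hA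
  refine ⟨⟨?_, ?_⟩, ?_⟩
  · rw [toPSL_neg, h1]
  · rw [← h2]
    simp only [map_mul, map_inv, toPSL_neg]
  · rw [toPSL_neg, h3]

lemma IsFlagFrame.exists_shortLabel {P Q R : OnePoint ℂ} {A : SL2} (hA : IsFlagFrame m Q P A)
    (hQ : IsCusp Γ Q) (hQR : Q ≠ R) : ∃ u, IsShortLabel m P Q R u := by
  obtain ⟨B, hB⟩ := IsFlagFrame.exists (m := m) hQ hQR
  obtain ⟨u, hu | hu⟩ := hA.1.unique hB.1
  · exact ⟨u, A, B, hA.1, hB.1, hA.2, hB.2, congrArg Subtype.val hu⟩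
  · refine ⟨u, A, -B, hA.1, hB.neg.1, hA.2, hB.neg.2, ?_⟩
    have : A⁻¹ * -B = translation u := by rw [mul_neg, hu, neg_neg]
    exact congrArg Subtype.val this

lemma IsRationalFlag.smul_iff {A₀ G : SL2} {P Q : OnePoint ℂ} (hP : IsCusp Γ P)
    (hG : toPSL G ∈ Γ) :
    IsRationalFlag K m A₀ (toPSL G • P) (toPSL G • Q) ↔ IsRationalFlag K m (G⁻¹ * A₀) P Q := by
  constructor
  · rintro ⟨A, hA, hK⟩
    have h := hA.smul (G := G⁻¹) (hP.smul hG) (by rw [map_inv]; exact inv_mem hG)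
    rw [map_inv, inv_smul_smul, inv_smul_smul] at h
    refine ⟨_, h, ?_⟩
    convert hK using 1
    group
  · rintro ⟨A, hA, hK⟩
    refine ⟨_, hA.smul hP hG, ?_⟩
    convert hK using 1
    group

namespace IdealTriangulation

variable (T : IdealTriangulation Γ)

/-- Swapping a flag and turning it around its first vertex generate all ordered pairs of vertices of
a tetrahedron, and each move costs one label. -/
lemma rationalFlag_of_rationalFlag {A₀ : SL2} (hK : T.zickertParameters m ⊆ K) (i : Fin T.n)
    {a b c d : Fin 4} (hab : a ≠ b) (hcd : c ≠ d)
    (h : IsRationalFlag K m A₀ (T.vertex i a) (T.vertex i b)) :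
    IsRationalFlag K m A₀ (T.vertex i c) (T.vertex i d) := by
  have turn : ∀ {a b c : Fin 4}, a ≠ b → a ≠ c →
      IsRationalFlag K m A₀ (T.vertex i a) (T.vertex i b) →
      IsRationalFlag K m A₀ (T.vertex i a) (T.vertex i c) := by
    intro a b c hab hac h
    by_cases hbc : b = c
    · rwa [← hbc]
    obtain ⟨A, hA, -⟩ := id h
    obtain ⟨u, hu⟩ := hA.exists_shortLabel (T.isCusp i a) ((T.vertex_injective i).ne hac)
    exact h.turn ⟨u, hu.translationParameter, hK (Or.inr ⟨i, b, a, c, hab.symm, hac, hbc, hu⟩)⟩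
  have swap : ∀ {a b : Fin 4}, a ≠ b →
      IsRationalFlag K m A₀ (T.vertex i a) (T.vertex i b) →
      IsRationalFlag K m A₀ (T.vertex i b) (T.vertex i a) := by
    intro a b hab h
    obtain ⟨A, hA, -⟩ := id h
    obtain ⟨B, hB⟩ := IsFlagFrame.exists (m := m) (T.isCusp i b) ((T.vertex_injective i).ne hab.symm)
    obtain ⟨α, hα, hN⟩ := hA.long hB
    refine h.swap ⟨_, isIntercuspParameter_iff.2 ⟨A, B, α, hA, hB, hα, hN, rfl⟩, ?_⟩
    exact neg_mem (inv_mem (hK (Or.inl ⟨i, a, b, hab, α, ⟨A, B, hA.1, hB.1, hA.2, hB.2, hN⟩, rfl⟩)))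
  by_cases hca : c = a
  · subst hca
    exact turn hab hcd h
  · exact turn hca hcd (swap (Ne.symm hca) (turn hab (Ne.symm hca) h))

lemma single_mem_of_not_mem_idealSimplex {x : Fin 4 → ℝ} (hx : x ∈ stdSimplex ℝ (Fin 4))
    (h : x ∉ idealSimplex) : ∃ k, x = Pi.single k 1 := by
  obtain ⟨k, hk⟩ : ∃ k, x k = 1 := by
    by_contra! h'
    exact h ⟨hx, h'⟩
  refine ⟨k, funext fun l => ?_⟩
  by_cases hl : l = k
  · subst hl; simp [hk]
  · rw [Pi.single_eq_of_ne hl]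
    have h1 := hx.2
    rw [← Finset.add_sum_erase _ _ (Finset.mem_univ k), hk] at h1
    have h2 : ∑ j ∈ Finset.univ.erase k, x j = 0 := by linarith
    exact (Finset.sum_eq_zero_iff_of_nonneg fun j _ => hx.1 j).1 h2 l
      (Finset.mem_erase.2 ⟨hl, Finset.mem_univ _⟩)

/-- The closed simplex is compact, so an ultrafilter on the ideal simplex has a limit in it. If the
limit is a vertex, the image runs into a cusp and cannot converge in H3. -/
lemma isClosed_image (i : Fin T.n) : IsClosed (T.map i '' idealSimplex) := by
  rw [← closure_subset_iff_isClosed]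
  intro y hy
  obtain ⟨u, hu, huy⟩ := mem_closure_iff_ultrafilter.1 hy
  let v := Ultrafilter.ofComapInfPrincipal hu
  have hvS : idealSimplex ∈ v := Ultrafilter.ofComapInfPrincipal_mem hu
  have hvu : v.map (T.map i) = u := Ultrafilter.ofComapInfPrincipal_eq_of_map hu
  have hty : Tendsto (T.map i) v (𝓝 y) := by
    have : ((v.map (T.map i) : Ultrafilter H3) : Filter H3) ≤ 𝓝 y := by rw [hvu]; exact huy
    exact this
  obtain ⟨x, hx, hvx⟩ := (isCompact_stdSimplex ℝ (Fin 4)).ultrafilter_le_nhds v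
    (le_principal_iff.2 (mem_of_superset hvS fun x hx => hx.1))
  have hvx' : (v : Filter _) ≤ 𝓝[idealSimplex] x := le_inf hvx (le_principal_iff.2 hvS)
  by_cases hxS : x ∈ idealSimplex
  · exact ⟨x, hxS, tendsto_nhds_unique ((T.continuousOn i x hxS).mono_left hvx') hty⟩
  · obtain ⟨k, rfl⟩ := single_mem_of_not_mem_idealSimplex hx hxS
    exact (((T.tendsTo i k).mono hvx').not_le_nhds hty).elim

/-- The points near the vertex `k` on the segment from it to `x`. -/
lemma tendsto_segment {x : Fin 4 → ℝ} (hx : x ∈ idealSimplex) (k : Fin 4) :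
    Tendsto (fun ε : ℝ => (1 - ε) • (Pi.single k 1 : Fin 4 → ℝ) + ε • x) (𝓝[>] 0)
      (𝓝[idealSimplex] (Pi.single k 1)) := by
  refine tendsto_nhdsWithin_iff.2 ⟨?_, ?_⟩
  · have : Continuous fun ε : ℝ => (1 - ε) • (Pi.single k 1 : Fin 4 → ℝ) + ε • x := by fun_prop
    have h := this.tendsto 0
    simp only [sub_zero, one_smul, zero_smul, add_zero] at h
    exact h.mono_left nhdsWithin_le_nhds
  · have h1 : ∀ᶠ ε : ℝ in 𝓝[>] 0, ε < 1 := nhdsWithin_le_nhds (Iio_mem_nhds one_pos)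
    filter_upwards [h1, self_mem_nhdsWithin] with ε h1 h0
    have h0 : 0 < ε := h0
    refine ⟨convex_stdSimplex ℝ (Fin 4) (single_mem_stdSimplex ℝ k) hx.1 (by linarith) h0.le
      (by ring), fun l => ?_⟩
    have hl : x l < 1 := lt_of_le_of_ne (by
      rw [← hx.1.2]
      exact Finset.single_le_sum (fun j _ => hx.1.1 j) (Finset.mem_univ l)) (hx.2 l)
    have hl0 := hx.1.1 l
    by_cases hlk : l = k
    · subst hlk
      simp only [Pi.add_apply, Pi.smul_apply, Pi.single_eq_same, smul_eq_mul]
      nlinarith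
    · simp only [Pi.add_apply, Pi.smul_apply, Pi.single_eq_of_ne hlk, smul_eq_mul]
      nlinarith

/-- A point of an ideal simplex is not a vertex, so the face that carries it has at least two
vertices, and the two lifts are identified along this whole face. -/
lemma exists_common_edge {i j : Fin T.n} {g h : PSL2} (hg : g ∈ Γ) (hh : h ∈ Γ)
    {x y : Fin 4 → ℝ} (hx : x ∈ idealSimplex) (hy : y ∈ idealSimplex)
    (hxy : g • T.map i x = h • T.map j y) :
    ∃ a b c d, a ≠ b ∧ c ≠ d ∧ g • T.vertex i a = h • T.vertex j c ∧
      g • T.vertex i b = h • T.vertex j d := by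
  have hxy' : T.map i x = (g⁻¹ * h) • T.map j y := by
    rw [mul_smul, ← hxy, inv_smul_smul]
  obtain ⟨σ, rfl, hface⟩ := T.face_to_face i j _ (mul_mem (inv_mem hg) hh) x hx y hy hxy'
  -- The segment from the vertex k to x stays in the face carrying x, where the two maps agree. Near
  -- its end it runs into an ideal vertex of either tetrahedron, and limits at infinity are unique.
  have key : ∀ k, x k ≠ 0 → g • T.vertex i k = h • T.vertex j (σ.symm k) := by
    intro k hk
    have h1 := (T.tendsTo i k).comp (tendsto_segment hx k)
    have h2 := ((T.tendsTo j (σ.symm k)).comp (tendsto_segment hy (σ.symm k))).smul (g⁻¹ * h)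
    have hmem : ∀ᶠ ε in 𝓝[>] (0 : ℝ),
        (1 - ε) • (Pi.single k 1 : Fin 4 → ℝ) + ε • x ∈ idealSimplex :=
      (tendsto_nhdsWithin_iff.1 (tendsto_segment hx k)).2
    have h3 : TendsToIdeal (𝓝[>] 0) (T.map i ∘ fun ε : ℝ =>
        (1 - ε) • (Pi.single k 1 : Fin 4 → ℝ) + ε • x) ((g⁻¹ * h) • T.vertex j (σ.symm k)) := by
      refine h2.congr ?_
      filter_upwards [hmem] with ε hε
      simp only [Function.comp_apply]
      rw [hface _ hε]
      · congr 2
        funext l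
        simp [Pi.single_apply, Equiv.eq_symm_apply]
      · intro l hl
        have : l ≠ k := by rintro rfl; exact hk hl
        simp [hl, this]
    have := h1.eq h3
    rw [this, mul_smul, smul_inv_smul]
  obtain ⟨a, ha⟩ : ∃ a, x a ≠ 0 := by
    by_contra! h0
    have := hx.1.2
    simp [h0] at this
  obtain ⟨b, hab, hb⟩ : ∃ b, a ≠ b ∧ x b ≠ 0 := by
    by_contra! h0
    have := hx.1.2
    rw [← Finset.add_sum_erase _ _ (Finset.mem_univ a),
      Finset.sum_eq_zero fun l hl => h0 l (Finset.ne_of_mem_erase hl).symm, add_zero] at this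
    exact hx.2 a this
  exact ⟨a, b, _, _, hab, σ.symm.injective.ne hab, key a ha, key b hb⟩

/-- The unions of the rational and of the remaining tetrahedra are closed, by local finiteness, and
cover the connected space H3. If both were nonempty they would meet, but rationality passes between
tetrahedra that meet, along a common edge. -/
theorem le_rationalSubgroup (hK : T.zickertParameters m ⊆ K) :
    ∃ A₀, Γ ≤ rationalSubgroup K A₀ := by
  obtain ⟨_, -, i₀, p₀, hp₀, -⟩ := T.covers ⟨(0, 1), one_pos⟩
  obtain ⟨A₀, hA₀⟩ := IsFlagFrame.exists (m := m) (T.isCusp i₀ 0)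
    ((T.vertex_injective i₀).ne (show (0 : Fin 4) ≠ 1 by decide))
  refine ⟨A₀, ?_⟩
  let C : Γ × Fin T.n → Set H3 := fun q => (fun x => (q.1 : PSL2) • x) '' (T.map q.2 '' idealSimplex)
  let Rat : Γ × Fin T.n → Prop := fun q =>
    IsRationalFlag K m A₀ ((q.1 : PSL2) • T.vertex q.2 0) ((q.1 : PSL2) • T.vertex q.2 1)
  have all : ∀ q : Γ × Fin T.n, ∀ a b c d, a ≠ b → c ≠ d →
      IsRationalFlag K m A₀ ((q.1 : PSL2) • T.vertex q.2 a) ((q.1 : PSL2) • T.vertex q.2 b) →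
      IsRationalFlag K m A₀ ((q.1 : PSL2) • T.vertex q.2 c) ((q.1 : PSL2) • T.vertex q.2 d) := by
    rintro ⟨⟨g, hg⟩, i⟩ a b c d hab hcd h
    obtain ⟨G, rfl⟩ := toPSL_surjective g
    simp only at h ⊢
    rw [IsRationalFlag.smul_iff (T.isCusp _ _) hg] at h ⊢
    exact T.rationalFlag_of_rationalFlag hK i hab hcd h
  have hclosed : ∀ q, IsClosed (C q) := fun q =>
    (Homeomorph.smul (q.1 : PSL2)).isClosedMap _ (T.isClosed_image q.2)
  have hfin : LocallyFinite C := by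
    intro x
    obtain ⟨N, hN, hNx⟩ := exists_compact_mem_nhds x
    refine ⟨N, hNx, (T.locallyFinite N hN).subset ?_⟩
    rintro q ⟨_, ⟨_, ⟨p, hp, rfl⟩, rfl⟩, hpN⟩
    exact ⟨p, hp, hpN⟩
  have hRatC : ∀ q q' x, x ∈ C q → x ∈ C q' → Rat q → Rat q' := by
    rintro q q' _ ⟨_, ⟨x, hx, rfl⟩, rfl⟩ ⟨_, ⟨y, hy, rfl⟩, hxy⟩ h
    obtain ⟨a, b, c, d, hab, hcd, e1, e2⟩ :=
      T.exists_common_edge q.1.2 q'.1.2 hx hy hxy.symm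
    have := all q 0 1 a b (by decide) hab h
    rw [e1, e2] at this
    exact all q' c d 0 1 hcd (by decide) this
  have hone : Rat (1, i₀) := by
    refine ⟨A₀, by simpa using hA₀, ?_⟩
    rw [inv_mul_cancel]; exact one_mem _
  have hcl : ∀ s : Set (Γ × Fin T.n), IsClosed (⋃ q : s, C q) := fun s =>
    (hfin.comp_injective Subtype.val_injective).isClosed_iUnion fun q => hclosed q
  have hcov : (univ : Set H3) ⊆ (⋃ q : {q | Rat q}, C q) ∪ (⋃ q : {q | ¬ Rat q}, C q) := by
    intro x _
    obtain ⟨g, hg, i, p, hp, hx⟩ := T.covers x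
    have hxC : x ∈ C (⟨g, hg⟩, i) := ⟨_, ⟨p, hp, rfl⟩, hx⟩
    by_cases h : Rat (⟨g, hg⟩, i)
    · exact Or.inl (mem_iUnion.2 ⟨⟨_, h⟩, hxC⟩)
    · exact Or.inr (mem_iUnion.2 ⟨⟨_, h⟩, hxC⟩)
  have hall : ∀ q, Rat q := by
    intro q
    by_contra hq
    have hne1 : ((univ : Set H3) ∩ ⋃ q : {q | Rat q}, C q).Nonempty :=
      ⟨_, trivial, mem_iUnion.2 ⟨⟨_, hone⟩, ⟨_, ⟨p₀, hp₀, rfl⟩, rfl⟩⟩⟩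
    have hne2 : ((univ : Set H3) ∩ ⋃ q : {q | ¬ Rat q}, C q).Nonempty :=
      ⟨_, trivial, mem_iUnion.2 ⟨⟨q, hq⟩, ⟨_, ⟨p₀, hp₀, rfl⟩, rfl⟩⟩⟩
    obtain ⟨x, -, hx1, hx2⟩ := isPreconnected_closed_iff.1 isPreconnected_univ _ _
      (hcl _) (hcl _) hcov hne1 hne2
    obtain ⟨⟨q1, h1⟩, hx1⟩ := mem_iUnion.1 hx1
    obtain ⟨⟨q2, h2⟩, hx2⟩ := mem_iUnion.1 hx2
    exact h2 (hRatC _ _ _ hx1 hx2 h1)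
  intro g hg
  have h1 : IsRationalFlag K m A₀ (T.vertex i₀ 0) (T.vertex i₀ 1) := by simpa [Rat] using hone
  exact h1.mem_rationalSubgroup (T.isCusp _ _) hg (hall (⟨g, hg⟩, i₀))

theorem adjoin_zickertParameters :
    IntermediateField.adjoin ℚ (T.zickertParameters m) = invariantTraceField Γ := by
  refine le_antisymm ?_ ?_
  · rw [IntermediateField.adjoin_le_iff]
    rintro x (⟨i, a, b, -, α, hα, rfl⟩ | ⟨i, a, b, c, -, -, -, hu⟩)
    · exact hα.sq_mem (T.isCusp _ _) (T.isCusp _ _)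
    · exact translationParameter_mem hu.translationParameter (T.isCusp _ _) (T.isCusp _ _)
        (T.isCusp _ _)
  · obtain ⟨A₀, h⟩ := T.le_rationalSubgroup (m := m) (IntermediateField.subset_adjoin ℚ _)
    exact invariantTraceField_le h

end IdealTriangulation

end CuspedHyp

namespace CuspedHyp

/-! ### The quotient map from H3 to M as a covering with group Γ -/

instance (Γ : Subgroup PSL2) : ContinuousConstSMul Γ H3 :=
  ⟨fun g => continuous_const_smul (g : PSL2)⟩

lemma IsFiniteVolumeManifoldGroup.isQuotientCoveringMap {Γ : Subgroup PSL2}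
    (hΓ : IsFiniteVolumeManifoldGroup Γ) : IsQuotientCoveringMap (toManifold Γ) Γ := by
  have := hΓ.properlyDiscontinuous
  have : IsCancelSMul Γ H3 := isCancelSMul_iff_eq_one_of_smul_eq.2 fun g x hx =>
    Subtype.ext (hΓ.free g g.2 x hx)
  exact isQuotientCoveringMap_quotientMk_of_properlyDiscontinuousSMul (G := Γ) (E := H3)

namespace LinkDiagram

/-! ## Lifts to the universal covering -/

variable {D : LinkDiagram} {Γ : Subgroup PSL2} (f : Manifold Γ ≃ₜ D.Complement)

/-- The universal covering of the link complement. -/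
def proj (x : H3) : D.Complement := f (toManifold Γ x)

lemma cover_eq (x : H3) : cover f x = (proj f x).1 := rfl

lemma isQuotientCoveringMap_proj (hΓ : IsFiniteVolumeManifoldGroup Γ) :
    IsQuotientCoveringMap (proj f) Γ :=
  hΓ.isQuotientCoveringMap.homeomorph_comp f

lemma cover_smul {g : PSL2} (hg : g ∈ Γ) (x : H3) : cover f (g • x) = cover f x := by
  have : toManifold Γ (g • x) = toManifold Γ x := Quotient.sound ⟨⟨g, hg⟩, rfl⟩
  simp only [cover, this]

lemma exists_smul_eq_of_cover_eq {x y : H3} (h : cover f x = cover f y) :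
    ∃ g ∈ Γ, y = g • x := by
  have h1 : toManifold Γ y = toManifold Γ x := (f.injective (Subtype.ext h)).symm
  obtain ⟨g, hg⟩ := Quotient.exact h1
  exact ⟨g, g.2, hg.symm⟩

lemma exists_cover_eq {p : OnePoint (ℂ × ℝ)}
    (hp : p ∉ (fun x : ℂ × ℝ => (x : OnePoint (ℂ × ℝ))) '' D.link) : ∃ x, cover f x = p := by
  obtain ⟨y, hy⟩ := f.surjective ⟨p, hp⟩
  obtain ⟨x, rfl⟩ := Quotient.exists_rep y
  exact ⟨x, congrArg Subtype.val hy⟩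

lemma exists_cover_eq_coe {p : ℂ × ℝ} (hp : p ∉ D.link) : ∃ x, cover f x = p :=
  exists_cover_eq f (by
    rintro ⟨q, hq, h⟩
    exact hp (OnePoint.coe_injective h ▸ hq))

lemma not_mem_link_of_cover_eq {x : H3} {p : ℂ × ℝ} (h : cover f x = p) : p ∉ D.link :=
  fun hp => (proj f x).2 ⟨p, hp, h.symm⟩

lemma smul_injective_of_mem (hΓ : IsFiniteVolumeManifoldGroup Γ) {g h : PSL2} (hg : g ∈ Γ)
    (hh : h ∈ Γ) {x : H3} (e : g • x = h • x) : g = h := by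
  have := hΓ.free (h⁻¹ * g) (mul_mem (inv_mem hh) hg) x (by rw [mul_smul, e, inv_smul_smul])
  exact (inv_mul_eq_one.1 this).symm

lemma continuous_cover (hΓ : IsFiniteVolumeManifoldGroup Γ) : Continuous (cover f) :=
  continuous_subtype_val.comp (isQuotientCoveringMap_proj f hΓ).continuous

variable {Y Z : Type*}

/-- `S` lifts `φ : Y → ℝ³ ∖ L` to `H3` on the set `U`. -/
def IsLiftOn [TopologicalSpace Y] (φ : Y → ℂ × ℝ) (U : Set Y) (S : Y → H3) : Prop :=
  ContinuousOn S U ∧ ∀ u ∈ U, cover f (S u) = φ u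

variable {f}

namespace IsLiftOn

variable [TopologicalSpace Y] [TopologicalSpace Z] {φ : Y → ℂ × ℝ} {U V : Set Y} {S S' : Y → H3}

lemma mono (h : IsLiftOn f φ U S) (hVU : V ⊆ U) : IsLiftOn f φ V S :=
  ⟨h.1.mono hVU, fun u hu => h.2 u (hVU hu)⟩

lemma comp (h : IsLiftOn f φ U S) {ψ : Z → Y} {V : Set Z} (hψ : ContinuousOn ψ V)
    (hV : MapsTo ψ V U) : IsLiftOn f (φ ∘ ψ) V (S ∘ ψ) :=
  ⟨h.1.comp hψ hV, fun _ hu => h.2 _ (hV hu)⟩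

lemma smul (h : IsLiftOn f φ U S) {g : PSL2} (hg : g ∈ Γ) :
    IsLiftOn f φ U fun u => g • S u :=
  ⟨h.1.const_smul g, fun u hu => (cover_smul f hg _).trans (h.2 u hu)⟩

lemma exists_smul (h : IsLiftOn f φ U S) (h' : IsLiftOn f φ U S') {u : Y} (hu : u ∈ U) :
    ∃ g ∈ Γ, S' u = g • S u :=
  exists_smul_eq_of_cover_eq f ((h.2 u hu).trans (h'.2 u hu).symm)

lemma eqOn (hΓ : IsFiniteVolumeManifoldGroup Γ) (hU : IsPreconnected U) (h : IsLiftOn f φ U S)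
    (h' : IsLiftOn f φ U S') {u : Y} (hu : u ∈ U) (e : S' u = S u) : EqOn S' S U := by
  refine (isQuotientCoveringMap_proj f hΓ).isCoveringMap.eqOn_of_comp_eqOn hU h'.1 h.1 ?_ hu e
  intro v hv
  exact Subtype.ext ((h'.2 v hv).trans (h.2 v hv).symm)

lemma eqOn_smul (hΓ : IsFiniteVolumeManifoldGroup Γ) (hU : IsPreconnected U)
    (h : IsLiftOn f φ U S) (h' : IsLiftOn f φ U S') {g : PSL2} (hg : g ∈ Γ) {u : Y} (hu : u ∈ U)
    (e : S' u = g • S u) {v : Y} (hv : v ∈ U) : S' v = g • S v :=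
  (h.smul hg).eqOn hΓ hU h' hu e hv

end IsLiftOn

lemma IsLiftOn.exists [TopologicalSpace Y] [LocallyPathConnectedSpace Y]
    (hΓ : IsFiniteVolumeManifoldGroup Γ) {φ : Y → ℂ × ℝ} {U : Set Y} (hU : IsOpen U)
    [SimplyConnectedSpace U] (hφ : ContinuousOn φ U) (hφL : ∀ u ∈ U, φ u ∉ D.link) {u₀ : Y}
    (hu₀ : u₀ ∈ U) {x₀ : H3} (hx₀ : cover f x₀ = φ u₀) :
    ∃ S, IsLiftOn f φ U S ∧ S u₀ = x₀ := by
  have := hU.locallyPathConnectedSpace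
  have hφU : ∀ u : U, (φ u : OnePoint (ℂ × ℝ)) ∉
      (fun x : ℂ × ℝ => (x : OnePoint (ℂ × ℝ))) '' D.link := by
    rintro u ⟨q, hq, h⟩
    exact hφL u u.2 (OnePoint.coe_injective h ▸ hq)
  let F : C(U, D.Complement) := ⟨fun u => ⟨(φ u : OnePoint (ℂ × ℝ)), hφU u⟩,
    Continuous.subtype_mk (OnePoint.continuous_coe.comp hφ.domRestrict) hφU⟩
  obtain ⟨G, ⟨hG, hGF⟩, -⟩ :=
    (isQuotientCoveringMap_proj f hΓ).isCoveringMap.existsUnique_continuousMap_lifts F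
      ⟨u₀, hu₀⟩ x₀ (Subtype.ext hx₀)
  classical
  refine ⟨fun u => if h : u ∈ U then G ⟨u, h⟩ else x₀, ⟨?_, ?_⟩, ?_⟩
  · rw [continuousOn_iff_continuous_domRestrict]
    convert G.continuous using 1
    funext u
    simp
  · intro u hu
    simp only [hu, dif_pos]
    exact congrArg Subtype.val (congrFun hGF ⟨u, hu⟩)
  · simp only [hu₀, dif_pos]
    exact hG

lemma IsLiftOn.exists_of_convex [AddCommGroup Y] [Module ℝ Y] [TopologicalSpace Y]
    [IsTopologicalAddGroup Y] [ContinuousSMul ℝ Y] [LocallyPathConnectedSpace Y]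
    (hΓ : IsFiniteVolumeManifoldGroup Γ) {φ : Y → ℂ × ℝ} {U : Set Y} (hU : IsOpen U)
    (hconv : Convex ℝ U) (hφ : ContinuousOn φ U) (hφL : ∀ u ∈ U, φ u ∉ D.link) {u₀ : Y}
    (hu₀ : u₀ ∈ U) {x₀ : H3} (hx₀ : cover f x₀ = φ u₀) :
    ∃ S, IsLiftOn f φ U S ∧ S u₀ = x₀ := by
  have := hconv.contractibleSpace ⟨u₀, hu₀⟩
  exact IsLiftOn.exists hΓ hU hφ hφL hu₀ hx₀

end LinkDiagram

end CuspedHyp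

namespace CuspedHyp

namespace LinkDiagram

variable (D : LinkDiagram)

/-! ## Geometry of polygonal diagrams -/

/-- The point with parameter `t` on the line through segment `i`. -/
def seg (i : Fin D.n) (t : ℝ) : ℂ × ℝ := AffineMap.lineMap (D.vert i) (D.vert (D.next i)) t

/-- The projection of the direction of segment `i`. -/
def dir (i : Fin D.n) : ℂ := (D.vert (D.next i)).1 - (D.vert i).1

/-- The slope of segment `i`. -/
def rise (i : Fin D.n) : ℝ := (D.vert (D.next i)).2 - (D.vert i).2

/-- The complex coordinate of the plane in which segment `i` is the unit interval. -/
def coord (i : Fin D.n) (z : ℂ) : ℂ := (z - (D.vert i).1) / D.dir i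

variable {D}

lemma seg_fst (i : Fin D.n) (t : ℝ) : (D.seg i t).1 = (D.vert i).1 + t * D.dir i := by
  simp only [seg, AffineMap.lineMap_apply, dir]
  simp [add_comm]

lemma seg_snd (i : Fin D.n) (t : ℝ) : (D.seg i t).2 = (D.vert i).2 + t * D.rise i := by
  simp only [seg, AffineMap.lineMap_apply, rise]
  simp [add_comm]

lemma seg_zero (i : Fin D.n) : D.seg i 0 = D.vert i := by simp [seg]

lemma seg_one (i : Fin D.n) : D.seg i 1 = D.seg (D.next i) 0 := by simp [seg]

lemma pt_eq_seg (a : D.Param) : D.pt a = D.seg a.1 a.2 := rfl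

lemma continuous_seg (i : Fin D.n) : Continuous (D.seg i) := by
  unfold seg; exact AffineMap.lineMap_continuous

/-- On a vertical segment an interior point would project to the initial vertex, against
`vertex_regular`. -/
lemma dir_ne_zero (i : Fin D.n) : D.dir i ≠ 0 := by
  intro h
  have := D.vertex_regular i i (1 / 2) ⟨by norm_num, by norm_num⟩ (by simp)
  apply this
  have h1 := seg_fst i (1 / 2)
  rw [h, mul_zero, add_zero] at h1
  exact h1

lemma coord_seg (i : Fin D.n) (t : ℝ) : D.coord i (D.seg i t).1 = t := by
  rw [coord, seg_fst, add_sub_cancel_left, mul_div_cancel_right₀ _ (dir_ne_zero i)]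

lemma continuous_coord (i : Fin D.n) : Continuous (D.coord i) := by
  unfold coord; fun_prop

lemma eq_of_coord (i : Fin D.n) (z : ℂ) : z = (D.vert i).1 + D.coord i z * D.dir i := by
  rw [coord, div_mul_cancel₀ _ (dir_ne_zero i)]; ring

lemma coord_injective (i : Fin D.n) : Function.Injective (D.coord i) := by
  intro z z' h
  rw [eq_of_coord i z, h, ← eq_of_coord]

lemma coord_add (i : Fin D.n) (z w : ℂ) : D.coord i (z + w) = D.coord i z + w / D.dir i := by
  simp only [coord]; ring

lemma exists_pt_eq_seg (i : Fin D.n) {t : ℝ} (ht : t ∈ Icc (0 : ℝ) 1) :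
    ∃ a : D.Param, a.2 ∈ Ico (0 : ℝ) 1 ∧ D.pt a = D.seg i t ∧
      (a = (i, t) ∨ a = (D.next i, 0)) := by
  rcases lt_or_eq_of_le ht.2 with h | rfl
  · exact ⟨(i, t), ⟨ht.1, h⟩, rfl, Or.inl rfl⟩
  · exact ⟨(D.next i, 0), by simp, (seg_one i).symm, Or.inr rfl⟩

lemma mem_link_iff {p : ℂ × ℝ} : p ∈ D.link ↔ ∃ i, ∃ t ∈ Icc (0 : ℝ) 1, D.seg i t = p := by
  constructor
  · rintro ⟨a, ha, rfl⟩
    exact ⟨a.1, a.2, Ico_subset_Icc_self ha, rfl⟩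
  · rintro ⟨i, t, ht, rfl⟩
    obtain ⟨a, ha, h, -⟩ := exists_pt_eq_seg i ht
    exact ⟨a, ha, h⟩

lemma mem_shadow_iff {z : ℂ} : z ∈ D.shadow ↔ ∃ i, ∃ t ∈ Icc (0 : ℝ) 1, (D.seg i t).1 = z := by
  constructor
  · rintro ⟨p, hp, rfl⟩
    obtain ⟨i, t, ht, rfl⟩ := mem_link_iff.1 hp
    exact ⟨i, t, ht, rfl⟩
  · rintro ⟨i, t, ht, rfl⟩
    exact ⟨_, mem_link_iff.2 ⟨i, t, ht, rfl⟩, rfl⟩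

variable (D) in
lemma isCompact_link : IsCompact D.link := by
  have : D.link = ⋃ i, D.seg i '' Icc 0 1 := by
    ext p
    simp [mem_link_iff]
  rw [this]
  exact isCompact_iUnion fun i => isCompact_Icc.image (continuous_seg i)

variable (D) in
lemma isCompact_shadow : IsCompact D.shadow := (isCompact_link D).image continuous_fst

lemma isOpen_compl_shadow : IsOpen D.shadowᶜ := (isCompact_shadow D).isClosed.isOpen_compl

lemma pt_mem_shadow {a : D.Param} (ha : a.2 ∈ Ico (0 : ℝ) 1) : (D.pt a).1 ∈ D.shadow :=
  ⟨_, ⟨a, ha, rfl⟩, rfl⟩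

/-- Segments which do not meet a vertical line stay away from it. -/
lemma exists_forall_le_norm (z : ℂ) : ∃ ε > 0, ∀ i, (∀ t ∈ Icc (0 : ℝ) 1, (D.seg i t).1 ≠ z) →
    ∀ t ∈ Icc (0 : ℝ) 1, ε ≤ ‖(D.seg i t).1 - z‖ := by
  have h : ∀ i, ∃ ε > 0, (∀ t ∈ Icc (0 : ℝ) 1, (D.seg i t).1 ≠ z) →
      ∀ t ∈ Icc (0 : ℝ) 1, ε ≤ ‖(D.seg i t).1 - z‖ := by
    intro i
    by_cases hi : ∀ t ∈ Icc (0 : ℝ) 1, (D.seg i t).1 ≠ z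
    · have hc : ContinuousOn (fun t => ‖(D.seg i t).1 - z‖) (Icc 0 1) :=
        ((continuous_fst.comp (continuous_seg i)).sub continuous_const).norm.continuousOn
      obtain ⟨t₀, ht₀, hmin⟩ := isCompact_Icc.exists_isMinOn ⟨0, by simp⟩ hc
      exact ⟨_, norm_pos_iff.2 (sub_ne_zero.2 (hi t₀ ht₀)), fun _ t ht => hmin ht⟩
    · exact ⟨1, one_pos, fun h => absurd h hi⟩
  choose ε hε hε' using h
  rcases isEmpty_or_nonempty (Fin D.n) with hn | hn
  · exact ⟨1, one_pos, fun i => (hn.false i).elim⟩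
  · obtain ⟨i₀, hi₀⟩ := Finite.exists_min ε
    exact ⟨ε i₀, hε i₀, fun i hi t ht => (hi₀ i).trans (hε' i hi t ht)⟩

variable (D) in
/-- Parameters of the double points. -/
def IsDouble (a : D.Param) : Prop := ∃ b, D.IsCrossing a b

lemma IsCrossing.symm {a b : D.Param} (h : D.IsCrossing a b) : D.IsCrossing b a :=
  ⟨h.2.1, h.1, h.2.2.1.symm, h.2.2.2.symm⟩

lemma IsCrossing.mem_Ioo {a b : D.Param} (h : D.IsCrossing a b) : a.2 ∈ Ioo (0 : ℝ) 1 := by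
  refine ⟨lt_of_le_of_ne h.1.1 fun h0 => ?_, h.1.2⟩
  have ha : a = (a.1, 0) := Prod.ext rfl h0.symm
  have := D.vertex_regular a.1 b.1 b.2 h.2.1 (by
    intro hb
    exact h.2.2.1 (ha.trans hb.symm))
  apply this
  have h1 := h.2.2.2
  rw [ha, pt_eq_seg, seg_zero] at h1
  exact h1.symm

lemma IsCrossing.fst_ne {a b : D.Param} (h : D.IsCrossing a b) : a.1 ≠ b.1 := by
  intro h1
  apply h.2.2.1
  have h2 := h.2.2.2
  rw [pt_eq_seg, pt_eq_seg, ← h1] at h2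
  have h3 := coord_seg a.1 a.2
  rw [h2, coord_seg] at h3
  exact Prod.ext h1 (by exact_mod_cast h3.symm)

lemma IsCrossing.snd_ne {a b : D.Param} (h : D.IsCrossing a b) : (D.pt a).2 ≠ (D.pt b).2 :=
  fun h1 => D.embedded a b h.1 h.2.1 h.2.2.1 (Prod.ext h.2.2.2 h1)

lemma IsCrossing.unique {a b c : D.Param} (h : D.IsCrossing a b) (h' : D.IsCrossing a c) :
    b = c := by
  by_contra hbc
  exact D.no_triple a b c h.1 h.2.1 h'.2.1 h.2.2.1 hbc h'.2.2.1 ⟨h.2.2.2, h.2.2.2.symm.trans h'.2.2.2⟩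

/-- Two segments do not overlap in the projection. -/
lemma not_overlap {i j : Fin D.n} (hij : i ≠ j) {t s α β : ℝ} {η : ℝ} (hη : 0 < η)
    (h : ∀ x ∈ Ioo 0 η, t + x * α ∈ Ico (0 : ℝ) 1 ∧ s + x * β ∈ Ico (0 : ℝ) 1 ∧
      (D.seg i (t + x * α)).1 = (D.seg j (s + x * β)).1) (hα : α ≠ 0) : False := by
  -- An overlap of positive length would consist of infinitely many double points.
  refine Set.not_infinite.2 D.finite_double ?_
  have hinj : Function.Injective
      fun x : ℝ => (((i, t + x * α), (j, s + x * β)) : (Fin D.n × ℝ) × (Fin D.n × ℝ)) := by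
    intro x y hxy
    simp only [Prod.mk.injEq] at hxy
    exact mul_right_cancel₀ hα (add_left_cancel hxy.1.2)
  refine ((Ioo_infinite hη).image hinj.injOn).mono ?_
  rintro _ ⟨x, hx, rfl⟩
  obtain ⟨h1, h2, h3⟩ := h x hx
  exact ⟨h1, h2, fun h => hij (congrArg Prod.fst h), h3⟩

lemma exists_pos_forall_mem_Ico {t : ℝ} (ht : t ∈ Ioo (0 : ℝ) 1) (α : ℝ) :
    ∃ η > 0, ∀ x ∈ Ioo 0 η, t + x * α ∈ Ico (0 : ℝ) 1 := by
  have hc : Tendsto (fun x : ℝ => t + x * α) (𝓝 0) (𝓝 t) := by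
    have : Continuous fun x : ℝ => t + x * α := by fun_prop
    simpa using this.tendsto 0
  obtain ⟨η, hη, h⟩ := Metric.eventually_nhds_iff.1 (hc (Ioo_mem_nhds ht.1 ht.2))
  refine ⟨η, hη, fun x hx => Ioo_subset_Ico_self (h ?_)⟩
  rw [Real.dist_eq, sub_zero, abs_of_pos hx.1]
  exact hx.2

/-- The two strands are transversal at a crossing. -/
lemma IsCrossing.im_ne_zero {a b : D.Param} (h : D.IsCrossing a b) :
    (D.dir b.1 / D.dir a.1).im ≠ 0 := by
  intro him
  set r := (D.dir b.1 / D.dir a.1).re with hr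
  have hν : D.dir b.1 = r * D.dir a.1 := by
    rw [← div_eq_iff (dir_ne_zero a.1)]
    apply Complex.ext <;> simp [hr, him]
  obtain ⟨η₁, h1, h1'⟩ := exists_pos_forall_mem_Ico h.mem_Ioo r
  obtain ⟨η₂, h2, h2'⟩ := exists_pos_forall_mem_Ico h.symm.mem_Ioo 1
  have hr0 : r ≠ 0 := by
    intro h0
    rw [h0, Complex.ofReal_zero, zero_mul] at hν
    exact dir_ne_zero b.1 hν
  refine not_overlap h.fst_ne (lt_min h1 h2) (fun x hx => ⟨h1' x ⟨hx.1, hx.2.trans_le (min_le_left _ _)⟩,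
    h2' x ⟨hx.1, hx.2.trans_le (min_le_right _ _)⟩, ?_⟩) hr0
  have e := h.2.2.2
  rw [pt_eq_seg, pt_eq_seg, seg_fst, seg_fst] at e
  rw [seg_fst, seg_fst]
  push_cast
  rw [hν] at e ⊢
  linear_combination e

lemma next_ne (i : Fin D.n) : D.next i ≠ i := by
  intro h
  apply dir_ne_zero i
  rw [dir, h, sub_self]

/-- At a vertex the link does not turn back in the projection. -/
lemma not_turn_back (i : Fin D.n) {r : ℝ} (hr : 0 < r) : -D.dir i ≠ r * D.dir (D.next i) := by
  intro h
  have key : ∀ x ∈ Ioo 0 (min 1 r⁻¹), 1 + x * (-1) ∈ Ico (0 : ℝ) 1 ∧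
      0 + x * r ∈ Ico (0 : ℝ) 1 ∧
      (D.seg i (1 + x * (-1))).1 = (D.seg (D.next i) (0 + x * r)).1 := by
    intro x hx
    have hx1 := hx.2.trans_le (min_le_left _ _)
    have hx2 := hx.2.trans_le (min_le_right _ _)
    have hx0 := hx.1
    refine ⟨⟨by linarith, by linarith⟩, ⟨by positivity, ?_⟩, ?_⟩
    · rw [zero_add]
      calc x * r < r⁻¹ * r := by gcongr
        _ = 1 := inv_mul_cancel₀ hr.ne'
    · have e : (D.vert (D.next i)).1 = (D.vert i).1 + D.dir i := by simp [dir]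
      rw [seg_fst, seg_fst, e]
      push_cast
      linear_combination (x : ℂ) * h
  exact not_overlap (next_ne i).symm (lt_min one_pos (inv_pos.2 hr)) key (by norm_num)

/-- Near a crossing there are only the two strands. -/
lemma IsCrossing.exists_nhd {a b : D.Param} (h : D.IsCrossing a b) :
    ∃ ε > 0, ∀ k, ∀ τ ∈ Icc (0 : ℝ) 1, ‖(D.seg k τ).1 - (D.pt a).1‖ < ε → k = a.1 ∨ k = b.1 := by
  obtain ⟨ε, hε, h'⟩ := exists_forall_le_norm (D := D) (D.pt a).1
  refine ⟨ε, hε, fun k τ hτ hk => ?_⟩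
  by_contra! hne
  refine absurd (h' k (fun t ht e => ?_) τ hτ) (not_le.2 hk)
  obtain ⟨c, hc, hce, hcc⟩ := exists_pt_eq_seg k ht
  rw [← hce] at e
  by_cases hca : c = a
  · rcases hcc with hcc | hcc
    · exact hne.1 (by rw [← hca, hcc])
    · have := h.mem_Ioo.1
      rw [← hca, hcc] at this
      exact lt_irrefl _ this
  · have : b = c := h.unique ⟨h.1, hc, Ne.symm hca, e.symm⟩
    rcases hcc with hcc | hcc
    · exact hne.2 (by rw [this, hcc])
    · have := h.symm.mem_Ioo.1
      rw [‹b = c›, hcc] at this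
      exact lt_irrefl _ this

/-- Near a point which is neither a double point nor a vertex there is only one strand. -/
lemma exists_nhd_of_not_isDouble {i : Fin D.n} {t : ℝ} (ht : t ∈ Ioo (0 : ℝ) 1)
    (h : ¬ D.IsDouble (i, t)) :
    ∃ ε > 0, ∀ k, ∀ τ ∈ Icc (0 : ℝ) 1, ‖(D.seg k τ).1 - (D.seg i t).1‖ < ε → k = i := by
  obtain ⟨ε, hε, h'⟩ := exists_forall_le_norm (D := D) (D.seg i t).1
  refine ⟨ε, hε, fun k τ hτ hk => ?_⟩
  by_contra! hne
  refine absurd (h' k (fun s hs e => ?_) τ hτ) (not_le.2 hk)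
  obtain ⟨c, hc, hce, hcc⟩ := exists_pt_eq_seg k hs
  rw [← hce] at e
  by_cases hca : c = (i, t)
  · rcases hcc with hcc | hcc
    · rw [hcc] at hca
      exact hne (congrArg Prod.fst hca)
    · rw [hcc] at hca
      exact ht.1.ne (congrArg Prod.snd hca)
  · exact h ⟨c, Ioo_subset_Ico_self ht, hc, Ne.symm hca, e.symm⟩

/-- Near a vertex there are only the two segments that end there. -/
lemma exists_nhd_vertex (i : Fin D.n) :
    ∃ ε > 0, ∀ k, ∀ τ ∈ Icc (0 : ℝ) 1, ‖(D.seg k τ).1 - (D.seg (D.next i) 0).1‖ < ε →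
      k = i ∨ k = D.next i := by
  obtain ⟨ε, hε, h'⟩ := exists_forall_le_norm (D := D) (D.seg (D.next i) 0).1
  refine ⟨ε, hε, fun k τ hτ hk => ?_⟩
  by_contra! hne
  refine absurd (h' k (fun s hs e => ?_) τ hτ) (not_le.2 hk)
  obtain ⟨c, hc, hce, hcc⟩ := exists_pt_eq_seg k hs
  rw [← hce] at e
  have hca : c = (D.next i, 0) := by
    by_contra hca
    refine D.vertex_regular (D.next i) c.1 c.2 hc (fun h => hca h) ?_
    rw [seg_zero] at e
    exact e
  rcases hcc with hcc | hcc
  · rw [hcc] at hca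
    exact hne.2 (congrArg Prod.fst hca)
  · rw [hcc] at hca
    exact hne.1 (D.next.injective (congrArg Prod.fst hca))

variable (D) in
lemma finite_isDouble : {a : D.Param | D.IsDouble a}.Finite := by
  refine (D.finite_double.image Prod.fst).subset ?_
  rintro a ⟨b, h⟩
  exact ⟨(a, b), ⟨h.1, h.2.1, h.2.2.1, h.2.2.2⟩, rfl⟩

/-! ## The points that are visible from above -/

variable (D) in
/-- The points such that the link does not meet the vertical half-line above them. -/
def visible : Set (ℂ × ℝ) := {p | ∀ i, ∀ t ∈ Icc (0 : ℝ) 1, (D.seg i t).1 = p.1 → (D.seg i t).2 < p.2}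

lemma visible_of_not_mem_shadow {p : ℂ × ℝ} (h : p.1 ∉ D.shadow) : p ∈ D.visible :=
  fun i t ht e => absurd (mem_shadow_iff.2 ⟨i, t, ht, e⟩) h

lemma not_mem_link_of_mem_visible {p : ℂ × ℝ} (h : p ∈ D.visible) : p ∉ D.link := by
  intro hp
  obtain ⟨i, t, ht, rfl⟩ := mem_link_iff.1 hp
  exact lt_irrefl _ (h i t ht rfl)

-- The complement is the sum of the compact link and the closed downward half-line.
variable (D) in
open scoped Pointwise in
lemma isOpen_visible : IsOpen D.visible := by
  rw [← isClosed_compl_iff]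
  have : D.visibleᶜ = D.link + ({0} ×ˢ Iic 0 : Set (ℂ × ℝ)) := by
    ext p
    constructor
    · intro hp
      simp only [visible, mem_compl_iff, Set.mem_ofPred_eq, not_forall, not_lt] at hp
      obtain ⟨i, t, ht, h1, h2⟩ := hp
      refine ⟨_, mem_link_iff.2 ⟨i, t, ht, rfl⟩, (0, p.2 - (D.seg i t).2), by simpa using h2, ?_⟩
      exact Prod.ext (by simpa using h1) (by simp)
    · rintro ⟨q, hq, r, ⟨hr1, hr2⟩, rfl⟩ h
      obtain ⟨i, t, ht, rfl⟩ := mem_link_iff.1 hq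
      have hr1 : r.1 = 0 := hr1
      have hr2 : r.2 ≤ 0 := hr2
      have := h i t ht (by simp [hr1])
      simp only [Prod.snd_add] at this
      linarith
  rw [this]
  exact (isClosed_singleton.prod isClosed_Iic).add_left_of_isCompact (isCompact_link D)

variable (D) in
lemma exists_height : ∃ H : ℝ, ∀ i, ∀ t ∈ Icc (0 : ℝ) 1, (D.seg i t).2 < H := by
  obtain ⟨M, hM⟩ := ((isCompact_link D).image continuous_snd).bddAbove
  exact ⟨M + 1, fun i t ht => lt_of_le_of_lt
    (hM ⟨_, mem_link_iff.2 ⟨i, t, ht, rfl⟩, rfl⟩) (lt_add_one M)⟩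

-- Pushing a visible point upwards keeps it visible. Above the height of the link everything is
-- visible, and a horizontal plane there contracts.
variable (D) in
lemma contractibleSpace_visible : ContractibleSpace D.visible := by
  obtain ⟨H, hH⟩ := exists_height D
  rw [contractible_iff_id_nullhomotopic]
  have hup : ∀ z, (z, H) ∈ D.visible := fun z i t ht _ => hH i t ht
  have hmem : ∀ (s : unitInterval) (p : D.visible),
      ((p : ℂ × ℝ).1, (1 - s) * (p : ℂ × ℝ).2 + s * H) ∈ D.visible := by
    intro s p i t ht h
    have h1 := p.2 i t ht h
    have h2 := hH i t ht
    have hs0 := s.2.1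
    have hs1 := s.2.2
    have e : (D.seg i t).2 = (1 - (s : ℝ)) * (D.seg i t).2 + s * (D.seg i t).2 := by ring
    simp only
    rcases hs0.eq_or_lt with h0 | h0
    · rw [← h0]; simpa using h1
    · nlinarith
  let r : C(D.visible, D.visible) := ⟨fun p => ⟨((p : ℂ × ℝ).1, H), hup _⟩, by fun_prop⟩
  let c : C(D.visible, D.visible) := ContinuousMap.const _ ⟨(0, H), hup 0⟩
  have h1 : (ContinuousMap.id D.visible).Homotopic r := ⟨{
    toFun := fun q => ⟨_, hmem q.1 q.2⟩
    continuous_toFun := by fun_prop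
    map_zero_left := fun p => by simp
    map_one_left := fun p => by simp [r] }⟩
  have h2 : r.Homotopic c := ⟨{
    toFun := fun q => ⟨((1 - (q.1 : ℝ) : ℝ) * (q.2 : ℂ × ℝ).1, H), hup _⟩
    continuous_toFun := by fun_prop
    map_zero_left := fun p => by simp [r]
    map_one_left := fun p => by simp [c] }⟩
  exact ⟨_, h1.trans h2⟩

end LinkDiagram

end CuspedHyp

namespace CuspedHyp

namespace LinkDiagram

variable {D : LinkDiagram} {Γ : Subgroup PSL2} {f : Manifold Γ ≃ₜ D.Complement}

/-! ## The walls below the strands of the link -/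

/-- This lift is the reference sheet: every later lift is compared with σ through an element of Γ.
-/
lemma exists_visibleLift (hΓ : IsFiniteVolumeManifoldGroup Γ) (f : Manifold Γ ≃ₜ D.Complement) :
    ∃ σ, IsLiftOn f id D.visible σ := by
  obtain ⟨H, hH⟩ := exists_height D
  have := contractibleSpace_visible D
  have h0 : ((0 : ℂ), H) ∈ D.visible := fun i t ht _ => hH i t ht
  obtain ⟨x₀, hx₀⟩ := exists_cover_eq_coe f (not_mem_link_of_mem_visible h0)
  obtain ⟨S, hS, -⟩ := IsLiftOn.exists hΓ (isOpen_visible D) continuousOn_id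
    (fun u hu => not_mem_link_of_mem_visible hu) h0 hx₀
  exact ⟨S, hS⟩

lemma IsRegion.eq_of_mem {R R' : Set ℂ} (hR : D.IsRegion R) (hR' : D.IsRegion R') {z : ℂ}
    (hz : z ∈ R) (hz' : z ∈ R') : R = R' := by
  obtain ⟨w, hw, rfl⟩ := hR
  obtain ⟨w', hw', rfl⟩ := hR'
  rw [connectedComponentIn_eq hz, connectedComponentIn_eq hz']

lemma IsRegion.subset_of_isPreconnected {R V : Set ℂ} (hR : D.IsRegion R) (hV : IsPreconnected V)
    (hVs : ∀ z ∈ V, z ∉ D.shadow) {z : ℂ} (hz : z ∈ R) (hzV : z ∈ V) : V ⊆ R := by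
  obtain ⟨w, hw, rfl⟩ := hR
  rw [connectedComponentIn_eq hz]
  exact hV.subset_connectedComponentIn hzV hVs

lemma exists_isRegion {V : Set ℂ} (hV : IsPreconnected V) (hne : V.Nonempty)
    (hVs : ∀ z ∈ V, z ∉ D.shadow) : ∃ R, D.IsRegion R ∧ V ⊆ R := by
  obtain ⟨z, hz⟩ := hne
  exact ⟨_, ⟨z, hVs z hz, rfl⟩, hV.subset_connectedComponentIn hz hVs⟩

lemma IsRegion.disjoint_shadow {R : Set ℂ} (hR : D.IsRegion R) {z : ℂ} (hz : z ∈ R) :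
    z ∉ D.shadow := by
  obtain ⟨w, hw, rfl⟩ := hR
  exact connectedComponentIn_subset _ _ hz

variable {σ : ℂ × ℝ → H3}

/-- A lift over a set of visible points differs from `σ` by a covering transformation. -/
lemma IsLiftOn.eq_smul_visibleLift {U : Set (ℂ × ℝ)} {S : ℂ × ℝ → H3} (hS : IsLiftOn f id U S)
    (hΓ : IsFiniteVolumeManifoldGroup Γ) (hσ : IsLiftOn f id D.visible σ) (hU : IsPreconnected U)
    (hUv : U ⊆ D.visible) {g : PSL2} (hg : g ∈ Γ)
    {p q : ℂ × ℝ} (hp : p ∈ U) (h : S p = g • σ p) (hq : q ∈ U) : S q = g • σ q :=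
  (hσ.mono hUv).eqOn_smul hΓ hU hS hg hp h hq

/-- A lift over a set of visible points differs from `σ` by a covering transformation. -/
lemma IsLiftOn.exists_eq_smul_visibleLift {U : Set (ℂ × ℝ)} {S : ℂ × ℝ → H3}
    (hS : IsLiftOn f id U S) (hΓ : IsFiniteVolumeManifoldGroup Γ)
    (hσ : IsLiftOn f id D.visible σ) (hU : IsPreconnected U)
    (hne : U.Nonempty) (hUv : U ⊆ D.visible) :
    ∃ g ∈ Γ, ∀ q ∈ U, S q = g • σ q := by
  obtain ⟨p, hp⟩ := hne
  obtain ⟨g, hg, h⟩ := (hσ.mono hUv).exists_smul hS hp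
  exact ⟨g, hg, fun q hq => hS.eq_smul_visibleLift hΓ hσ hU hUv hg hp h hq⟩

variable (f σ) in
/-- A lift `S` over a vertical half-open cylinder below the point of the link with parameter `(i, t)`
coincides with `σ` on the left of the link, where it lies over `R`, and with `g • σ` on the right. -/
structure IsWallChart (i : Fin D.n) (t : ℝ) (g : PSL2) (R : Set ℂ) (ε h : ℝ) (S : ℂ × ℝ → H3) :
    Prop where
  pos : 0 < ε
  mem : g ∈ Γ
  region : D.IsRegion R
  lift : IsLiftOn f id (Metric.ball (D.seg i t).1 ε ×ˢ Iio h) S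
  not_mem_shadow : ∀ z ∈ Metric.ball (D.seg i t).1 ε, (D.coord i z).im ≠ 0 → z ∉ D.shadow
  mem_region : ∀ z ∈ Metric.ball (D.seg i t).1 ε, 0 < (D.coord i z).im → z ∈ R
  left : ∀ z ∈ Metric.ball (D.seg i t).1 ε, 0 < (D.coord i z).im → ∀ y < h, S (z, y) = σ (z, y)
  right : ∀ z ∈ Metric.ball (D.seg i t).1 ε, (D.coord i z).im < 0 → ∀ y < h,
    S (z, y) = g • σ (z, y)

variable (f σ) in
/-- Crossing the wall below the link at the parameter `(i, t)` from left to right is the covering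
transformation `g`; on the left is the region `R`. -/
def IsWall (i : Fin D.n) (t : ℝ) (g : PSL2) (R : Set ℂ) : Prop :=
  ∃ ε h S, IsWallChart f σ i t g R ε h S

/-- The point with coordinate `t + x + y i` relative to segment `i`. -/
lemma coord_seg_add (i : Fin D.n) (t : ℝ) (w : ℂ) :
    D.coord i ((D.seg i t).1 + w * D.dir i) = t + w := by
  rw [coord_add, coord_seg, mul_div_cancel_right₀ _ (dir_ne_zero i)]

lemma exists_left_right (i : Fin D.n) (t : ℝ) {ε : ℝ} (hε : 0 < ε) :
    ∃ zl ∈ Metric.ball (D.seg i t).1 ε, ∃ zr ∈ Metric.ball (D.seg i t).1 ε,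
      0 < (D.coord i zl).im ∧ (D.coord i zr).im < 0 := by
  have hd : 0 < ‖D.dir i‖ := norm_pos_iff.2 (dir_ne_zero i)
  set y := ε / (2 * ‖D.dir i‖) with hy
  have hy0 : 0 < y := by positivity
  have hn : y * ‖D.dir i‖ < ε := by rw [hy]; field_simp; linarith
  refine ⟨(D.seg i t).1 + (y * Complex.I) * D.dir i, ?_,
    (D.seg i t).1 + (-(y * Complex.I)) * D.dir i, ?_, ?_, ?_⟩
  · rw [mem_ball_iff_norm, add_sub_cancel_left, norm_mul]
    simpa [abs_of_pos hy0] using hn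
  · rw [mem_ball_iff_norm, add_sub_cancel_left, norm_mul]
    simpa [abs_of_pos hy0] using hn
  · rw [coord_seg_add]; simpa using hy0
  · rw [coord_seg_add]; simpa using hy0

lemma convex_side (i : Fin D.n) (ρ : ℝ) : Convex ℝ {z | 0 < ρ * (D.coord i z).im} := by
  intro z hz w hw a b ha hb hab
  simp only [Set.mem_ofPred_eq] at hz hw ⊢
  have e : D.coord i (a • z + b • w) = a * D.coord i z + b * D.coord i w := by
    have hab' : (a : ℂ) + b = 1 := by exact_mod_cast hab
    have hd := dir_ne_zero i
    simp only [coord, Complex.real_smul]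
    field_simp
    linear_combination (D.vert i).1 * hab'
  rw [e]
  simp only [Complex.add_im, Complex.im_ofReal_mul]
  rcases ha.eq_or_lt with rfl | ha'
  · have : b = 1 := by linarith
    subst this; simpa using hw
  · nlinarith [mul_pos ha' hz, mul_nonneg hb hw.le]

lemma isPreconnected_ball_side (i : Fin D.n) (ρ : ℝ) (z : ℂ) (ε : ℝ) :
    IsPreconnected (Metric.ball z ε ∩ {z | 0 < ρ * (D.coord i z).im}) :=
  ((convex_ball z ε).inter (convex_side i ρ)).isPreconnected

lemma prod_subset_visible {V : Set ℂ} (hV : ∀ z ∈ V, z ∉ D.shadow) (I : Set ℝ) :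
    V ×ˢ I ⊆ D.visible :=
  fun p hp => visible_of_not_mem_shadow (hV p.1 hp.1)

namespace IsWallChart

variable {i : Fin D.n} {t : ℝ} {g g' : PSL2} {R R' : Set ℂ} {ε ε' h h' : ℝ} {S S' : ℂ × ℝ → H3}

lemma of_mem_ball (w : IsWallChart f σ i t g R ε h S) {t' : ℝ}
    (ht' : (D.seg i t').1 ∈ Metric.ball (D.seg i t).1 ε) :
    IsWallChart f σ i t' g R (ε - dist (D.seg i t').1 (D.seg i t).1) h S := by
  have hsub : Metric.ball (D.seg i t').1 (ε - dist (D.seg i t').1 (D.seg i t).1) ⊆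
      Metric.ball (D.seg i t).1 ε := Metric.ball_subset (by linarith)
  exact ⟨sub_pos.2 ht', w.mem, w.region, w.lift.mono (prod_mono hsub subset_rfl),
    fun z hz => w.not_mem_shadow z (hsub hz), fun z hz => w.mem_region z (hsub hz),
    fun z hz => w.left z (hsub hz), fun z hz => w.right z (hsub hz)⟩

/-- Both charts equal σ on the left, hence agree on their connected overlap by uniqueness of lifts.
On the right this reads g • σ = g' • σ, and the action is free. -/
lemma unique (hΓ : IsFiniteVolumeManifoldGroup Γ) (w : IsWallChart f σ i t g R ε h S)
    (w' : IsWallChart f σ i t g' R' ε' h' S') : g = g' ∧ R = R' := by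
  have hε : 0 < min ε ε' := lt_min w.pos w'.pos
  obtain ⟨zl, hzl, zr, hzr, hl, hr⟩ := exists_left_right i t hε
  have s1 : Metric.ball (D.seg i t).1 (min ε ε') ⊆ Metric.ball (D.seg i t).1 ε :=
    Metric.ball_subset_ball (min_le_left _ _)
  have s2 : Metric.ball (D.seg i t).1 (min ε ε') ⊆ Metric.ball (D.seg i t).1 ε' :=
    Metric.ball_subset_ball (min_le_right _ _)
  refine ⟨?_, w.region.eq_of_mem w'.region (w.mem_region _ (s1 hzl) hl)
    (w'.mem_region _ (s2 hzl) hl)⟩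
  set U := Metric.ball (D.seg i t).1 (min ε ε') ×ˢ Iio (min h h') with hU
  have hUc : IsPreconnected U := ((convex_ball _ _).prod (convex_Iio _)).isPreconnected
  set y := min h h' - 1 with hy
  have hy1 : y < min h h' := by linarith
  have hyh : y < h := hy1.trans_le (min_le_left _ _)
  have hyh' : y < h' := hy1.trans_le (min_le_right _ _)
  have e := (w.lift.mono (prod_mono s1 (Iio_subset_Iio (min_le_left _ _)))).eqOn hΓ hUc
    (w'.lift.mono (prod_mono s2 (Iio_subset_Iio (min_le_right _ _))))
    (u := (zl, y)) ⟨hzl, hy1⟩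
    ((w'.left zl (s2 hzl) hl y hyh').trans (w.left zl (s1 hzl) hl y hyh).symm)
  have e2 := e (show (zr, y) ∈ U from ⟨hzr, hy1⟩)
  rw [w.right zr (s1 hzr) hr y hyh, w'.right zr (s2 hzr) hr y hyh'] at e2
  exact (smul_injective_of_mem hΓ w'.mem w.mem e2).symm

end IsWallChart

lemma IsWall.unique (hΓ : IsFiniteVolumeManifoldGroup Γ) {i : Fin D.n} {t : ℝ} {g g' : PSL2}
    {R R' : Set ℂ} (w : IsWall f σ i t g R) (w' : IsWall f σ i t g' R') : g = g' ∧ R = R' := by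
  obtain ⟨_, _, _, w⟩ := w
  obtain ⟨_, _, _, w'⟩ := w'
  exact w.unique hΓ w'

lemma IsWall.eventually {i : Fin D.n} {t : ℝ} {g : PSL2}
    {R : Set ℂ} (w : IsWall f σ i t g R) : ∀ᶠ t' in 𝓝 t, IsWall f σ i t' g R := by
  obtain ⟨ε, h, S, w⟩ := w
  have hc : ContinuousAt (fun t' => (D.seg i t').1) t :=
    (continuous_fst.comp (continuous_seg i)).continuousAt
  filter_upwards [hc (Metric.ball_mem_nhds _ w.pos)] with t' ht'
  exact ⟨_, _, _, w.of_mem_ball ht'⟩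

/-- The height of a segment is close to that of `seg i t` over a small disc. -/
lemma exists_height_close (i : Fin D.n) (t : ℝ) {η : ℝ} (hη : 0 < η) :
    ∃ ε > 0, ∀ τ, ‖(D.seg i τ).1 - (D.seg i t).1‖ < ε → |(D.seg i τ).2 - (D.seg i t).2| < η := by
  have hd : 0 < ‖D.dir i‖ := norm_pos_iff.2 (dir_ne_zero i)
  refine ⟨η * ‖D.dir i‖ / (|D.rise i| + 1), by positivity, fun τ hτ => ?_⟩
  rw [seg_fst, seg_fst, add_sub_add_left_eq_sub, ← sub_mul, norm_mul, ← Complex.ofReal_sub,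
    Complex.norm_real, Real.norm_eq_abs, lt_div_iff₀ (by positivity)] at hτ
  rw [seg_snd, seg_snd, add_sub_add_left_eq_sub, ← sub_mul, abs_mul]
  have h1 : |τ - t| * (|D.rise i| + 1) < η := by
    have : |τ - t| * (|D.rise i| + 1) * ‖D.dir i‖ < η * ‖D.dir i‖ := by linarith
    exact lt_of_mul_lt_mul_right this hd.le
  have := abs_nonneg (τ - t)
  linarith

lemma coord_eq_of_seg_eq {i k : Fin D.n} {τ : ℝ} {z : ℂ} (hk : k = i) (h : (D.seg k τ).1 = z) :
    D.coord i z = τ := by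
  subst hk; rw [← h, coord_seg]

/-- Walls exist at the regular points of the diagram; the charts come arbitrarily close to the
link. -/
lemma exists_isWallChart (hΓ : IsFiniteVolumeManifoldGroup Γ) (hσ : IsLiftOn f id D.visible σ)
    {i : Fin D.n} {t : ℝ} (ht : t ∈ Ioo (0 : ℝ) 1) (hreg : ¬ D.IsDouble (i, t)) {η : ℝ}
    (hη : 0 < η) : ∃ g R ε h S, IsWallChart f σ i t g R ε h S ∧ (D.seg i t).2 - η < h := by
  obtain ⟨ε₁, hε₁, h1⟩ := exists_nhd_of_not_isDouble ht hreg
  obtain ⟨ε₂, hε₂, h2⟩ := exists_height_close i t (half_pos hη)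
  set ε := min ε₁ ε₂ with hε
  have hε0 : 0 < ε := lt_min hε₁ hε₂
  -- Over the disc the strand stays within η / 2 of its central height, so the cylinder below h
  -- misses it, while h still exceeds the central height minus η.
  set h := (D.seg i t).2 - η / 2 with hh
  set B := Metric.ball (D.seg i t).1 ε with hB
  have hstrand : ∀ k, ∀ τ ∈ Icc (0 : ℝ) 1, (D.seg k τ).1 ∈ B → k = i := by
    intro k τ hτ hk
    exact h1 k τ hτ ((mem_ball_iff_norm.1 hk).trans_le (min_le_left _ _))
  have hshadow : ∀ z ∈ B, (D.coord i z).im ≠ 0 → z ∉ D.shadow := by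
    intro z hz him hzs
    obtain ⟨k, τ, hτ, rfl⟩ := mem_shadow_iff.1 hzs
    apply him
    rw [coord_eq_of_seg_eq (hstrand k τ hτ hz) rfl, Complex.ofReal_im]
  have hlink : ∀ p ∈ B ×ˢ Iio h, p ∉ D.link := by
    rintro p ⟨hp1, hp2⟩ hp
    obtain ⟨k, τ, hτ, rfl⟩ := mem_link_iff.1 hp
    obtain rfl := hstrand k τ hτ hp1
    have := (abs_lt.1 (h2 τ ((mem_ball_iff_norm.1 hp1).trans_le (min_le_right _ _)))).1
    have hp2 : (D.seg k τ).2 < h := hp2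
    linarith
  obtain ⟨zl, hzl, zr, hzr, hl, hr⟩ := exists_left_right i t hε0
  have hlv : (zl, h - 1) ∈ D.visible := visible_of_not_mem_shadow (hshadow zl hzl hl.ne')
  obtain ⟨S, hS, hS0⟩ := IsLiftOn.exists_of_convex (f := f) (φ := id) hΓ
    (Metric.isOpen_ball.prod isOpen_Iio) ((convex_ball _ _).prod (convex_Iio h)) continuousOn_id
    hlink (u₀ := (zl, h - 1)) ⟨hzl, by simp⟩ (hσ.2 _ hlv)
  have hVl := isPreconnected_ball_side i 1 (D.seg i t).1 ε
  have hVr := isPreconnected_ball_side i (-1) (D.seg i t).1 ε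
  rw [← hB] at hVl hVr
  have hVls : ∀ z ∈ B ∩ {z | 0 < 1 * (D.coord i z).im}, z ∉ D.shadow := by
    rintro z ⟨hz, hz'⟩
    have hz' : 0 < 1 * (D.coord i z).im := hz'
    exact hshadow z hz (by linarith)
  have hVrs : ∀ z ∈ B ∩ {z | 0 < -1 * (D.coord i z).im}, z ∉ D.shadow := by
    rintro z ⟨hz, hz'⟩
    have hz' : 0 < -1 * (D.coord i z).im := hz'
    exact hshadow z hz (by linarith)
  have hmeml : ∀ z ∈ B, 0 < (D.coord i z).im → z ∈ B ∩ {z | 0 < 1 * (D.coord i z).im} :=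
    fun z hz him => ⟨hz, by simpa using him⟩
  have hmemr : ∀ z ∈ B, (D.coord i z).im < 0 → z ∈ B ∩ {z | 0 < -1 * (D.coord i z).im} :=
    fun z hz him => ⟨hz, by simpa using him⟩
  obtain ⟨R, hR, hRV⟩ := exists_isRegion hVl ⟨zl, hmeml zl hzl hl⟩ hVls
  obtain ⟨g, hg, hgr⟩ := (hS.mono (prod_mono inter_subset_left subset_rfl)).exists_eq_smul_visibleLift
    hΓ hσ (hVr.prod isPreconnected_Iio) ⟨(zr, h - 1), hmemr zr hzr hr, by simp⟩
    (prod_subset_visible hVrs _)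
  refine ⟨g, R, ε, h, S, ⟨hε0, hg, hR, hS, hshadow, fun z hz him => hRV (hmeml z hz him), ?_, ?_⟩,
    by linarith⟩
  · intro z hz him y hy
    have := (hS.mono (prod_mono inter_subset_left subset_rfl)).eq_smul_visibleLift
      hΓ hσ (hVl.prod isPreconnected_Iio) (prod_subset_visible hVls _) (one_mem Γ)
      (p := (zl, h - 1)) (q := (z, y)) ⟨hmeml zl hzl hl, by simp⟩ (by rw [hS0, one_smul])
      ⟨hmeml z hz him, hy⟩
    rwa [one_smul] at this
  · intro z hz him y hy
    exact hgr _ ⟨hmemr z hz him, hy⟩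

end LinkDiagram

end CuspedHyp

namespace CuspedHyp

/-! ## Polar coordinates -/

lemma polar_angle_unique {ρ ρ' φ ψ : ℝ} (hρ : 0 < ρ) (hρ' : 0 < ρ')
    (h : (ρ : ℂ) * Complex.exp (φ * Complex.I) = ρ' * Complex.exp (ψ * Complex.I))
    (hφ : |φ - ψ| < 2 * Real.pi) : φ = ψ := by
  have hn : ρ = ρ' := by
    have := congrArg norm h
    simpa [Complex.norm_exp_ofReal_mul_I, abs_of_pos hρ, abs_of_pos hρ'] using this
  subst hn
  have h1 := mul_left_cancel₀ (Complex.ofReal_ne_zero.2 hρ.ne') h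
  obtain ⟨n, hn⟩ := Complex.exp_eq_exp_iff_exists_int.1 h1
  have h2 : φ - ψ = n * (2 * Real.pi) := by
    have h3 : ((φ : ℂ) - ψ) * Complex.I = (n * (2 * Real.pi)) * Complex.I := by
      linear_combination hn
    have := mul_right_cancel₀ Complex.I_ne_zero h3
    exact_mod_cast this
  have hpi := Real.pi_pos
  have hn0 : n = 0 := by
    rw [h2, abs_mul, abs_of_pos (by positivity : 0 < 2 * Real.pi)] at hφ
    have h4 : |(n : ℝ)| < 1 := by
      by_contra h5
      rw [not_lt] at h5
      nlinarith
    have : |n| < 1 := by exact_mod_cast h4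
    exact Int.abs_lt_one_iff.1 this
  rw [hn0] at h2
  simp at h2
  linarith

/-- Near a point of the ray with angle `α` the angle is close to `α`. -/
lemma exists_polar_near {s α δ : ℝ} (hs : 0 < s) (hδ : 0 < δ) :
    ∃ ε > 0, ∀ w : ℂ, ‖w - s * Complex.exp (α * Complex.I)‖ < ε →
      ∃ η, |η| < δ ∧ 0 < ‖w‖ ∧ w = ‖w‖ * Complex.exp ((α + η : ℝ) * Complex.I) ∧
        (0 < (w * Complex.exp (-(α * Complex.I))).im → 0 < η) ∧
        ((w * Complex.exp (-(α * Complex.I))).im < 0 → η < 0) := by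
  have hc : ContinuousAt Complex.arg (s : ℂ) :=
    Complex.continuousAt_arg (by simp [Complex.mem_slitPlane_iff, hs])
  have h0 : Complex.arg (s : ℂ) = 0 := Complex.arg_ofReal_of_nonneg hs.le
  obtain ⟨ε, hε, h⟩ := Metric.continuousAt_iff.1 hc δ hδ
  refine ⟨min ε s, lt_min hε hs, fun w hw => ?_⟩
  set v := w * Complex.exp (-(α * Complex.I)) with hv
  have hexp : ‖Complex.exp (-(α * Complex.I))‖ = 1 := by
    rw [← neg_mul, ← Complex.ofReal_neg, Complex.norm_exp_ofReal_mul_I]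
  have hvs : ‖v - s‖ < min ε s := by
    have : v - s = (w - s * Complex.exp (α * Complex.I)) * Complex.exp (-(α * Complex.I)) := by
      rw [sub_mul, mul_assoc (s : ℂ), ← Complex.exp_add, add_neg_cancel, Complex.exp_zero, mul_one]
    rw [this, norm_mul, hexp, mul_one]
    exact hw
  have hnv : ‖v‖ = ‖w‖ := by rw [hv, norm_mul, hexp, mul_one]
  have hv0 : v ≠ 0 := by
    intro h0
    rw [h0, zero_sub, norm_neg, Complex.norm_real, Real.norm_eq_abs, abs_of_pos hs] at hvs
    exact lt_irrefl _ (hvs.trans_le (min_le_right _ _))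
  have hwv : w = v * Complex.exp (α * Complex.I) := by
    rw [hv, mul_assoc, ← Complex.exp_add, neg_add_cancel, Complex.exp_zero, mul_one]
  refine ⟨v.arg, ?_, by rw [← hnv]; exact norm_pos_iff.2 hv0, ?_, ?_, ?_⟩
  · have := h (x := v) (by rw [dist_eq_norm]; exact hvs.trans_le (min_le_left _ _))
    rwa [h0, Real.dist_eq, sub_zero] at this
  · rw [← hnv]
    push_cast
    rw [add_mul, Complex.exp_add, mul_comm (Complex.exp (α * Complex.I)), ← mul_assoc,
      Complex.norm_mul_exp_arg_mul_I]
    exact hwv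
  · intro him
    refine lt_of_le_of_ne (Complex.arg_nonneg_iff.2 him.le) fun h => ?_
    exact him.ne' (Complex.arg_eq_zero_iff.1 h.symm).2
  · exact Complex.arg_neg_iff.2

namespace LinkDiagram

variable {D : LinkDiagram} {Γ : Subgroup PSL2} {f : Manifold Γ ≃ₜ D.Complement}
  {σ : ℂ × ℝ → H3}

/-! ## Walls at the vertices -/

/-- The open circular sector at the initial point of segment `j` between two angles relative to the
segment. -/
def sector (j : Fin D.n) (ε φ ψ : ℝ) : Set ℂ :=
  (fun q : ℝ × ℝ => (D.vert j).1 + q.1 * Complex.exp (q.2 * Complex.I) * D.dir j) ''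
    (Ioo 0 ε ×ˢ Ioo φ ψ)

lemma isPreconnected_sector (j : Fin D.n) (ε φ ψ : ℝ) : IsPreconnected (sector j ε φ ψ) :=
  (isPreconnected_Ioo.prod isPreconnected_Ioo).image _ (by fun_prop)

lemma mem_sector {j : Fin D.n} {ε φ ψ : ℝ} {z : ℂ} {η : ℝ} (h0 : 0 < ‖D.coord j z‖)
    (h1 : ‖D.coord j z‖ < ε)
    (hz : D.coord j z = ‖D.coord j z‖ * Complex.exp (η * Complex.I)) (hη : η ∈ Ioo φ ψ) :
    z ∈ sector j ε φ ψ := by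
  refine ⟨(‖D.coord j z‖, η), ⟨⟨h0, h1⟩, hη⟩, ?_⟩
  simp only
  rw [← hz, ← eq_of_coord]

lemma coord_of_mem_sector {j : Fin D.n} {ε φ ψ : ℝ} {z : ℂ} (hz : z ∈ sector j ε φ ψ) :
    ∃ ρ ∈ Ioo 0 ε, ∃ η ∈ Ioo φ ψ, D.coord j z = ρ * Complex.exp (η * Complex.I) := by
  obtain ⟨⟨ρ, η⟩, ⟨hρ, hη⟩, rfl⟩ := hz
  refine ⟨ρ, hρ, η, hη, ?_⟩
  simp only [coord]
  rw [add_sub_cancel_left, mul_div_cancel_right₀ _ (dir_ne_zero j)]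

/-- The angle at a vertex, on the left of the link. -/
lemma exists_vertex_angle (i : Fin D.n) : ∃ β ∈ Ioo 0 (2 * Real.pi), ∃ ρ : ℝ, 0 < ρ ∧
    -D.dir i = ρ * Complex.exp ((β : ℝ) * Complex.I) * D.dir (D.next i) := by
  -- Seen from the vertex, the incoming segment points in the direction `-D.dir i`. Its angle is
  -- nonzero because the link does not turn back, and it is normalised to lie between 0 and 2π.
  set ν := -D.dir i / D.dir (D.next i) with hν
  have hν0 : ν ≠ 0 := div_ne_zero (neg_ne_zero.2 (dir_ne_zero i)) (dir_ne_zero _)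
  have hνd : -D.dir i = ν * D.dir (D.next i) := (div_mul_cancel₀ _ (dir_ne_zero _)).symm
  have harg : ν.arg ≠ 0 := by
    intro h
    obtain ⟨h1, h2⟩ := Complex.arg_eq_zero_iff.1 h
    have hre : ν = (ν.re : ℂ) := Complex.ext (by simp) (by simp [h2])
    have hpos : 0 < ν.re := lt_of_le_of_ne h1 fun h0 => hν0 (by rw [hre, ← h0]; simp)
    rw [hre] at hνd
    exact not_turn_back i hpos hνd
  have hpi := Real.pi_pos
  have e := Complex.norm_mul_exp_arg_mul_I ν
  rcases lt_or_gt_of_ne harg with h | h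
  · refine ⟨ν.arg + 2 * Real.pi, ⟨by linarith [Complex.neg_pi_lt_arg ν], by linarith⟩, ‖ν‖,
      norm_pos_iff.2 hν0, ?_⟩
    rw [hνd]
    push_cast
    rw [add_mul, Complex.exp_add, Complex.exp_two_pi_mul_I, mul_one, e]
  · refine ⟨ν.arg, ⟨h, by linarith [Complex.arg_le_pi ν]⟩, ‖ν‖, norm_pos_iff.2 hν0, ?_⟩
    rw [hνd, e]

/-- Walls of the two segments at a vertex near the vertex agree. -/
lemma exists_isWall_vertex (hΓ : IsFiniteVolumeManifoldGroup Γ) (hσ : IsLiftOn f id D.visible σ)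
    (i : Fin D.n) : ∃ g R, (∀ᶠ t in 𝓝[<] 1, IsWall f σ i t g R) ∧
      ∀ᶠ t in 𝓝[>] 0, IsWall f σ (D.next i) t g R := by
  set j := D.next i with hj
  obtain ⟨β, hβ, r, hr, hβr⟩ := exists_vertex_angle i
  rw [← hj] at hβr
  obtain ⟨ε₁, hε₁, h1⟩ := exists_nhd_vertex i
  rw [← hj] at h1
  obtain ⟨ε₂, hε₂, h2⟩ := exists_height_close i 1 one_pos
  obtain ⟨ε₃, hε₃, h3⟩ := exists_height_close j 0 one_pos
  rw [seg_one i, ← hj] at h2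
  have hd : 0 < ‖D.dir j‖ := norm_pos_iff.2 (dir_ne_zero j)
  set ε := min ε₁ (min ε₂ ε₃) with hε
  have hε0 : 0 < ε := lt_min hε₁ (lt_min hε₂ hε₃)
  set z₀ := (D.seg j 0).1 with hz₀
  have hz₀v : z₀ = (D.vert j).1 := by rw [hz₀, seg_zero]
  set h := (D.seg j 0).2 - 1 with hh
  set B := Metric.ball z₀ ε with hB
  have hstrand : ∀ k, ∀ τ ∈ Icc (0 : ℝ) 1, (D.seg k τ).1 ∈ B → k = i ∨ k = j := fun k τ hτ hk =>
    h1 k τ hτ ((mem_ball_iff_norm.1 hk).trans_le (min_le_left _ _))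
  have hlink : ∀ p ∈ B ×ˢ Iio h, p ∉ D.link := by
    rintro p ⟨hp1, hp2⟩ hp
    obtain ⟨k, τ, hτ, rfl⟩ := mem_link_iff.1 hp
    have hp2 : (D.seg k τ).2 < h := hp2
    have hp1 := mem_ball_iff_norm.1 hp1
    rcases hstrand k τ hτ (mem_ball_iff_norm.2 hp1) with rfl | rfl
    · have := (abs_lt.1 (h2 τ (hp1.trans_le ((min_le_right _ _).trans (min_le_left _ _))))).1
      linarith
    · have := (abs_lt.1 (h3 τ (hp1.trans_le ((min_le_right _ _).trans (min_le_right _ _))))).1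
      linarith
  -- In the coordinate of the outgoing segment j, the incoming segment i is the ray of angle β.
  have hcoordi : ∀ z, D.coord j z = (1 - D.coord i z) * (r * Complex.exp (β * Complex.I)) := by
    intro z
    have e1 : (D.vert j).1 = (D.vert i).1 + D.dir i := by simp [dir, hj]
    have e2 := eq_of_coord i z
    have hdj := dir_ne_zero j
    rw [coord, div_eq_iff hdj]
    linear_combination e2 - e1 + (1 - D.coord i z) * hβr
  -- Near the vertex the diagram consists of the rays of angles 0 and β only, so a sector within (0,
  -- 2π) that avoids β avoids the diagram.
  have hoff : ∀ {φ ψ : ℝ}, 0 ≤ φ → ψ ≤ 2 * Real.pi → β ∉ Ioo φ ψ →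
      ∀ z ∈ sector j (ε / ‖D.dir j‖) φ ψ, z ∈ B ∧ z ∉ D.shadow := by
    intro φ ψ hφ hψ hβn z hz
    obtain ⟨ρ, hρ, η, hη, hzρ⟩ := coord_of_mem_sector hz
    have hzB : z ∈ B := by
      rw [hB, mem_ball_iff_norm, hz₀v, eq_of_coord j z, add_sub_cancel_left, norm_mul, hzρ,
        norm_mul, Complex.norm_exp_ofReal_mul_I, mul_one, Complex.norm_real, Real.norm_eq_abs,
        abs_of_pos hρ.1]
      exact (lt_div_iff₀ hd).1 hρ.2
    refine ⟨hzB, fun hzs => ?_⟩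
    obtain ⟨k, τ, hτ, rfl⟩ := mem_shadow_iff.1 hzs
    rcases hstrand k τ hτ hzB with rfl | rfl
    · rw [hcoordi, coord_seg] at hzρ
      have hpos : 0 < (1 - τ) * r := by
        refine mul_pos (lt_of_le_of_ne (by linarith [hτ.2]) fun h0 => ?_) hr
        have h0' : (1 - (τ : ℂ)) = 0 := by exact_mod_cast h0.symm
        rw [h0', zero_mul, eq_comm, mul_eq_zero] at hzρ
        rcases hzρ with h | h
        · exact hρ.1.ne' (by exact_mod_cast h)
        · exact Complex.exp_ne_zero _ h
      have := polar_angle_unique (ρ := (1 - τ) * r) hpos hρ.1 (φ := β) (ψ := η)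
        (by push_cast; rw [← hzρ]; ring)
        (by rw [abs_lt]; constructor <;> linarith [hη.1, hη.2, hβ.1, hβ.2])
      rw [this] at hβn
      exact hβn hη
    · rw [coord_seg] at hzρ
      have hpos : 0 < τ := by
        refine lt_of_le_of_ne hτ.1 fun h0 => ?_
        rw [← h0, Complex.ofReal_zero, eq_comm, mul_eq_zero] at hzρ
        rcases hzρ with h | h
        · exact hρ.1.ne' (by exact_mod_cast h)
        · exact Complex.exp_ne_zero _ h
      have := polar_angle_unique (ρ := τ) hpos hρ.1 (φ := 0) (ψ := η)
        (by rw [← hzρ]; simp)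
        (by rw [abs_lt]; constructor <;> linarith [hη.1, hη.2, hβ.1, hβ.2])
      rw [← this] at hη
      exact absurd hη.1 (not_lt.2 hφ)
  have hoffl := hoff le_rfl hβ.2.le (fun hm : β ∈ Ioo 0 β => lt_irrefl _ hm.2)
  have hoffr := hoff hβ.1.le le_rfl (fun hm : β ∈ Ioo β (2 * Real.pi) => lt_irrefl _ hm.1)
  set A := sector j (ε / ‖D.dir j‖) 0 β with hA
  set A' := sector j (ε / ‖D.dir j‖) β (2 * Real.pi) with hA'
  have hεd : 0 < ε / ‖D.dir j‖ := div_pos hε0 hd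
  have hAne : A.Nonempty :=
    ((nonempty_Ioo.2 hεd).prod (nonempty_Ioo.2 hβ.1)).image _
  have hAne' : A'.Nonempty :=
    ((nonempty_Ioo.2 hεd).prod (nonempty_Ioo.2 hβ.2)).image _
  have hAc : IsPreconnected A := isPreconnected_sector _ _ _ _
  have hAc' : IsPreconnected A' := isPreconnected_sector _ _ _ _
  obtain ⟨zl, hzl⟩ := hAne
  obtain ⟨zr, hzr⟩ := hAne'
  have hlv : (zl, h - 1) ∈ D.visible := visible_of_not_mem_shadow (hoffl zl hzl).2
  obtain ⟨S, hS, hS0⟩ := IsLiftOn.exists_of_convex (f := f) (φ := id) hΓ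
    (Metric.isOpen_ball.prod isOpen_Iio) ((convex_ball _ _).prod (convex_Iio h)) continuousOn_id
    hlink (u₀ := (zl, h - 1)) ⟨(hoffl zl hzl).1, by simp⟩ (hσ.2 _ hlv)
  obtain ⟨R, hR, hRV⟩ := exists_isRegion hAc ⟨zl, hzl⟩ fun z hz => (hoffl z hz).2
  obtain ⟨g, hg, hgr⟩ := (hS.mono (prod_mono (fun z hz => (hoffr z hz).1) subset_rfl)
    ).exists_eq_smul_visibleLift hΓ hσ (hAc'.prod isPreconnected_Iio) ⟨(zr, h - 1), hzr, by simp⟩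
    (prod_subset_visible (fun z hz => (hoffr z hz).2) _)
  have hSl : ∀ z ∈ A, ∀ y < h, S (z, y) = σ (z, y) := by
    intro z hz y hy
    have := (hS.mono (prod_mono (fun z hz => (hoffl z hz).1) subset_rfl)).eq_smul_visibleLift
      hΓ hσ (hAc.prod isPreconnected_Iio) (prod_subset_visible (fun z hz => (hoffl z hz).2) _)
      (one_mem Γ) (p := (zl, h - 1)) (q := (z, y)) ⟨hzl, by simp⟩ (by rw [hS0, one_smul]) ⟨hz, hy⟩
    rwa [one_smul] at this
  -- a chart near a point whose left and right half-discs lie in the two sectors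
  have chart : ∀ (k : Fin D.n) (t ε' : ℝ), 0 < ε' →
      Metric.ball (D.seg k t).1 ε' ⊆ B →
      (∀ z ∈ Metric.ball (D.seg k t).1 ε', 0 < (D.coord k z).im → z ∈ A) →
      (∀ z ∈ Metric.ball (D.seg k t).1 ε', (D.coord k z).im < 0 → z ∈ A') →
      IsWall f σ k t g R := by
    intro k t ε' hε' hsub hl hr
    refine ⟨ε', h, S, ⟨hε', hg, hR, hS.mono (prod_mono hsub subset_rfl), ?_,
      fun z hz him => hRV (hl z hz him), fun z hz him => hSl z (hl z hz him),
      fun z hz him y hy => hgr _ ⟨hr z hz him, hy⟩⟩⟩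
    intro z hz him
    rcases lt_or_gt_of_ne him with him | him
    · exact (hoffr z (hr z hz him)).2
    · exact (hoffl z (hl z hz him)).2
  -- A direction that differs from one of the two rays by less than this margin has not yet reached
  -- the other ray.
  have hδ : 0 < min β (2 * Real.pi - β) := lt_min hβ.1 (by linarith [hβ.2])
  have hnormB : ∀ z ∈ B, ‖D.coord j z‖ < ε / ‖D.dir j‖ := by
    intro z hz
    rw [lt_div_iff₀ hd, ← norm_mul]
    have e := eq_of_coord j z
    rw [mem_ball_iff_norm, hz₀v] at hz
    rwa [e, add_sub_cancel_left] at hz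
  -- a small disc around a point with coordinate `s * exp (α i)`
  have small : ∀ (k : Fin D.n) (t s α : ℝ), 0 < s →
      D.coord j (D.seg k t).1 = s * Complex.exp (α * Complex.I) →
      (D.seg k t).1 ∈ B → ∃ ε' > 0, Metric.ball (D.seg k t).1 ε' ⊆ B ∧
      ∀ z ∈ Metric.ball (D.seg k t).1 ε', ∃ η, |η| < min β (2 * Real.pi - β) ∧
        0 < ‖D.coord j z‖ ∧ D.coord j z = ‖D.coord j z‖ * Complex.exp ((α + η : ℝ) * Complex.I) ∧
        (0 < (D.coord j z * Complex.exp (-(α * Complex.I))).im → 0 < η) ∧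
        ((D.coord j z * Complex.exp (-(α * Complex.I))).im < 0 → η < 0) := by
    intro k t s α hs hst htB
    obtain ⟨ε₄, hε₄, h4⟩ := exists_polar_near (α := α) hs hδ
    obtain ⟨ε₅, hε₅, h5⟩ := Metric.isOpen_iff.1 Metric.isOpen_ball _ htB
    have hc : ContinuousAt (fun z => D.coord j z) (D.seg k t).1 :=
      (continuous_coord j).continuousAt
    obtain ⟨ε₆, hε₆, h6⟩ := Metric.continuousAt_iff.1 hc ε₄ hε₄
    refine ⟨min ε₅ ε₆, lt_min hε₅ hε₆, (Metric.ball_subset_ball (min_le_left _ _)).trans h5,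
      fun z hz => h4 _ ?_⟩
    rw [← hst, ← dist_eq_norm]
    exact h6 (lt_of_lt_of_le hz (min_le_right _ _))
  refine ⟨g, R, ?_, ?_⟩
  · have hc : Tendsto (fun t => (D.seg i t).1) (𝓝[<] 1) (𝓝 z₀) := by
      have := (continuous_fst.comp (continuous_seg i)).tendsto 1
      simp only [Function.comp_apply, seg_one] at this
      exact this.mono_left nhdsWithin_le_nhds
    filter_upwards [hc (Metric.ball_mem_nhds _ hε0), self_mem_nhdsWithin] with t htB ht1
    have ht1 : t < 1 := ht1
    obtain ⟨ε', hε', hsub, hsm⟩ := small i t ((1 - t) * r) β (mul_pos (by linarith) hr) (by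
      rw [hcoordi, coord_seg]; push_cast; ring) htB
    have him : ∀ z, (D.coord j z * Complex.exp (-(β * Complex.I))).im = -r * (D.coord i z).im := by
      intro z
      rw [hcoordi, mul_assoc, mul_assoc, ← Complex.exp_add, add_neg_cancel, Complex.exp_zero,
        mul_one, mul_comm, Complex.im_ofReal_mul]
      simp
    refine chart i t ε' hε' hsub (fun z hz hpos => ?_) fun z hz hneg => ?_
    · obtain ⟨η, hη, h0, hzη, -, hη0⟩ := hsm z hz
      have hη1 := hη0 (by rw [him]; nlinarith)
      have := abs_lt.1 hη
      exact mem_sector h0 (hnormB z (hsub hz)) hzη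
        ⟨by linarith [min_le_left β (2 * Real.pi - β)], by linarith⟩
    · obtain ⟨η, hη, h0, hzη, hη0, -⟩ := hsm z hz
      have hη1 := hη0 (by rw [him]; nlinarith)
      have := abs_lt.1 hη
      exact mem_sector h0 (hnormB z (hsub hz)) hzη
        ⟨by linarith, by linarith [min_le_right β (2 * Real.pi - β)]⟩
  · have hc : Tendsto (fun t => (D.seg j t).1) (𝓝[>] 0) (𝓝 z₀) := by
      have := (continuous_fst.comp (continuous_seg j)).tendsto 0
      exact this.mono_left nhdsWithin_le_nhds
    filter_upwards [hc (Metric.ball_mem_nhds _ hε0), self_mem_nhdsWithin] with t htB ht0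
    have ht0 : 0 < t := ht0
    obtain ⟨ε', hε', hsub, hsm⟩ := small j t t 0 ht0 (by rw [coord_seg]; simp) htB
    have him : ∀ z, (D.coord j z * Complex.exp (-((0 : ℝ) * Complex.I))).im =
        (D.coord j z).im := by
      intro z; simp
    refine chart j t ε' hε' hsub (fun z hz hpos => ?_) fun z hz hneg => ?_
    · obtain ⟨η, hη, h0, hzη, hη0, -⟩ := hsm z hz
      have hη1 := hη0 (by rw [him]; exact hpos)
      have := abs_lt.1 hη
      rw [zero_add] at hzη
      exact mem_sector h0 (hnormB z (hsub hz)) hzη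
        ⟨hη1, by linarith [min_le_left β (2 * Real.pi - β)]⟩
    · obtain ⟨η, hη, h0, hzη, -, hη0⟩ := hsm z hz
      have hη1 := hη0 (by rw [him]; exact hneg)
      have := abs_lt.1 hη
      rw [zero_add] at hzη
      -- Just to the right of the outgoing segment the angle is slightly negative; the right sector
      -- counts it as slightly less than 2π.
      refine mem_sector (η := η + 2 * Real.pi) h0 (hnormB z (hsub hz)) ?_
        ⟨by linarith [min_le_right β (2 * Real.pi - β)], by linarith⟩
      push_cast
      rw [add_mul, Complex.exp_add, Complex.exp_two_pi_mul_I, mul_one]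
      exact hzη

end LinkDiagram

end CuspedHyp

namespace CuspedHyp

namespace LinkDiagram

variable {D : LinkDiagram} {Γ : Subgroup PSL2} {f : Manifold Γ ≃ₜ D.Complement}
  {σ : ℂ × ℝ → H3}

/-! ## Walking along the link -/

lemma walk_eq {a : D.Param} {r τ : ℝ} {k : ℕ} (hτ : τ ∈ Ico (0 : ℝ) 1) (h : a.2 + r = k + τ) :
    D.walk a r = ((D.next ^ k) a.1, τ) := by
  have h1 : ⌊a.2 + r⌋₊ = k := by
    rw [h, Nat.floor_eq_iff (by have := hτ.1; positivity)]
    constructor <;> linarith [hτ.1, hτ.2]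
  have h2 : Int.fract (a.2 + r) = τ := by
    rw [h, Int.fract_natCast_add, Int.fract_eq_self.2 hτ]
  rw [walk, h1, h2]

lemma walk_decomp (a : D.Param) {r : ℝ} (h : 0 ≤ a.2 + r) :
    ∃ k : ℕ, ∃ τ ∈ Ico (0 : ℝ) 1, a.2 + r = k + τ ∧ D.walk a r = ((D.next ^ k) a.1, τ) := by
  have e : a.2 + r = (⌊a.2 + r⌋₊ : ℝ) + Int.fract (a.2 + r) := by
    rw [natCast_floor_eq_intCast_floor h, Int.floor_add_fract]
  exact ⟨_, _, ⟨Int.fract_nonneg _, Int.fract_lt_one _⟩, e, rfl⟩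

lemma walk_snd_mem (a : D.Param) (r : ℝ) : (D.walk a r).2 ∈ Ico (0 : ℝ) 1 :=
  ⟨Int.fract_nonneg _, Int.fract_lt_one _⟩

lemma walk_zero {a : D.Param} (ha : a.2 ∈ Ico (0 : ℝ) 1) : D.walk a 0 = a := by
  rw [walk_eq (k := 0) ha (by simp)]
  simp

lemma walk_walk {a : D.Param} {r s : ℝ} (ha : 0 ≤ a.2 + r) (hs : 0 ≤ s) :
    D.walk (D.walk a r) s = D.walk a (r + s) := by
  obtain ⟨k, τ, hτ, e, hw⟩ := walk_decomp a ha
  rw [hw]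
  obtain ⟨l, τ', hτ', e', hw'⟩ := walk_decomp ((D.next ^ k) a.1, τ) (r := s) (by
    have := hτ.1
    simp only
    linarith)
  rw [hw', walk_eq (k := l + k) hτ' (by push_cast; simp only at e'; linarith), pow_add]
  rfl

lemma walk_right {a : D.Param} {s : ℝ} (h : 0 ≤ a.2 + s) :
    ∀ᶠ s' in 𝓝[>] s, D.walk a s' = ((D.walk a s).1, (D.walk a s).2 + (s' - s)) := by
  obtain ⟨k, τ, hτ, e, hw⟩ := walk_decomp a h
  have h1 : ∀ᶠ s' in 𝓝[>] s, s' < s + (1 - τ) :=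
    nhdsWithin_le_nhds (Iio_mem_nhds (by linarith [hτ.2]))
  filter_upwards [h1, self_mem_nhdsWithin] with s' h1 h2
  have h2 : s < s' := h2
  rw [hw]
  exact walk_eq ⟨by linarith [hτ.1], by linarith⟩ (by linarith)

lemma walk_left {a : D.Param} {s : ℝ} (h : 0 ≤ a.2 + s) (h0 : 0 < (D.walk a s).2) :
    ∀ᶠ s' in 𝓝[<] s, D.walk a s' = ((D.walk a s).1, (D.walk a s).2 + (s' - s)) := by
  obtain ⟨k, τ, hτ, e, hw⟩ := walk_decomp a h
  rw [hw] at h0 ⊢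
  have h0 : 0 < τ := h0
  have h1 : ∀ᶠ s' in 𝓝[<] s, s - τ < s' :=
    nhdsWithin_le_nhds (Ioi_mem_nhds (by linarith))
  filter_upwards [h1, self_mem_nhdsWithin] with s' h1 h2
  have h2 : s' < s := h2
  exact walk_eq ⟨by linarith, by linarith [hτ.2]⟩ (by linarith)

lemma walk_left_vertex {a : D.Param} {s : ℝ} (h : 0 < a.2 + s) (h0 : (D.walk a s).2 = 0) :
    ∃ i, D.next i = (D.walk a s).1 ∧ ∀ᶠ s' in 𝓝[<] s, D.walk a s' = (i, 1 + (s' - s)) := by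
  obtain ⟨k, τ, hτ, e, hw⟩ := walk_decomp a h.le
  rw [hw] at h0 ⊢
  have h0 : τ = 0 := h0
  obtain ⟨l, rfl⟩ : ∃ l, k = l + 1 := by
    refine Nat.exists_eq_succ_of_ne_zero fun hk => ?_
    rw [e, hk, h0] at h
    simp at h
  refine ⟨(D.next ^ l) a.1, by rw [pow_succ']; rfl, ?_⟩
  have h1 : ∀ᶠ s' in 𝓝[<] s, s - 1 < s' := nhdsWithin_le_nhds (Ioi_mem_nhds (by linarith))
  filter_upwards [h1, self_mem_nhdsWithin] with s' h1 h2
  have h2 : s' < s := h2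
  push_cast at e
  exact walk_eq ⟨by linarith, by linarith⟩ (by linarith)

/-- Near a point of the link which is not a double point the wall is the same on both sides. -/
lemma exists_isWall_near (hΓ : IsFiniteVolumeManifoldGroup Γ) (hσ : IsLiftOn f id D.visible σ)
    {a : D.Param} {s : ℝ} (h : 0 < a.2 + s) (hreg : ¬ D.IsDouble (D.walk a s)) :
    ∃ g R, ∀ᶠ s' in 𝓝[≠] s, IsWall f σ (D.walk a s').1 (D.walk a s').2 g R := by
  -- At parameter 0 the walk is at a vertex, where the walls of two consecutive segments have to be
  -- matched. Otherwise one chart on a single segment serves both directions.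
  rcases (walk_snd_mem a s).1.eq_or_lt with h0 | h0
  · obtain ⟨i, hi, hl⟩ := walk_left_vertex h h0.symm
    obtain ⟨g, R, h1, h2⟩ := exists_isWall_vertex hΓ hσ i
    rw [hi] at h2
    refine ⟨g, R, ?_⟩
    rw [← Iio_union_Ioi, nhdsWithin_union, eventually_sup]
    constructor
    · have ht : Tendsto (fun s' => 1 + (s' - s)) (𝓝[<] s) (𝓝[<] 1) := by
        refine tendsto_nhdsWithin_iff.2 ⟨?_, ?_⟩
        · have : Continuous fun s' : ℝ => 1 + (s' - s) := by fun_prop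
          have := this.tendsto s
          simp only [sub_self, add_zero] at this
          exact this.mono_left nhdsWithin_le_nhds
        · filter_upwards [self_mem_nhdsWithin] with s' hs'
          have : s' < s := hs'
          simp only [mem_Iio]
          linarith
      filter_upwards [hl, ht h1] with s' h3 h4
      rw [h3]
      exact h4
    · have ht : Tendsto (fun s' => (D.walk a s).2 + (s' - s)) (𝓝[>] s) (𝓝[>] 0) := by
        rw [← h0]
        refine tendsto_nhdsWithin_iff.2 ⟨?_, ?_⟩
        · have : Continuous fun s' : ℝ => 0 + (s' - s) := by fun_prop
          have := this.tendsto s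
          simp only [sub_self, add_zero] at this
          exact this.mono_left nhdsWithin_le_nhds
        · filter_upwards [self_mem_nhdsWithin] with s' hs'
          have : s < s' := hs'
          simp only [mem_Ioi]
          linarith
      filter_upwards [walk_right h.le, ht h2] with s' h3 h4
      rw [h3]
      exact h4
  · obtain ⟨g, R, ε, y, S, w, -⟩ := exists_isWallChart hΓ hσ (i := (D.walk a s).1)
      ⟨h0, (walk_snd_mem a s).2⟩ hreg one_pos
    have hw := IsWall.eventually ⟨ε, y, S, w⟩
    have ht : Tendsto (fun s' => (D.walk a s).2 + (s' - s)) (𝓝 s) (𝓝 (D.walk a s).2) := by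
      have : Continuous fun s' : ℝ => (D.walk a s).2 + (s' - s) := by fun_prop
      have := this.tendsto s
      simpa only [sub_self, add_zero] using this
    have hw' := ht hw
    refine ⟨g, R, ?_⟩
    rw [← Iio_union_Ioi, nhdsWithin_union, eventually_sup]
    constructor
    · filter_upwards [walk_left h.le h0, nhdsWithin_le_nhds hw'] with s' h3 h4
      rw [h3]
      exact h4
    · filter_upwards [walk_right h.le, nhdsWithin_le_nhds hw'] with s' h3 h4
      rw [h3]
      exact h4

/-- The wall is the same all along an edge. -/
lemma exists_isWall_edge (hΓ : IsFiniteVolumeManifoldGroup Γ) (hσ : IsLiftOn f id D.visible σ)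
    {a : D.Param} (ha : 0 ≤ a.2) {r : ℝ} (hr : 0 < r)
    (hreg : ∀ s ∈ Ioo 0 r, ¬ D.IsDouble (D.walk a s)) :
    ∃ g R, ∀ s ∈ Ioo 0 r, (D.walk a s).2 ≠ 0 → IsWall f σ (D.walk a s).1 (D.walk a s).2 g R := by
  have hpos : ∀ s ∈ Ioo 0 r, 0 < a.2 + s := fun s hs => add_pos_of_nonneg_of_pos ha hs.1
  choose! G R hGR using fun s (hs : s ∈ Ioo 0 r) => exists_isWall_near hΓ hσ (hpos s hs) (hreg s hs)
  have hconst : ∀ x ∈ Ioo 0 r, ∀ y ∈ Ioo 0 r, G x = G y ∧ R x = R y := by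
    intro x hx y hy
    refine isPreconnected_Ioo.induction₂ (s := Ioo 0 r) (fun x y => G x = G y ∧ R x = R y)
      (fun x hx => ?_) ?_ ?_ hx hy
    · have h1 : ∀ᶠ y in 𝓝[≠] x, y ∈ Ioo 0 r := nhdsWithin_le_nhds (isOpen_Ioo.mem_nhds hx)
      have h2 := eventually_eventually_nhdsWithin.2 (hGR x hx)
      have h3 : ∀ᶠ y in 𝓝[≠] x, G x = G y ∧ R x = R y := by
        filter_upwards [h1, h2, self_mem_nhdsWithin] with y hy h2 hyx
        have hyx : y ∈ ({x}ᶜ : Set ℝ) := hyx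
        rw [isOpen_compl_singleton.nhdsWithin_eq hyx] at h2
        have h2' := (nhdsWithin_le_nhds : 𝓝[≠] y ≤ 𝓝 y) h2
        obtain ⟨z, h4, h5⟩ := (Filter.Eventually.and (f := 𝓝[≠] y) h2' (hGR y hy)).exists
        exact IsWall.unique hΓ h4 h5
      refine nhdsWithin_le_nhds ?_
      filter_upwards [eventually_nhdsWithin_iff.1 h3] with y hy
      by_cases hyx : y = x
      · rw [hyx]; exact ⟨rfl, rfl⟩
      · exact hy hyx
    · intro x y z _ _ _ h1 h2
      exact ⟨h1.1.trans h2.1, h1.2.trans h2.2⟩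
    · intro x y _ _ h
      exact ⟨h.1.symm, h.2.symm⟩
  refine ⟨G (r / 2), R (r / 2), fun s hs h0 => ?_⟩
  have hmid : r / 2 ∈ Ioo 0 r := ⟨by linarith, by linarith⟩
  obtain ⟨h1, h2⟩ := hconst s hs _ hmid
  rw [← h1, ← h2]
  have h0' : 0 < (D.walk a s).2 := lt_of_le_of_ne (walk_snd_mem a s).1 (Ne.symm h0)
  obtain ⟨g, R', ε, y, S, w, -⟩ := exists_isWallChart hΓ hσ (i := (D.walk a s).1)
    ⟨h0', (walk_snd_mem a s).2⟩ (hreg s hs) one_pos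
  have hw : IsWall f σ (D.walk a s).1 (D.walk a s).2 g R' := ⟨ε, y, S, w⟩
  have ht : Tendsto (fun s' => (D.walk a s).2 + (s' - s)) (𝓝[>] s) (𝓝 (D.walk a s).2) := by
    have : Continuous fun s' : ℝ => (D.walk a s).2 + (s' - s) := by fun_prop
    have := this.tendsto s
    simp only [sub_self, add_zero] at this
    exact this.mono_left nhdsWithin_le_nhds
  obtain ⟨s', h3, h4, h5⟩ := ((ht.eventually hw.eventually).and ((walk_right (hpos s hs).le).and
    (nhdsWithin_mono s (fun x (hx : s < x) => hx.ne') (hGR s hs)))).exists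
  rw [h4] at h5
  obtain ⟨rfl, rfl⟩ := IsWall.unique hΓ h3 h5
  exact hw

lemma IsWall.mem_closure {i : Fin D.n} {t : ℝ} {g : PSL2} {R : Set ℂ} (w : IsWall f σ i t g R) :
    (D.seg i t).1 ∈ closure R := by
  obtain ⟨ε, h, S, w⟩ := w
  rw [Metric.mem_closure_iff]
  intro δ hδ
  obtain ⟨z, hz, -, -, hl, -⟩ := exists_left_right i t (lt_min w.pos hδ)
  refine ⟨z, w.mem_region z (Metric.ball_subset_ball (min_le_left _ _) hz) hl, ?_⟩
  rw [dist_comm]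
  exact lt_of_lt_of_le hz (min_le_right _ _)

lemma isSide_of_isWall {a : D.Param} (ha : 0 ≤ a.2) {r : ℝ} {g : PSL2} {R : Set ℂ}
    (h : ∀ s ∈ Ioo 0 r, (D.walk a s).2 ≠ 0 → IsWall f σ (D.walk a s).1 (D.walk a s).2 g R) :
    D.IsSide a r R := by
  intro s hs
  have ht : Tendsto (fun s' => (D.seg (D.walk a s).1 ((D.walk a s).2 + (s' - s))).1) (𝓝[>] s)
      (𝓝 (D.pt (D.walk a s)).1) := by
    have h1 : Continuous fun s' : ℝ => (D.seg (D.walk a s).1 ((D.walk a s).2 + (s' - s))).1 :=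
      continuous_fst.comp ((continuous_seg _).comp (by fun_prop))
    have := h1.tendsto s
    simp only [sub_self, add_zero] at this
    exact this.mono_left nhdsWithin_le_nhds
  refine isClosed_closure.mem_of_tendsto ht ?_
  have h1 : ∀ᶠ s' in 𝓝[>] s, s' < r := nhdsWithin_le_nhds (Iio_mem_nhds hs.2)
  filter_upwards [walk_right (a := a) (s := s) (by linarith [hs.1]), h1, self_mem_nhdsWithin] with
    s' h2 h3 h4
  have h4 : s < s' := h4
  have h5 := h s' ⟨hs.1.trans h4, h3⟩
  rw [h2] at h5
  refine (h5 ?_).mem_closure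
  have := (walk_snd_mem a s).1
  simp only
  linarith

end LinkDiagram

end CuspedHyp

namespace CuspedHyp

namespace LinkDiagram

variable {D : LinkDiagram} {Γ : Subgroup PSL2} {f : Manifold Γ ≃ₜ D.Complement}
  {σ : ℂ × ℝ → H3} {m : MeridianSystem Γ}

/-! ## Neighbourhoods of crossing arcs -/

/-- The double cone around the crossing arc between two points of the link. -/
def spindle (a b : D.Param) (κ : ℝ) : Set (ℂ × ℝ) :=
  {p | ‖p.1 - (D.pt a).1‖ < κ * (p.2 - min (D.pt a).2 (D.pt b).2) ∧
    ‖p.1 - (D.pt a).1‖ < κ * (max (D.pt a).2 (D.pt b).2 - p.2)}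

lemma spindle_comm {a b : D.Param} (h : D.IsCrossing a b) (κ : ℝ) :
    spindle a b κ = spindle b a κ := by
  simp only [spindle, h.2.2.2, min_comm, max_comm]

lemma spindle_mono {a b : D.Param} {κ κ' : ℝ} (h : κ ≤ κ') (h0 : 0 < κ) :
    spindle a b κ ⊆ spindle a b κ' := by
  rintro p ⟨h1, h2⟩
  have h3 : 0 < p.2 - min (D.pt a).2 (D.pt b).2 :=
    (mul_pos_iff_of_pos_left h0).1 ((norm_nonneg _).trans_lt h1)
  have h4 : 0 < max (D.pt a).2 (D.pt b).2 - p.2 :=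
    (mul_pos_iff_of_pos_left h0).1 ((norm_nonneg _).trans_lt h2)
  exact ⟨h1.trans_le (by gcongr), h2.trans_le (by gcongr)⟩

lemma isOpen_spindle (a b : D.Param) (κ : ℝ) : IsOpen (spindle a b κ) :=
  IsOpen.inter
    (isOpen_lt (f := fun p : ℂ × ℝ => ‖p.1 - (D.pt a).1‖)
      (g := fun p => κ * (p.2 - min (D.pt a).2 (D.pt b).2)) (by fun_prop) (by fun_prop))
    (isOpen_lt (f := fun p : ℂ × ℝ => ‖p.1 - (D.pt a).1‖)
      (g := fun p => κ * (max (D.pt a).2 (D.pt b).2 - p.2)) (by fun_prop) (by fun_prop))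

lemma convex_spindle (a b : D.Param) (κ : ℝ) : Convex ℝ (spindle a b κ) := by
  rintro p ⟨hp1, hp2⟩ q ⟨hq1, hq2⟩ x y hx hy hxy
  have hn : ‖(x • p + y • q).1 - (D.pt a).1‖ ≤
      x * ‖p.1 - (D.pt a).1‖ + y * ‖q.1 - (D.pt a).1‖ := by
    have e : (x • p + y • q).1 - (D.pt a).1 =
        x • (p.1 - (D.pt a).1) + y • (q.1 - (D.pt a).1) := by
      have : (D.pt a).1 = x • (D.pt a).1 + y • (D.pt a).1 := by
        rw [← add_smul, hxy, one_smul]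
      simp only [Prod.fst_add, Prod.smul_fst, smul_sub]
      nth_rewrite 1 [this]
      abel
    rw [e]
    refine (norm_add_le _ _).trans ?_
    rw [norm_smul, norm_smul, Real.norm_eq_abs, Real.norm_eq_abs, abs_of_nonneg hx,
      abs_of_nonneg hy]
  have hyx : y = 1 - x := by linarith
  have hcomb : ∀ {u u' v v' : ℝ}, u < u' → v < v' → x * u + y * v < x * u' + y * v' := by
    intro u u' v v' h1 h2
    rcases hx.eq_or_lt with rfl | hx'
    · have : y = 1 := by linarith
      subst this; simpa using h2
    · nlinarith
  constructor
  · refine hn.trans_lt ((hcomb hp1 hq1).trans_eq ?_)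
    simp only [Prod.snd_add, Prod.smul_snd, smul_eq_mul]
    rw [hyx]; ring
  · refine hn.trans_lt ((hcomb hp2 hq2).trans_eq ?_)
    simp only [Prod.snd_add, Prod.smul_snd, smul_eq_mul]
    rw [hyx]; ring

lemma IsCrossing.lineMap_eq {a b : D.Param} (h : D.IsCrossing a b) (τ : ℝ) :
    AffineMap.lineMap (D.pt a) (D.pt b) τ =
      ((D.pt a).1, (D.pt a).2 + τ * ((D.pt b).2 - (D.pt a).2)) := by
  rw [AffineMap.lineMap_apply]
  refine Prod.ext ?_ ?_
  · simp [h.2.2.2]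
  · simp [add_comm]

lemma mem_spindle_of_fst_eq {a b : D.Param} {κ : ℝ} (hκ : 0 < κ) {y : ℝ}
    (h1 : min (D.pt a).2 (D.pt b).2 < y) (h2 : y < max (D.pt a).2 (D.pt b).2) :
    ((D.pt a).1, y) ∈ spindle a b κ := by
  simp only [spindle, Set.mem_ofPred_eq, sub_self, norm_zero]
  exact ⟨mul_pos hκ (by linarith), mul_pos hκ (by linarith)⟩

lemma IsCrossing.lineMap_mem_spindle {a b : D.Param} (h : D.IsCrossing a b) {κ : ℝ} (hκ : 0 < κ)
    {τ : ℝ} (hτ : τ ∈ Ioo (0 : ℝ) 1) : AffineMap.lineMap (D.pt a) (D.pt b) τ ∈ spindle a b κ := by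
  rw [h.lineMap_eq]
  have h0 := hτ.1
  have h1 := hτ.2
  rcases lt_or_gt_of_ne h.snd_ne with h2 | h2
  · refine mem_spindle_of_fst_eq hκ ?_ ?_
    · rw [min_eq_left h2.le]; nlinarith
    · rw [max_eq_right h2.le]; nlinarith
  · refine mem_spindle_of_fst_eq hκ ?_ ?_
    · rw [min_eq_right h2.le]; nlinarith
    · rw [max_eq_left h2.le]; nlinarith

lemma tendsto_one_sub_left : Tendsto (fun τ : ℝ => 1 - τ) (𝓝[>] 0) (𝓝[<] 1) := by
  refine tendsto_nhdsWithin_iff.2 ⟨?_, ?_⟩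
  · have : Continuous fun τ : ℝ => 1 - τ := by fun_prop
    have := this.tendsto 0
    rw [sub_zero] at this
    exact this.mono_left nhdsWithin_le_nhds
  · filter_upwards [self_mem_nhdsWithin] with τ hτ
    have : (0 : ℝ) < τ := hτ
    simp only [mem_Iio]; linarith

lemma tendsto_one_sub_right : Tendsto (fun τ : ℝ => 1 - τ) (𝓝[<] 1) (𝓝[>] 0) := by
  refine tendsto_nhdsWithin_iff.2 ⟨?_, ?_⟩
  · have : Continuous fun τ : ℝ => 1 - τ := by fun_prop
    have := this.tendsto 1
    rw [sub_self] at this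
    exact this.mono_left nhdsWithin_le_nhds
  · filter_upwards [self_mem_nhdsWithin] with τ hτ
    have : τ < (1 : ℝ) := hτ
    simp only [mem_Ioi]; linarith

lemma Joins.reverse {c : ℝ → H3} {P Q : OnePoint ℂ} (h : Joins Γ c P Q) :
    Joins Γ (fun τ => c (1 - τ)) Q P :=
  ⟨h.2.1, h.1, h.2.2.2.comp tendsto_one_sub_left, h.2.2.1.comp tendsto_one_sub_right⟩

lemma Joins.smul {c : ℝ → H3} {P Q : OnePoint ℂ} (h : Joins Γ c P Q) {g : PSL2} (hg : g ∈ Γ) :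
    Joins Γ (fun τ => g • c τ) (g • P) (g • Q) :=
  ⟨h.1.smul hg, h.2.1.smul hg, h.2.2.1.smul g, h.2.2.2.smul g⟩

lemma Joins.congr {c c' : ℝ → H3} {P Q : OnePoint ℂ} (h : Joins Γ c P Q)
    (hc : EqOn c c' (Ioo 0 1)) : Joins Γ c' P Q := by
  refine ⟨h.1, h.2.1, h.2.2.1.congr ?_, h.2.2.2.congr ?_⟩
  · filter_upwards [Ioo_mem_nhdsGT (zero_lt_one' ℝ)] with τ hτ using hc hτ
  · filter_upwards [Ioo_mem_nhdsLT (zero_lt_one' ℝ)] with τ hτ using hc hτ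

lemma Joins.unique {c : ℝ → H3} {P Q P' Q' : OnePoint ℂ} (h : Joins Γ c P Q)
    (h' : Joins Γ c P' Q') : P = P' ∧ Q = Q' :=
  ⟨h.2.2.1.eq h'.2.2.1, h.2.2.2.eq h'.2.2.2⟩

/-! ## Tubes around the strands of a crossing -/

/-- Cylindrical coordinates around segment `a.1`, in vertical planes. -/
def tubeMap (a : D.Param) (q : ℝ × ℝ × ℝ) : ℂ × ℝ := D.meridianLoop (a.1, a.2 + q.1) q.2.1 q.2.2

def tube (ε : ℝ) : Set (ℝ × ℝ × ℝ) := Ioo (-ε) ε ×ˢ Ioo 0 ε ×ˢ univ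

lemma isOpen_tube (ε : ℝ) : IsOpen (tube ε) := isOpen_Ioo.prod (isOpen_Ioo.prod isOpen_univ)

lemma convex_tube (ε : ℝ) : Convex ℝ (tube ε) :=
  (convex_Ioo _ _).prod ((convex_Ioo _ _).prod convex_univ)

lemma tubeMap_eq (a : D.Param) (s r θ : ℝ) : tubeMap a (s, r, θ) =
    ((D.seg a.1 (a.2 + s)).1 + (r * Real.cos θ : ℝ) * (Complex.I * D.dir a.1),
      (D.seg a.1 (a.2 + s)).2 + r * Real.sin θ) := rfl

lemma continuous_tubeMap (a : D.Param) : Continuous (tubeMap a) := by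
  have e : tubeMap a = fun q : ℝ × ℝ × ℝ =>
      ((D.seg a.1 (a.2 + q.1)).1 + (q.2.1 * Real.cos q.2.2 : ℝ) * (Complex.I * D.dir a.1),
      (D.seg a.1 (a.2 + q.1)).2 + q.2.1 * Real.sin q.2.2) := rfl
  rw [e]
  have h := continuous_seg a.1
  have h1 : Continuous fun q : ℝ × ℝ × ℝ => D.seg a.1 (a.2 + q.1) := h.comp (by fun_prop)
  have h2 : Continuous fun q : ℝ × ℝ × ℝ => ((q.2.1 * Real.cos q.2.2 : ℝ) : ℂ) :=
    Complex.continuous_ofReal.comp (by fun_prop)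
  exact ((continuous_fst.comp h1).add (h2.mul continuous_const)).prodMk
    ((continuous_snd.comp h1).add (by fun_prop))

lemma coord_tubeMap (a : D.Param) (s r θ : ℝ) :
    D.coord a.1 (tubeMap a (s, r, θ)).1 = (a.2 + s : ℝ) + (r * Real.cos θ : ℝ) * Complex.I := by
  rw [tubeMap_eq, ← mul_assoc, coord_seg_add]

lemma tubeMap_add_two_pi (a : D.Param) (s r θ : ℝ) :
    tubeMap a (s, r, θ + 2 * Real.pi) = tubeMap a (s, r, θ) := by
  rw [tubeMap_eq, tubeMap_eq, Real.cos_add_two_pi, Real.sin_add_two_pi]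

lemma tubeMap_fst_sub (a : D.Param) (s r θ : ℝ) : (tubeMap a (s, r, θ)).1 - (D.pt a).1 =
    (s + (r * Real.cos θ : ℝ) * Complex.I) * D.dir a.1 := by
  rw [tubeMap_eq, pt_eq_seg, seg_fst, seg_fst]
  push_cast
  ring

lemma tubeMap_snd (a : D.Param) (s r θ : ℝ) : (tubeMap a (s, r, θ)).2 =
    (D.pt a).2 + s * D.rise a.1 + r * Real.sin θ := by
  rw [tubeMap_eq, pt_eq_seg, seg_snd, seg_snd]
  ring

/-- The vertical direction at `a` towards the crossing strand `b`. -/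
def arcSign (a b : D.Param) : ℝ := if (D.pt a).2 < (D.pt b).2 then 1 else -1

lemma arcSign_eq (a b : D.Param) : arcSign a b = 1 ∨ arcSign a b = -1 := by
  unfold arcSign; split_ifs <;> simp

lemma IsCrossing.arcSign_mul_abs {a b : D.Param} (h : D.IsCrossing a b) :
    arcSign a b * |(D.pt b).2 - (D.pt a).2| = (D.pt b).2 - (D.pt a).2 := by
  unfold arcSign
  split_ifs with h1
  · rw [abs_of_pos (by linarith), one_mul]
  · have := lt_of_le_of_ne (not_lt.1 h1) h.snd_ne.symm
    rw [abs_of_neg (by linarith)]; ring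

lemma tubeMap_arc {a b : D.Param} (h : D.IsCrossing a b) (r : ℝ) :
    tubeMap a (0, r, arcSign a b * (Real.pi / 2)) =
      AffineMap.lineMap (D.pt a) (D.pt b) (r / |(D.pt b).2 - (D.pt a).2|) := by
  have hl : |(D.pt b).2 - (D.pt a).2| ≠ 0 := abs_ne_zero.2 (sub_ne_zero.2 h.snd_ne.symm)
  rw [h.lineMap_eq, tubeMap_eq, add_zero, pt_eq_seg a]
  refine Prod.ext ?_ ?_
  · rcases arcSign_eq a b with h1 | h1 <;> simp [h1]
  · have h2 := h.arcSign_mul_abs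
    rw [pt_eq_seg a] at h2 hl
    simp only
    have h3 : r / |(D.pt b).2 - (D.seg a.1 a.2).2| * ((D.pt b).2 - (D.seg a.1 a.2).2) =
        r * arcSign a b := by
      generalize |(D.pt b).2 - (D.seg a.1 a.2).2| = l at *
      rw [← h2]
      field_simp
    rw [h3]
    rcases arcSign_eq a b with h1 | h1 <;> simp [h1]

/-- Small tubes around a strand of a crossing do not meet the link. -/
lemma IsCrossing.exists_tube {a b : D.Param} (h : D.IsCrossing a b) : ∃ ε > 0,
    ε < |(D.pt b).2 - (D.pt a).2| ∧
    (∀ q ∈ tube ε, tubeMap a q ∉ D.link) ∧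
    (∀ q ∈ tube ε, ∀ k, ∀ τ ∈ Icc (0 : ℝ) 1, (D.seg k τ).1 = (tubeMap a q).1 →
      k = a.1 ∨ k = b.1) := by
  obtain ⟨ε₁, hε₁, h1⟩ := h.exists_nhd
  set l := |(D.pt b).2 - (D.pt a).2| with hl
  have hl0 : 0 < l := abs_pos.2 (sub_ne_zero.2 h.snd_ne.symm)
  obtain ⟨ε₂, hε₂, h2⟩ := exists_height_close b.1 b.2 (show 0 < l / 4 by linarith)
  have hd : 0 < ‖D.dir a.1‖ := norm_pos_iff.2 (dir_ne_zero a.1)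
  -- The first bound keeps the projection of the tube near the crossing, the second keeps its height
  -- within l / 4 of that of `a`. Strand `b` stays within l / 4 of its own height at the crossing,
  -- at distance l, so the tube cannot reach it.
  set ε := min (min ε₁ ε₂ / (2 * ‖D.dir a.1‖)) (l / (4 * (|D.rise a.1| + 1))) with hε
  have hε0 : 0 < ε := lt_min (div_pos (lt_min hε₁ hε₂) (by positivity)) (by positivity)
  have hεr : ε * (|D.rise a.1| + 1) ≤ l / 4 := by
    have : ε ≤ l / (4 * (|D.rise a.1| + 1)) := min_le_right _ _
    rw [le_div_iff₀ (by positivity)] at this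
    linarith
  have hnear : ∀ q ∈ tube ε, ‖(tubeMap a q).1 - (D.pt a).1‖ < min ε₁ ε₂ := by
    rintro ⟨s, r, θ⟩ ⟨hs, hr, -⟩
    have hs : s ∈ Ioo (-ε) ε := hs
    have hr : r ∈ Ioo 0 ε := hr
    rw [tubeMap_fst_sub, norm_mul]
    have hn : ‖(s : ℂ) + (r * Real.cos θ : ℝ) * Complex.I‖ < 2 * ε := by
      refine (norm_add_le _ _).trans_lt ?_
      rw [norm_mul, Complex.norm_I, mul_one, Complex.norm_real, Complex.norm_real,
        Real.norm_eq_abs, Real.norm_eq_abs, abs_mul, abs_of_pos hr.1]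
      have h3 := abs_lt.2 ⟨hs.1, hs.2⟩
      have h4 := Real.abs_cos_le_one θ
      nlinarith [hr.1, hr.2]
    have : ε ≤ min ε₁ ε₂ / (2 * ‖D.dir a.1‖) := min_le_left _ _
    rw [le_div_iff₀ (by positivity)] at this
    calc _ < 2 * ε * ‖D.dir a.1‖ := by gcongr
      _ ≤ _ := by linarith
  have hheight : ∀ q ∈ tube ε, |(tubeMap a q).2 - (D.pt a).2| ≤ l / 4 := by
    rintro ⟨s, r, θ⟩ ⟨hs, hr, -⟩
    have hs : s ∈ Ioo (-ε) ε := hs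
    have hr : r ∈ Ioo 0 ε := hr
    rw [tubeMap_snd]
    have h3 := (abs_lt.2 ⟨hs.1, hs.2⟩).le
    have h4 := Real.abs_sin_le_one θ
    have e : (D.pt a).2 + s * D.rise a.1 + r * Real.sin θ - (D.pt a).2 =
      s * D.rise a.1 + r * Real.sin θ := by ring
    rw [e]
    refine (abs_add_le _ _).trans ?_
    rw [abs_mul, abs_mul, abs_of_pos hr.1]
    have h5 := mul_le_mul h3 le_rfl (abs_nonneg (D.rise a.1)) hε0.le
    have h6 := mul_le_mul hr.2.le h4 (abs_nonneg _) hε0.le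
    linarith
  have hb : ∀ q ∈ tube ε, ∀ τ ∈ Icc (0 : ℝ) 1, (D.seg b.1 τ).1 = (tubeMap a q).1 →
      |(D.seg b.1 τ).2 - (D.pt b).2| < l / 4 := by
    intro q hq τ hτ e
    refine h2 τ ?_
    rw [← pt_eq_seg, ← h.2.2.2, e]
    exact (hnear q hq).trans_le (min_le_right _ _)
  have hstrand : ∀ q ∈ tube ε, ∀ k, ∀ τ ∈ Icc (0 : ℝ) 1, (D.seg k τ).1 = (tubeMap a q).1 →
      k = a.1 ∨ k = b.1 := by
    intro q hq k τ hτ e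
    refine h1 k τ hτ ?_
    rw [e]
    exact (hnear q hq).trans_le (min_le_left _ _)
  refine ⟨ε, hε0, ?_, ?_, hstrand⟩
  · have := abs_nonneg (D.rise a.1)
    nlinarith
  · rintro ⟨s, r, θ⟩ hq hL
    obtain ⟨k, τ, hτ, e⟩ := mem_link_iff.1 hL
    have e1 := congrArg Prod.fst e
    have e2 := congrArg Prod.snd e
    rcases hstrand _ hq k τ hτ e1 with rfl | rfl
    · have hr : r ∈ Ioo 0 ε := hq.2.1
      have h3 := coord_tubeMap a s r θ
      rw [← e1, coord_seg] at h3
      have him := congrArg Complex.im h3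
      have hre := congrArg Complex.re h3
      simp at him hre
      rw [tubeMap_eq, hre] at e2
      have hcos : Real.cos θ = 0 := him.resolve_left hr.1.ne'
      have hsin : Real.sin θ = 0 := by
        have : r * Real.sin θ = 0 := by
          simp only at e2
          linarith
        exact (mul_eq_zero.1 this).resolve_left hr.1.ne'
      have := Real.sin_sq_add_cos_sq θ
      rw [hcos, hsin] at this
      norm_num at this
    · have h3 := hb _ hq τ hτ e1
      have h4 := hheight _ hq
      rw [← e2] at h4
      have h5 : l ≤ |(D.seg b.1 τ).2 - (D.pt b).2| + |(D.seg b.1 τ).2 - (D.pt a).2| := by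
        rw [hl, abs_sub_comm ((D.seg b.1 τ).2) ((D.pt b).2)]
        exact abs_sub_le _ _ _
      linarith

/-- A lift of the tube, with the meridian as monodromy. -/
lemma exists_tubeLift (hΓ : IsFiniteVolumeManifoldGroup Γ) (hm : IsStandardMeridian f m)
    {a b : D.Param} {c : ℝ → H3} (hc : IsCrossingLift f a b c) {P : OnePoint ℂ}
    (hP : IsCusp Γ P) (hcP : TendsToIdeal (𝓝[>] 0) c P) {ε : ℝ} (hε : 0 < ε)
    (hεl : ε < |(D.pt b).2 - (D.pt a).2|) (hL : ∀ q ∈ tube ε, tubeMap a q ∉ D.link) :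
    ∃ Ψ : ℝ × ℝ × ℝ → H3, IsLiftOn f (tubeMap a) (tube ε) Ψ ∧
      (∀ r ∈ Ioo 0 ε, Ψ (0, r, arcSign a b * (Real.pi / 2)) =
        c (r / |(D.pt b).2 - (D.pt a).2|)) ∧
      ∀ s r θ, (s, r, θ) ∈ tube ε → Ψ (s, r, θ + 2 * Real.pi) = m.meridian P • Ψ (s, r, θ) := by
  obtain ⟨hab, hcc, hcl⟩ := hc
  set l := |(D.pt b).2 - (D.pt a).2| with hl
  have hl0 : 0 < l := hε.trans hεl
  set θ₀ := arcSign a b * (Real.pi / 2) with hθ₀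
  have hrl : ∀ r ∈ Ioo 0 ε, r / l ∈ Ioo (0 : ℝ) 1 := fun r hr =>
    ⟨div_pos hr.1 hl0, (div_lt_one hl0).2 (hr.2.trans hεl)⟩
  have hmid : ε / 2 ∈ Ioo 0 ε := ⟨by linarith, by linarith⟩
  have hbase : ((0 : ℝ), ε / 2, θ₀) ∈ tube ε := ⟨⟨by linarith, hε⟩, hmid, trivial⟩
  obtain ⟨Ψ, hΨ, hΨ0⟩ := IsLiftOn.exists_of_convex (f := f) (φ := tubeMap a) hΓ (isOpen_tube ε)
    (convex_tube ε) (continuous_tubeMap a).continuousOn hL hbase (x₀ := c (ε / 2 / l)) (by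
      rw [hcl _ (hrl _ hmid), tubeMap_arc hab])
  have hray : ∀ r ∈ Ioo 0 ε, Ψ (0, r, θ₀) = c (r / l) := by
    have h1 : IsLiftOn f (tubeMap a ∘ fun r => (0, r, θ₀)) (Ioo 0 ε) (Ψ ∘ fun r => (0, r, θ₀)) :=
      hΨ.comp (by fun_prop) fun r hr => ⟨⟨by linarith, hε⟩, hr, trivial⟩
    have h2 : IsLiftOn f (tubeMap a ∘ fun r => (0, r, θ₀)) (Ioo 0 ε) (fun r => c (r / l)) := by
      refine ⟨hcc.comp (by fun_prop) hrl, fun r hr => ?_⟩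
      rw [hcl _ (hrl r hr)]
      simp only [Function.comp_apply]
      rw [tubeMap_arc hab]
    intro r hr
    exact h2.eqOn hΓ isPreconnected_Ioo h1 hmid hΨ0 hr
  refine ⟨Ψ, hΨ, hray, ?_⟩
  -- The hypothesis on the meridians gives the monodromy on the slice s = 0 through `a`, since the
  -- ray at angle θ₀ is the beginning of the crossing arc and runs to P. Uniqueness of lifts extends
  -- it to the whole tube.
  have hstd := hm a (ε / 2) (fun q => Ψ (0, q.1, q.2)) P θ₀ hab.mem_Ioo (by linarith)
    (hΨ.1.comp (by fun_prop) fun q hq =>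
      ⟨⟨by simp only; linarith, hε⟩, ⟨hq.1.1, hq.1.2.trans_lt hmid.2⟩, trivial⟩)
    (fun r hr θ => by
      rw [hΨ.2 _ ⟨⟨by simp only; linarith, hε⟩, ⟨hr.1, hr.2.trans_lt hmid.2⟩, trivial⟩]
      simp only [tubeMap, add_zero])
    hP (by
      have ht : Tendsto (fun r => r / l) (𝓝[>] 0) (𝓝[>] 0) := by
        refine tendsto_nhdsWithin_iff.2 ⟨?_, ?_⟩
        · have : Continuous fun r : ℝ => r / l := by fun_prop
          have := this.tendsto 0
          rw [zero_div] at this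
          exact this.mono_left nhdsWithin_le_nhds
        · filter_upwards [self_mem_nhdsWithin] with r hr
          exact div_pos hr hl0
      refine (hcP.comp ht).congr ?_
      filter_upwards [Ioo_mem_nhdsGT hε] with r hr
      exact (hray r hr).symm)
    (ε / 2) ⟨by linarith, le_rfl⟩ θ₀
  intro s r θ hq
  have hshift : IsLiftOn f (tubeMap a) (tube ε) (fun q => Ψ (q.1, q.2.1, q.2.2 + 2 * Real.pi)) := by
    have := hΨ.comp (ψ := fun q : ℝ × ℝ × ℝ => (q.1, q.2.1, q.2.2 + 2 * Real.pi)) (V := tube ε)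
      (by fun_prop) fun q hq => ⟨hq.1, hq.2.1, trivial⟩
    refine ⟨this.1, fun q hq => (this.2 q hq).trans ?_⟩
    rw [Function.comp_apply, tubeMap_add_two_pi]
  exact hΨ.eqOn_smul hΓ (convex_tube ε).isPreconnected hshift (m.mem P hP) hbase hstd hq

end LinkDiagram

end CuspedHyp

namespace CuspedHyp

namespace LinkDiagram

variable {D : LinkDiagram} {Γ : Subgroup PSL2} {f : Manifold Γ ≃ₜ D.Complement}
  {σ : ℂ × ℝ → H3} {m : MeridianSystem Γ}

/-! ## Lifts of neighbourhoods of crossing arcs -/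

/-- The crossing arc in a lift of a neighbourhood of it. -/
def arc (S : ℂ × ℝ → H3) (a b : D.Param) (τ : ℝ) : H3 := S (AffineMap.lineMap (D.pt a) (D.pt b) τ)

lemma arc_swap (S : ℂ × ℝ → H3) (a b : D.Param) :
    arc S b a = fun τ => arc S a b (1 - τ) := by
  funext τ
  simp only [arc, AffineMap.lineMap_apply_one_sub]

lemma IsCrossing.isCrossingLift_arc {a b : D.Param} (h : D.IsCrossing a b) {κ : ℝ} (hκ : 0 < κ)
    {S : ℂ × ℝ → H3} (hS : IsLiftOn f id (spindle a b κ) S) : IsCrossingLift f a b (arc S a b) := by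
  refine ⟨h, hS.1.comp (AffineMap.lineMap_continuous).continuousOn fun τ hτ =>
    h.lineMap_mem_spindle hκ hτ, fun τ hτ => hS.2 _ (h.lineMap_mem_spindle hκ hτ)⟩

variable (f σ) in
/-- A lift of a neighbourhood of the crossing arc from `a` to `b` which agrees with `σ` on the left
of the strand `a`, close to the strand, after the crossing if `e = 1` and before the crossing if
`e = -1`. -/
def IsSectorLift (a b : D.Param) (κ e : ℝ) (S : ℂ × ℝ → H3) : Prop :=
  0 < κ ∧ IsLiftOn f id (spindle a b κ) S ∧ ∃ δ > 0, ∀ p ∈ spindle a b κ,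
    0 < (D.coord a.1 p.1).im → (D.coord a.1 p.1).im < δ * (e * ((D.coord a.1 p.1).re - a.2)) →
    S p = σ p

variable (f σ) in
/-- A lift of a neighbourhood of the crossing arc from `o` to `u` which agrees with `σ` on one side
of the strand `o`, on the left if `ρ = 1` and on the right if `ρ = -1`. -/
def IsSideLift (o u : D.Param) (κ ρ : ℝ) (S : ℂ × ℝ → H3) : Prop :=
  0 < κ ∧ IsLiftOn f id (spindle o u κ) S ∧
    ∀ p ∈ spindle o u κ, 0 < ρ * (D.coord o.1 p.1).im → S p = σ p

lemma IsSectorLift.mono {a b : D.Param} {κ κ' e : ℝ} {S : ℂ × ℝ → H3}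
    (h : IsSectorLift f σ a b κ e S) (h0 : 0 < κ') (hκ : κ' ≤ κ) : IsSectorLift f σ a b κ' e S := by
  obtain ⟨-, h1, δ, hδ, h2⟩ := h
  have hs := spindle_mono (a := a) (b := b) hκ h0
  exact ⟨h0, h1.mono hs, δ, hδ, fun p hp => h2 p (hs hp)⟩

lemma IsSideLift.mono {o u : D.Param} {κ κ' ρ : ℝ} {S : ℂ × ℝ → H3}
    (h : IsSideLift f σ o u κ ρ S) (h0 : 0 < κ') (hκ : κ' ≤ κ) : IsSideLift f σ o u κ' ρ S := by
  have hs := spindle_mono (a := o) (b := u) hκ h0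
  exact ⟨h0, h.2.1.mono hs, fun p hp => h.2.2 p (hs hp)⟩

/-- The double cone around the arc from the overpass `o` to the underpass `u` is so thin that it
lies strictly between the strands. -/
structure IsArcNhd (o u : D.Param) (κ : ℝ) : Prop where
  pos : 0 < κ
  not_mem_link : ∀ p ∈ spindle o u κ, p ∉ D.link
  mem_visible : ∀ p ∈ spindle o u κ, (D.coord o.1 p.1).im ≠ 0 → p ∈ D.visible

lemma IsArcNhd.mono {o u : D.Param} {κ κ' : ℝ} (h : IsArcNhd o u κ) (h0 : 0 < κ') (hκ : κ' ≤ κ) :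
    IsArcNhd o u κ' :=
  have hs := spindle_mono (a := o) (b := u) hκ h0
  ⟨h0, fun p hp => h.not_mem_link p (hs hp), fun p hp => h.mem_visible p (hs hp)⟩

lemma abs_mul_rise_lt {a : D.Param} {τ κ x : ℝ} (hκ : 0 < κ) (hr : κ * |D.rise a.1| ≤ ‖D.dir a.1‖)
    (h : ‖(D.seg a.1 τ).1 - (D.pt a).1‖ < κ * x) : |(D.seg a.1 τ).2 - (D.pt a).2| < x := by
  rw [pt_eq_seg, seg_fst, seg_fst, add_sub_add_left_eq_sub, ← sub_mul, norm_mul,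
    ← Complex.ofReal_sub, Complex.norm_real, Real.norm_eq_abs] at h
  rw [pt_eq_seg, seg_snd, seg_snd, add_sub_add_left_eq_sub, ← sub_mul, abs_mul]
  have h1 := mul_le_mul_of_nonneg_left hr (abs_nonneg (τ - a.2))
  have h2 : κ * (|τ - a.2| * |D.rise a.1|) < κ * x := by linarith
  exact lt_of_mul_lt_mul_left h2 hκ.le

/-- If the sides of the double cone are steeper than both strands, the overpass passes above it and
the underpass below it. Away from the vertical plane of the overpass nothing then lies above a point
of the cone. -/
lemma IsCrossing.exists_isArcNhd {o u : D.Param} (h : D.IsCrossing o u)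
    (hou : (D.pt u).2 < (D.pt o).2) : ∃ κ, IsArcNhd o u κ := by
  obtain ⟨ε, hε, h1⟩ := h.exists_nhd
  have hl : 0 < (D.pt o).2 - (D.pt u).2 := sub_pos.2 hou
  have hdo : 0 < ‖D.dir o.1‖ := norm_pos_iff.2 (dir_ne_zero o.1)
  have hdu : 0 < ‖D.dir u.1‖ := norm_pos_iff.2 (dir_ne_zero u.1)
  -- The three bounds keep the cone over the disc that contains no further strand, and make it
  -- steeper than the overpass and the underpass.
  set κ := min (ε / ((D.pt o).2 - (D.pt u).2))
    (min (‖D.dir o.1‖ / (|D.rise o.1| + 1)) (‖D.dir u.1‖ / (|D.rise u.1| + 1))) with hκ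
  have hκ0 : 0 < κ := lt_min (by positivity) (lt_min (by positivity) (by positivity))
  have k1 : κ * ((D.pt o).2 - (D.pt u).2) ≤ ε := by
    rw [← le_div_iff₀ hl]; exact min_le_left _ _
  have k2 : κ * |D.rise o.1| ≤ ‖D.dir o.1‖ := by
    have : κ * (|D.rise o.1| + 1) ≤ ‖D.dir o.1‖ := by
      rw [← le_div_iff₀ (by positivity)]
      exact (min_le_right _ _).trans (min_le_left _ _)
    linarith
  have k3 : κ * |D.rise u.1| ≤ ‖D.dir u.1‖ := by
    have : κ * (|D.rise u.1| + 1) ≤ ‖D.dir u.1‖ := by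
      rw [← le_div_iff₀ (by positivity)]
      exact (min_le_right _ _).trans (min_le_right _ _)
    linarith
  have key : ∀ p ∈ spindle o u κ, ∀ k, ∀ τ ∈ Icc (0 : ℝ) 1, (D.seg k τ).1 = p.1 →
      (k = o.1 ∧ p.2 < (D.seg k τ).2) ∨ (k = u.1 ∧ (D.seg k τ).2 < p.2) := by
    rintro p ⟨hp1, hp2⟩ k τ hτ e
    rw [min_eq_right hou.le] at hp1
    rw [max_eq_left hou.le] at hp2
    have hn : ‖(D.seg k τ).1 - (D.pt o).1‖ < ε := by
      rw [e]
      have h3 : 0 < p.2 - (D.pt u).2 :=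
        (mul_pos_iff_of_pos_left hκ0).1 ((norm_nonneg _).trans_lt hp1)
      refine hp2.trans_le (le_trans ?_ k1)
      gcongr
      linarith
    rcases h1 k τ hτ hn with rfl | rfl
    · rw [← e] at hp2
      have := (abs_lt.1 (abs_mul_rise_lt hκ0 k2 hp2)).1
      exact Or.inl ⟨rfl, by linarith⟩
    · rw [← e, h.2.2.2] at hp1
      have := (abs_lt.1 (abs_mul_rise_lt hκ0 k3 hp1)).2
      exact Or.inr ⟨rfl, by linarith⟩
  refine ⟨κ, hκ0, fun p hp hL => ?_, fun p hp him k τ hτ e => ?_⟩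
  · obtain ⟨k, τ, hτ, rfl⟩ := mem_link_iff.1 hL
    rcases key _ hp k τ hτ rfl with ⟨-, h2⟩ | ⟨-, h2⟩ <;> exact lt_irrefl _ h2
  · rcases key _ hp k τ hτ e with ⟨h2, -⟩ | ⟨-, h2⟩
    · exact absurd (by rw [coord_eq_of_seg_eq h2 e, Complex.ofReal_im]) him
    · exact h2

/-- Points near the middle of a crossing arc. -/
lemma IsCrossing.eventually_mem_spindle {a b : D.Param} (h : D.IsCrossing a b) {κ : ℝ}
    (hκ : 0 < κ) (w : ℂ) : ∀ᶠ x : ℝ in 𝓝[>] 0,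
      ((D.pt a).1 + x * w, ((D.pt a).2 + (D.pt b).2) / 2) ∈ spindle a b κ := by
  have hc : Continuous fun x : ℝ => ((D.pt a).1 + x * w, ((D.pt a).2 + (D.pt b).2) / 2) := by
    fun_prop
  have h0 : ((D.pt a).1 + (0 : ℝ) * w, ((D.pt a).2 + (D.pt b).2) / 2) ∈ spindle a b κ := by
    rw [Complex.ofReal_zero, zero_mul, add_zero]
    rcases lt_or_gt_of_ne h.snd_ne with h2 | h2
    · exact mem_spindle_of_fst_eq hκ (by rw [min_eq_left h2.le]; linarith)
        (by rw [max_eq_right h2.le]; linarith)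
    · exact mem_spindle_of_fst_eq hκ (by rw [min_eq_right h2.le]; linarith)
        (by rw [max_eq_left h2.le]; linarith)
  exact nhdsWithin_le_nhds (hc.tendsto 0 ((isOpen_spindle a b κ).mem_nhds h0))

lemma coord_pt_add (a : D.Param) (w : ℂ) :
    D.coord a.1 ((D.pt a).1 + w * D.dir a.1) = a.2 + w := by
  rw [pt_eq_seg, coord_seg_add]

/-- There are points in the sectors. -/
lemma IsCrossing.exists_mem_sector {a b : D.Param} (h : D.IsCrossing a b) {κ e δ : ℝ}
    (hκ : 0 < κ) (he : e * e = 1) (hδ : 0 < δ) : ∃ p ∈ spindle a b κ, 0 < (D.coord a.1 p.1).im ∧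
      (D.coord a.1 p.1).im < δ * (e * ((D.coord a.1 p.1).re - a.2)) := by
  obtain ⟨x, h1, h2⟩ := ((h.eventually_mem_spindle hκ ((e + (δ / 2 : ℝ) * Complex.I) *
    D.dir a.1)).and self_mem_nhdsWithin).exists
  have h2 : 0 < x := h2
  refine ⟨_, h1, ?_⟩
  simp only
  rw [← mul_assoc, coord_pt_add]
  have h3 : e * (x * e) = x := by linear_combination x * he
  simp
  rw [h3]
  constructor
  · positivity
  · nlinarith [mul_pos h2 hδ]

lemma convex_spindle_side (o u : D.Param) (κ ρ : ℝ) :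
    Convex ℝ (spindle o u κ ∩ {p | 0 < ρ * (D.coord o.1 p.1).im}) :=
  (convex_spindle o u κ).inter ((convex_side o.1 ρ).linear_preimage (LinearMap.fst ℝ ℂ ℝ))

lemma IsArcNhd.side_subset {o u : D.Param} {κ : ℝ} (hκ : IsArcNhd o u κ) (ρ : ℝ) :
    spindle o u κ ∩ {p | 0 < ρ * (D.coord o.1 p.1).im} ⊆ D.visible := by
  rintro p ⟨hp, hp'⟩
  refine hκ.mem_visible p hp fun h => ?_
  rw [Set.mem_ofPred_eq, h, mul_zero] at hp'
  exact lt_irrefl _ hp'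

/-- A lift which agrees with `σ` at a point on one side agrees with `σ` on that side. -/
lemma IsArcNhd.isSideLift {o u : D.Param} {κ ρ : ℝ} (hκ : IsArcNhd o u κ)
    (hΓ : IsFiniteVolumeManifoldGroup Γ) (hσ : IsLiftOn f id D.visible σ) {S : ℂ × ℝ → H3}
    (hS : IsLiftOn f id (spindle o u κ) S) {p : ℂ × ℝ} (hp : p ∈ spindle o u κ)
    (hp' : 0 < ρ * (D.coord o.1 p.1).im) (h : S p = σ p) : IsSideLift f σ o u κ ρ S := by
  refine ⟨hκ.pos, hS, fun q hq hq' => ?_⟩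
  have := (hS.mono inter_subset_left).eq_smul_visibleLift hΓ hσ
    (convex_spindle_side o u κ ρ).isPreconnected (hκ.side_subset ρ) (one_mem Γ) (p := p) (q := q)
    ⟨hp, hp'⟩ (by rw [one_smul, h]) ⟨hq, hq'⟩
  rwa [one_smul] at this

lemma IsArcNhd.exists_smul {o u : D.Param} {κ ρ : ℝ} (hκ : IsArcNhd o u κ)
    (h : D.IsCrossing o u) (hρ : ρ * ρ = 1)
    (hΓ : IsFiniteVolumeManifoldGroup Γ) (hσ : IsLiftOn f id D.visible σ) {S : ℂ × ℝ → H3}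
    (hS : IsLiftOn f id (spindle o u κ) S) : ∃ g ∈ Γ, ∀ p ∈ spindle o u κ,
      0 < ρ * (D.coord o.1 p.1).im → S p = g • σ p := by
  obtain ⟨x, h1, h2⟩ := ((h.eventually_mem_spindle hκ.pos ((ρ * Complex.I) * D.dir o.1)).and
    self_mem_nhdsWithin).exists
  have h2 : 0 < x := h2
  obtain ⟨g, hg, h3⟩ := (hS.mono inter_subset_left).exists_eq_smul_visibleLift hΓ hσ
    (convex_spindle_side o u κ ρ).isPreconnected ⟨_, h1, by
      rw [Set.mem_ofPred_eq, ← mul_assoc, coord_pt_add]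
      simp
      nlinarith⟩ (hκ.side_subset ρ)
  exact ⟨g, hg, fun p hp hp' => h3 p ⟨hp, hp'⟩⟩

lemma IsArcNhd.exists_isSideLift {o u : D.Param} {κ ρ : ℝ} (hκ : IsArcNhd o u κ)
    (h : D.IsCrossing o u) (hρ : ρ * ρ = 1)
    (hΓ : IsFiniteVolumeManifoldGroup Γ) (hσ : IsLiftOn f id D.visible σ) :
    ∃ S, IsSideLift f σ o u κ ρ S := by
  obtain ⟨x, h1, h2⟩ := ((h.eventually_mem_spindle hκ.pos ((ρ * Complex.I) * D.dir o.1)).and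
    self_mem_nhdsWithin).exists
  have h2 : 0 < x := h2
  have h3 : 0 < ρ * (D.coord o.1 ((D.pt o).1 + x * (ρ * Complex.I * D.dir o.1))).im := by
    rw [← mul_assoc, coord_pt_add]
    simp
    nlinarith
  obtain ⟨S, hS, hS0⟩ := IsLiftOn.exists_of_convex (f := f) (φ := id) hΓ (isOpen_spindle o u κ)
    (convex_spindle o u κ) continuousOn_id hκ.not_mem_link h1
    (hσ.2 _ (hκ.mem_visible _ h1 (right_ne_zero_of_mul h3.ne')))
  exact ⟨S, hκ.isSideLift hΓ hσ hS h1 h3 hS0⟩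

/-- The sector on the left of the overpass lies on the left of the overpass. -/
lemma IsSideLift.isSectorLift_over {o u : D.Param} {κ : ℝ} {S : ℂ × ℝ → H3}
    (hS : IsSideLift f σ o u κ 1 S) (e : ℝ) : IsSectorLift f σ o u κ e S :=
  ⟨hS.1, hS.2.1, 1, one_pos, fun p hp h1 _ => hS.2.2 p hp (by rwa [one_mul])⟩

lemma IsSectorLift.isSideLift_over {o u : D.Param} {κ e : ℝ} {S : ℂ × ℝ → H3}
    (hS : IsSectorLift f σ o u κ e S) (he : e * e = 1) (hκ : IsArcNhd o u κ)
    (h : D.IsCrossing o u)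
    (hΓ : IsFiniteVolumeManifoldGroup Γ) (hσ : IsLiftOn f id D.visible σ) :
    IsSideLift f σ o u κ 1 S := by
  obtain ⟨-, h1, δ, hδ, h2⟩ := hS
  obtain ⟨p, hp, h3, h4⟩ := h.exists_mem_sector hκ.pos he hδ
  exact hκ.isSideLift hΓ hσ h1 hp (by rwa [one_mul]) (h2 p hp h3 h4)

lemma IsCrossing.coord_eq {a b : D.Param} (h : D.IsCrossing a b) (z : ℂ) :
    D.coord a.1 z = a.2 + (D.coord b.1 z - b.2) * (D.dir b.1 / D.dir a.1) := by
  have h1 := coord_pt_add a ((D.coord b.1 z - b.2) * (D.dir b.1 / D.dir a.1))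
  rw [← h1, h.2.2.2, mul_assoc, div_mul_cancel₀ _ (dir_ne_zero a.1)]
  congr 1
  apply coord_injective b.1
  rw [coord_pt_add]
  ring

/-- On which side of the overpass the sectors at the underpass lie. -/
lemma IsCrossing.side_of_sector {o u : D.Param} (h : D.IsCrossing o u) {ρ e δ : ℝ} (hρ : ρ * ρ = 1)
    (he : e * e = 1) (hρe : 0 < ρ * (e * (D.dir u.1 / D.dir o.1).im))
    (hδ : δ * |(D.dir u.1 / D.dir o.1).re| ≤ |(D.dir u.1 / D.dir o.1).im|) {z : ℂ}
    (h1 : 0 < (D.coord u.1 z).im)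
    (h2 : (D.coord u.1 z).im < δ * (e * ((D.coord u.1 z).re - u.2))) (h0 : 0 < δ) :
    0 < ρ * (D.coord o.1 z).im := by
  rw [h.coord_eq z]
  set ν := D.dir u.1 / D.dir o.1
  set y := (D.coord u.1 z).im
  set x := e * ((D.coord u.1 z).re - u.2) with hx
  have hx0 : 0 < x := by
    by_contra! hx0
    nlinarith
  have e1 : (D.coord u.1 z).re - u.2 = e * x := by
    rw [hx]; linear_combination (-((D.coord u.1 z).re - u.2)) * he
  have e2 : ρ * e * ν.im = |ν.im| := by
    rcases mul_self_eq_one_iff.1 hρ with rfl | rfl <;> rcases mul_self_eq_one_iff.1 he with rfl | rfl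
    all_goals
      simp only [one_mul, neg_mul, mul_neg, neg_neg] at hρe ⊢
      first
        | rw [abs_of_pos hρe]
        | rw [abs_of_neg (by linarith)]
  have e3 : |ρ| = 1 := by
    rcases mul_self_eq_one_iff.1 hρ with rfl | rfl <;> simp
  simp only [Complex.add_im, Complex.ofReal_im, zero_add, Complex.mul_im, Complex.sub_re,
    Complex.ofReal_re, Complex.sub_im, sub_zero]
  rw [e1]
  -- The sign is decided by the first summand: y < δx and δ |Re ν| ≤ |Im ν| make x |Im ν| outweigh
  -- the second one.
  have e4 : ρ * (e * x * ν.im + y * ν.re) = x * (ρ * e * ν.im) + y * (ρ * ν.re) := by ring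
  rw [e4, e2]
  have h4 : -|ν.re| ≤ ρ * ν.re := by
    have := neg_abs_le (ρ * ν.re)
    rwa [abs_mul, e3, one_mul] at this
  have h5 : x * (δ * |ν.re|) ≤ x * |ν.im| := mul_le_mul_of_nonneg_left hδ hx0.le
  have h6 : y * (-|ν.re|) ≤ y * (ρ * ν.re) := mul_le_mul_of_nonneg_left h4 h1.le
  rcases (abs_nonneg ν.re).eq_or_lt with h7 | h7
  · rw [← h7] at h6
    have : 0 < |ν.im| := by
      rw [← e2]; linarith
    have := mul_pos hx0 this
    linarith
  · have := mul_lt_mul_of_pos_right h2 h7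
    linarith

lemma IsCrossing.exists_sector_ratio {o u : D.Param} (h : D.IsCrossing o u) : ∃ δ > 0,
    δ * |(D.dir u.1 / D.dir o.1).re| ≤ |(D.dir u.1 / D.dir o.1).im| := by
  have h1 : 0 < |(D.dir u.1 / D.dir o.1).im| := abs_pos.2 h.im_ne_zero
  refine ⟨|(D.dir u.1 / D.dir o.1).im| / (|(D.dir u.1 / D.dir o.1).re| + 1), by positivity, ?_⟩
  rw [div_mul_eq_mul_div, div_le_iff₀ (by positivity)]
  gcongr
  linarith

lemma IsSideLift.isSectorLift_under {o u : D.Param} {κ ρ e : ℝ} {S : ℂ × ℝ → H3}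
    (hS : IsSideLift f σ o u κ ρ S) (h : D.IsCrossing o u) (hρ : ρ * ρ = 1) (he : e * e = 1)
    (hρe : 0 < ρ * (e * (D.dir u.1 / D.dir o.1).im)) : IsSectorLift f σ u o κ e S := by
  obtain ⟨δ, hδ, h1⟩ := h.exists_sector_ratio
  refine ⟨hS.1, spindle_comm h κ ▸ hS.2.1, δ, hδ, fun p hp h2 h3 => hS.2.2 p ?_
    (h.side_of_sector hρ he hρe h1 h2 h3 hδ)⟩
  rwa [spindle_comm h]

lemma IsSectorLift.isSideLift_under {o u : D.Param} {κ ρ e : ℝ} {S : ℂ × ℝ → H3}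
    (hS : IsSectorLift f σ u o κ e S) (h : D.IsCrossing o u) (hρ : ρ * ρ = 1) (he : e * e = 1)
    (hρe : 0 < ρ * (e * (D.dir u.1 / D.dir o.1).im)) (hκ : IsArcNhd o u κ)
    (hΓ : IsFiniteVolumeManifoldGroup Γ) (hσ : IsLiftOn f id D.visible σ) :
    IsSideLift f σ o u κ ρ S := by
  obtain ⟨-, h1, δ, hδ, h2⟩ := hS
  obtain ⟨δ', hδ', h3⟩ := h.exists_sector_ratio
  obtain ⟨p, hp, h4, h5⟩ := h.symm.exists_mem_sector hκ.pos he (lt_min hδ hδ')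
  rw [← spindle_comm h] at h1
  have hx : 0 ≤ e * ((D.coord u.1 p.1).re - u.2) := by
    by_contra! hx
    nlinarith [lt_min hδ hδ']
  refine hκ.isSideLift hΓ hσ h1 (by rwa [spindle_comm h])
    (h.side_of_sector hρ he hρe h3 h4 (h5.trans_le ?_) hδ') (h2 p hp h4 (h5.trans_le ?_))
  · exact mul_le_mul_of_nonneg_right (min_le_right _ _) hx
  · exact mul_le_mul_of_nonneg_right (min_le_left _ _) hx

end LinkDiagram

end CuspedHyp

namespace CuspedHyp

namespace LinkDiagram

variable {D : LinkDiagram} {Γ : Subgroup PSL2} {f : Manifold Γ ≃ₜ D.Complement}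
  {σ : ℂ × ℝ → H3} {m : MeridianSystem Γ}

/-! ## The wall at a crossing is the meridian -/

lemma eventually_regular {a : D.Param} (ha : a.2 ∈ Ioo (0 : ℝ) 1) {e : ℝ} (he : e ≠ 0) :
    ∀ᶠ x in 𝓝[>] (0 : ℝ), a.2 + e * x ∈ Ioo (0 : ℝ) 1 ∧ ¬ D.IsDouble (a.1, a.2 + e * x) := by
  have hc : Continuous fun x : ℝ => a.2 + e * x := by fun_prop
  refine Eventually.and (nhdsWithin_le_nhds (hc.tendsto 0 (isOpen_Ioo.mem_nhds (by simpa using ha))))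
    ?_
  have hinj : Function.Injective fun x : ℝ => ((a.1, a.2 + e * x) : D.Param) := by
    intro x y hxy
    have := congrArg Prod.snd hxy
    simpa [he] using this
  have hfin : {x : ℝ | D.IsDouble (a.1, a.2 + e * x)}.Finite :=
    Finite.preimage (f := fun x : ℝ => ((a.1, a.2 + e * x) : D.Param)) hinj.injOn
      (finite_isDouble D)
  have h1 := (hfin.subset (sdiff_subset (t := {0}))).isClosed.isOpen_compl.mem_nhds
    (show (0 : ℝ) ∈ _ by simp)
  filter_upwards [nhdsWithin_le_nhds h1, self_mem_nhdsWithin] with x hx hx0 hd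
  exact hx ⟨hd, (ne_of_gt hx0 : x ≠ 0)⟩

lemma coord_tubeMap_im (a : D.Param) (s r θ : ℝ) :
    (D.coord a.1 (tubeMap a (s, r, θ)).1).im = r * Real.cos θ := by
  rw [coord_tubeMap, Complex.add_im, Complex.ofReal_im, zero_add, Complex.im_ofReal_mul,
    Complex.I_im, mul_one]

lemma coord_tubeMap_re (a : D.Param) (s r θ : ℝ) :
    (D.coord a.1 (tubeMap a (s, r, θ)).1).re = a.2 + s := by
  rw [coord_tubeMap, Complex.add_re, Complex.ofReal_re, Complex.re_ofReal_mul,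
    Complex.I_re, mul_zero, add_zero]

/-- Points of a tube around a strand of a crossing which are visible. -/
def visibleTube (a b : D.Param) (ε e : ℝ) : Set (ℝ × ℝ × ℝ) :=
  {q | q ∈ tube ε ∧ q.2.2 ∈ Ioo (-(Real.pi / 2)) (3 * (Real.pi / 2)) ∧
    q.2.1 * |Real.cos q.2.2| * |(D.dir b.1 / D.dir a.1).re| <
      |(D.dir b.1 / D.dir a.1).im| * (e * q.1)}

/-- The angles omit exactly the direction straight down, so over the strand `a` itself only θ = π/2
is left, where the point lies above the strand. The inequality keeps the projection off the strand
`b`. -/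
lemma IsCrossing.tubeMap_mem_visible {a b : D.Param} (h : D.IsCrossing a b) {ε e : ℝ}
    (he : e * e = 1)
    (hε : ∀ q ∈ tube ε, ∀ k, ∀ τ ∈ Icc (0 : ℝ) 1, (D.seg k τ).1 = (tubeMap a q).1 →
      k = a.1 ∨ k = b.1)
    {q : ℝ × ℝ × ℝ} (hq : q ∈ visibleTube a b ε e) : tubeMap a q ∈ D.visible := by
  obtain ⟨s, r, θ⟩ := q
  obtain ⟨hq, ⟨hθ1, hθ2⟩, hlt⟩ := hq
  simp only at hθ1 hθ2 hlt
  have hr : r ∈ Ioo 0 ε := hq.2.1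
  intro k τ hτ e1
  rcases hε _ hq k τ hτ e1 with rfl | rfl
  · have h3 := coord_tubeMap a s r θ
    rw [← e1, coord_seg] at h3
    have him := congrArg Complex.im h3
    have hre := congrArg Complex.re h3
    simp at him hre
    have hcos : Real.cos θ = 0 := him.resolve_left hr.1.ne'
    have hθ : θ = Real.pi / 2 := by
      rcases lt_trichotomy θ (Real.pi / 2) with h4 | h4 | h4
      · exact absurd hcos (Real.cos_pos_of_mem_Ioo ⟨hθ1, h4⟩).ne'
      · exact h4
      · exact absurd hcos (Real.cos_neg_of_pi_div_two_lt_of_lt h4 (by linarith)).ne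
    rw [tubeMap_eq, hre, hθ, Real.sin_pi_div_two]
    simp only
    linarith [hr.1]
  · exfalso
    have h3 := coord_tubeMap a s r θ
    rw [← e1, h.coord_eq, coord_seg, ← Complex.ofReal_sub] at h3
    set ν := D.dir b.1 / D.dir a.1
    have him := congrArg Complex.im h3
    have hre := congrArg Complex.re h3
    simp only [Complex.add_im, Complex.add_re, Complex.ofReal_im, Complex.ofReal_re, zero_add,
      Complex.im_ofReal_mul, Complex.re_ofReal_mul, Complex.I_im, Complex.I_re, mul_one, mul_zero,
      add_zero] at him hre
    have hs : (τ - b.2) * ν.re = s := by linarith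
    have e2 : r * |Real.cos θ| * |ν.re| = |ν.im| * |s| := by
      have e4 : r * |Real.cos θ| = |τ - b.2| * |ν.im| := by
        rw [← abs_mul, him, abs_mul, abs_of_pos hr.1]
      rw [e4, ← hs, abs_mul]
      ring
    have e3 : e * s ≤ |s| := by
      rcases mul_self_eq_one_iff.1 he with rfl | rfl
      · rw [one_mul]; exact le_abs_self s
      · rw [neg_one_mul]; exact neg_le_abs s
    rw [e2] at hlt
    have := mul_le_mul_of_nonneg_left e3 (abs_nonneg ν.im)
    linarith

/-- The lift of the tube agrees with `σ` on the visible part, close to the strand. -/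
lemma IsSectorLift.tubeLift_eq (hΓ : IsFiniteVolumeManifoldGroup Γ)
    (hσ : IsLiftOn f id D.visible σ) {a b : D.Param} (h : D.IsCrossing a b) {κ e : ℝ}
    {S : ℂ × ℝ → H3} (hS : IsSectorLift f σ a b κ e S) (he : e * e = 1) {ε : ℝ} (hε : 0 < ε)
    (hεl : ε < |(D.pt b).2 - (D.pt a).2|)
    (hvis : ∀ q ∈ visibleTube a b ε e, tubeMap a q ∈ D.visible)
    {Ψ : ℝ × ℝ × ℝ → H3} (hΨ : IsLiftOn f (tubeMap a) (tube ε) Ψ)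
    (hray : ∀ r ∈ Ioo 0 ε, Ψ (0, r, arcSign a b * (Real.pi / 2)) =
        arc S a b (r / |(D.pt b).2 - (D.pt a).2|)) :
    ∃ κ' > 0, ∀ x ∈ Ioo 0 ε, ∀ r ∈ Ioo 0 (min ε (κ' * x)),
      ∀ θ ∈ Ioo (-(Real.pi / 2)) (3 * (Real.pi / 2)),
        Ψ (e * x, r, θ) = σ (tubeMap a (e * x, r, θ)) := by
  obtain ⟨hκ, hSl, δ, hδ, hSσ⟩ := hS
  set ν := D.dir b.1 / D.dir a.1 with hν
  have hνim : 0 < |ν.im| := abs_pos.2 h.im_ne_zero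
  set κ' := |ν.im| / (|ν.re| + 1) with hκ'
  have hκ'0 : 0 < κ' := by positivity
  have hκν : κ' * (|ν.re| + 1) = |ν.im| := div_mul_cancel₀ _ (by positivity)
  have hl0 : 0 < |(D.pt b).2 - (D.pt a).2| := hε.trans hεl
  -- Uniqueness of lifts: on a connected set of visible tube points it is enough to compare the two
  -- lifts at one point. The proof moves through three such comparisons, from the crossing arc to
  -- the strand.
  have hchain : ∀ C : Set (ℝ × ℝ × ℝ), IsPreconnected C → C ⊆ visibleTube a b ε e →
      ∀ q ∈ C, Ψ q = σ (tubeMap a q) → ∀ q' ∈ C, Ψ q' = σ (tubeMap a q') := by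
    intro C hC hCv q hq e1 q' hq'
    have h1 := hΨ.mono fun q hq => (hCv hq).1
    have h2 : IsLiftOn f (tubeMap a) C (σ ∘ tubeMap a) :=
      hσ.comp (continuous_tubeMap a).continuousOn fun q hq => hvis q (hCv hq)
    exact h2.eqOn hΓ hC h1 hq e1 hq'
  have hmem : ∀ x ∈ Ioo 0 ε, ∀ r ∈ Ioo 0 ε, ∀ θ ∈ Ioo (-(Real.pi / 2)) (3 * (Real.pi / 2)),
      r * |Real.cos θ| < κ' * x → (e * x, r, θ) ∈ visibleTube a b ε e := by
    intro x hx r hr θ hθ hlt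
    refine ⟨⟨?_, hr, trivial⟩, hθ, ?_⟩
    · rcases mul_self_eq_one_iff.1 he with rfl | rfl
      · constructor <;> simp only <;> linarith [hx.1, hx.2]
      · constructor <;> simp only <;> linarith [hx.1, hx.2]
    · simp only
      rw [← mul_assoc e, he, one_mul, ← hκν]
      have h1 := mul_le_mul_of_nonneg_right hlt.le (abs_nonneg ν.re)
      have h2 := mul_pos hκ'0 hx.1
      calc _ ≤ κ' * x * |ν.re| := h1
        _ < _ := by linarith
  set r₂ := ε / 2 with hr₂
  set θ₀ := arcSign a b * (Real.pi / 2) with hθ₀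
  have hr₂m : r₂ ∈ Ioo 0 ε := ⟨by linarith, by linarith⟩
  have hq₀ : ((0 : ℝ), r₂, θ₀) ∈ tube ε ∩ tubeMap a ⁻¹' spindle a b κ := by
    refine ⟨⟨⟨by linarith, hε⟩, hr₂m, trivial⟩, ?_⟩
    rw [mem_preimage, tubeMap_arc h]
    exact h.lineMap_mem_spindle hκ ⟨div_pos hr₂m.1 hl0, (div_lt_one hl0).2 (hr₂m.2.trans hεl)⟩
  obtain ⟨ρ, hρ, hball⟩ := Metric.isOpen_iff.1
    ((isOpen_tube ε).inter ((isOpen_spindle a b κ).preimage (continuous_tubeMap a))) _ hq₀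
  -- On the arc both lifts are the same, so they agree near one of its points.
  have hΨS : ∀ q ∈ Metric.ball ((0 : ℝ), r₂, θ₀) ρ, Ψ q = S (tubeMap a q) := by
    intro q hq
    have h1 := hΨ.mono fun q hq => (hball hq).1
    have h2 : IsLiftOn f (tubeMap a) (Metric.ball ((0 : ℝ), r₂, θ₀) ρ) (S ∘ tubeMap a) :=
      hSl.comp (continuous_tubeMap a).continuousOn fun q hq => (hball hq).2
    refine h2.eqOn hΓ (convex_ball _ _).isPreconnected h1 (Metric.mem_ball_self hρ) ?_ hq
    rw [hray _ hr₂m, Function.comp_apply, tubeMap_arc h]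
    rfl
  set υ := min ρ ε / 2 with hυ
  have hυ0 : 0 < υ := by have := lt_min hρ hε; linarith
  have hυρ : υ < ρ := by have := min_le_left ρ ε; linarith
  have hυε : υ < ε := by have := min_le_right ρ ε; linarith
  set ξ := min (min (ρ / 2) (Real.pi / 4)) (min δ κ' * υ / (2 * r₂)) with hξ
  have hξ0 : 0 < ξ := lt_min (lt_min (by linarith) (by positivity))
    (div_pos (mul_pos (lt_min hδ hκ'0) hυ0) (by linarith [hr₂m.1]))
  have hξρ : ξ < ρ := by
    have : ξ ≤ ρ / 2 := (min_le_left _ _).trans (min_le_left _ _)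
    linarith
  have hξπ : ξ ≤ Real.pi / 4 := (min_le_left _ _).trans (min_le_right _ _)
  have hξr : r₂ * ξ < min δ κ' * υ := by
    have h1 : ξ ≤ min δ κ' * υ / (2 * r₂) := min_le_right _ _
    rw [le_div_iff₀ (by linarith [hr₂m.1])] at h1
    have := mul_pos hξ0 hr₂m.1
    linarith
  -- Turning from the arc by the small angle ξ towards the left of the strand, and moving by υ along
  -- it, leads into the sector on which S is known to be σ. The bound on ξ keeps the point inside
  -- this sector and off the strand `b`.
  set θ₁ := θ₀ - arcSign a b * ξ with hθ₁
  have hpi := Real.pi_pos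
  have hcos : Real.cos θ₁ = Real.sin ξ := by
    rw [hθ₁, hθ₀]
    rcases arcSign_eq a b with h1 | h1
    · rw [h1, one_mul, one_mul, Real.cos_pi_div_two_sub]
    · rw [h1, neg_one_mul, neg_one_mul, sub_neg_eq_add, neg_add_eq_sub, ← Real.cos_neg, neg_sub,
        Real.cos_pi_div_two_sub]
  have hsin : 0 < Real.sin ξ := Real.sin_pos_of_pos_of_lt_pi hξ0 (by linarith)
  have hsin' : r₂ * Real.sin ξ < min δ κ' * υ :=
    (mul_le_mul_of_nonneg_left (Real.sin_le hξ0.le) hr₂m.1.le).trans_lt hξr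
  have hθ₁m : θ₁ ∈ Ioo (-(Real.pi / 2)) (3 * (Real.pi / 2)) := by
    rw [hθ₁, hθ₀]
    rcases arcSign_eq a b with h1 | h1 <;> rw [h1] <;> constructor <;> linarith
  have hee : |e| = 1 := by
    rcases mul_self_eq_one_iff.1 he with rfl | rfl <;> simp
  have hq₁ : (e * υ, r₂, θ₁) ∈ Metric.ball ((0 : ℝ), r₂, θ₀) ρ := by
    rw [Metric.mem_ball, Prod.dist_eq, Prod.dist_eq, dist_self, Real.dist_eq, Real.dist_eq]
    simp only
    rw [sub_zero, abs_mul, hee, one_mul, abs_of_pos hυ0, hθ₁, sub_sub_cancel_left, abs_neg, abs_mul]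
    have : |arcSign a b| = 1 := by rcases arcSign_eq a b with h1 | h1 <;> simp [h1]
    rw [this, one_mul, abs_of_pos hξ0]
    exact max_lt hυρ (max_lt hρ hξρ)
  have hΨ₁ : Ψ (e * υ, r₂, θ₁) = σ (tubeMap a (e * υ, r₂, θ₁)) := by
    rw [hΨS _ hq₁]
    refine hSσ _ (hball hq₁).2 ?_ ?_
    · rw [coord_tubeMap_im, hcos]
      exact mul_pos hr₂m.1 hsin
    · rw [coord_tubeMap_im, coord_tubeMap_re, hcos, add_sub_cancel_left, ← mul_assoc e, he,
        one_mul]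
      exact hsin'.trans_le (mul_le_mul_of_nonneg_right (min_le_left _ _) hυ0.le)
  -- With the angle fixed, the radius is decreased below κ'υ. From there all angles are admissible,
  -- because then even the full radius, as horizontal offset, does not reach the strand `b`.
  set r₃ := min r₂ (κ' * υ / 2) with hr₃
  have hr₃0 : 0 < r₃ := lt_min hr₂m.1 (by positivity)
  have hΨ₃ : Ψ (e * υ, r₃, θ₁) = σ (tubeMap a (e * υ, r₃, θ₁)) := by
    have hpre : IsPreconnected ((fun r : ℝ => (e * υ, r, θ₁)) '' Ioc 0 r₂) :=
      isPreconnected_Ioc.image _ (by fun_prop)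
    refine hchain _ hpre ?_ _ (mem_image_of_mem _ ⟨hr₂m.1, le_rfl⟩) hΨ₁ _
      (mem_image_of_mem _ ⟨hr₃0, min_le_left _ _⟩)
    rintro _ ⟨r, hr, rfl⟩
    refine hmem υ ⟨hυ0, hυε⟩ r ⟨hr.1, hr.2.trans_lt hr₂m.2⟩ θ₁ hθ₁m ?_
    rw [hcos, abs_of_pos hsin]
    calc r * Real.sin ξ ≤ r₂ * Real.sin ξ := mul_le_mul_of_nonneg_right hr.2 hsin.le
      _ < min δ κ' * υ := hsin'
      _ ≤ κ' * υ := mul_le_mul_of_nonneg_right (min_le_right _ _) hυ0.le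
  have hparam : ∀ x ∈ Ioo 0 ε, ∀ r ∈ Ioo 0 (min ε (κ' * x)),
      ∀ θ ∈ Ioo (-(Real.pi / 2)) (3 * (Real.pi / 2)), (e * x, r, θ) ∈
        (fun y : ℝ × ℝ × ℝ => (e * y.1, y.2.1 * min ε (κ' * y.1), y.2.2)) ''
          (Ioo 0 ε ×ˢ Ioo 0 1 ×ˢ Ioo (-(Real.pi / 2)) (3 * (Real.pi / 2))) := by
    intro x hx r hr θ hθ
    have h1 : 0 < min ε (κ' * x) := hr.1.trans hr.2
    refine ⟨(x, r / min ε (κ' * x), θ), ⟨hx, ⟨div_pos hr.1 h1, (div_lt_one h1).2 hr.2⟩, hθ⟩, ?_⟩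
    simp only
    rw [div_mul_cancel₀ _ h1.ne']
  refine ⟨κ', hκ'0, fun x hx r hr θ hθ => ?_⟩
  -- The target set is the image of a box, with the radius measured as a fraction of its bound at
  -- the given distance x from the crossing; hence it is connected.
  have hpre : IsPreconnected
      ((fun y : ℝ × ℝ × ℝ => (e * y.1, y.2.1 * min ε (κ' * y.1), y.2.2)) ''
          (Ioo 0 ε ×ˢ Ioo 0 1 ×ˢ Ioo (-(Real.pi / 2)) (3 * (Real.pi / 2)))) :=
    (isPreconnected_Ioo.prod (isPreconnected_Ioo.prod isPreconnected_Ioo)).image _ (by fun_prop)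
  refine hchain _ hpre ?_ _ (hparam υ ⟨hυ0, hυε⟩ r₃ ⟨hr₃0, ?_⟩ θ₁ hθ₁m) hΨ₃ _
    (hparam x hx r hr θ hθ)
  · rintro _ ⟨⟨x, y, θ⟩, ⟨hx, hy, hθ⟩, rfl⟩
    have hx : x ∈ Ioo 0 ε := hx
    have hy : y ∈ Ioo (0 : ℝ) 1 := hy
    have h1 : 0 < min ε (κ' * x) := lt_min hε (mul_pos hκ'0 hx.1)
    have h2 : y * min ε (κ' * x) < min ε (κ' * x) := by
      have := mul_lt_mul_of_pos_right hy.2 h1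
      linarith
    have h3 := mul_pos hy.1 h1
    refine hmem x hx _ ⟨h3, h2.trans_le (min_le_left _ _)⟩ θ hθ ?_
    calc _ ≤ y * min ε (κ' * x) * 1 :=
          mul_le_mul_of_nonneg_left (Real.abs_cos_le_one θ) h3.le
      _ < κ' * x := by rw [mul_one]; exact h2.trans_le (min_le_right _ _)
  · refine lt_min ((min_le_left _ _).trans_lt hr₂m.2) ((min_le_right _ _).trans_lt ?_)
    have := mul_pos hκ'0 hυ0
    linarith

/-- The wall below a strand next to a crossing is the meridian of the cusp to which the crossing arc
runs. -/
lemma IsSectorLift.wall_eq (hΓ : IsFiniteVolumeManifoldGroup Γ) (hσ : IsLiftOn f id D.visible σ)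
    (hm : IsStandardMeridian f m) {a b : D.Param} (h : D.IsCrossing a b) {κ e : ℝ}
    {S : ℂ × ℝ → H3} (hS : IsSectorLift f σ a b κ e S) (he : e * e = 1) {P : OnePoint ℂ}
    (hP : IsCusp Γ P) (hSP : TendsToIdeal (𝓝[>] 0) (arc S a b) P) :
    ∀ᶠ x in 𝓝[>] (0 : ℝ), ∀ g R, IsWall f σ a.1 (a.2 + e * x) g R → g = (m.meridian P)⁻¹ := by
  obtain ⟨ε, hε, hεl, hL, hstrand⟩ := h.exists_tube
  obtain ⟨Ψ, hΨ, hray, hper⟩ := exists_tubeLift hΓ hm (h.isCrossingLift_arc hS.1 hS.2.1) hP hSP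
    hε hεl hL
  obtain ⟨κ', hκ', hΨσ⟩ := hS.tubeLift_eq hΓ hσ h he hε hεl
    (fun q hq => h.tubeMap_mem_visible he hstrand hq) hΨ hray
  have he0 : e ≠ 0 := by rintro rfl; simp at he
  filter_upwards [eventually_regular h.mem_Ioo he0, Ioo_mem_nhdsGT hε] with x ⟨hx1, hx2⟩ hx g R hg
  -- The wall chart is required to reach within r of the strand, so that it contains the point of
  -- the tube straight below the strand.
  set r := min ε (κ' * x) / 2 with hr
  have hmin : 0 < min ε (κ' * x) := lt_min hε (mul_pos hκ' hx.1)
  have hrm : r ∈ Ioo 0 (min ε (κ' * x)) := ⟨by linarith, by linarith⟩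
  obtain ⟨g', R', ε', y, S', w, hy⟩ := exists_isWallChart hΓ hσ (i := a.1) hx1 hx2 hrm.1
  obtain ⟨rfl, -⟩ := hg.unique hΓ ⟨_, _, _, w⟩
  have hcθ : Continuous fun θ : ℝ => tubeMap a (e * x, r, θ) :=
    (continuous_tubeMap a).comp (by fun_prop)
  have hmem0 : tubeMap a (e * x, r, -(Real.pi / 2)) ∈
      Metric.ball (D.seg a.1 (a.2 + e * x)).1 ε' ×ˢ Iio y := by
    rw [tubeMap_eq, Real.cos_neg, Real.cos_pi_div_two, Real.sin_neg, Real.sin_pi_div_two]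
    refine ⟨?_, ?_⟩
    · simpa using w.pos
    · simp only [mem_Iio]; linarith
  obtain ⟨ξ', hξ', hball⟩ := Metric.isOpen_iff.1
    ((Metric.isOpen_ball.prod isOpen_Iio).preimage hcθ) _ hmem0
  have hpi := Real.pi_pos
  set ξ := min ξ' Real.pi / 2 with hξ
  have hξm : 0 < min ξ' Real.pi := lt_min hξ' hpi
  have hξ0 : 0 < ξ := by linarith
  have hξξ : ξ < ξ' := by have := min_le_left ξ' Real.pi; linarith
  have hξπ : ξ ≤ Real.pi / 2 := by have := min_le_right ξ' Real.pi; linarith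
  have hsin : 0 < Real.sin ξ := Real.sin_pos_of_pos_of_lt_pi hξ0 (by linarith)
  have hmemp : -(Real.pi / 2) + ξ ∈ Metric.ball (-(Real.pi / 2)) ξ' := by
    rw [mem_ball_iff_norm, add_sub_cancel_left, Real.norm_eq_abs, abs_of_pos hξ0]; exact hξξ
  have hmemm : -(Real.pi / 2) - ξ ∈ Metric.ball (-(Real.pi / 2)) ξ' := by
    rw [mem_ball_iff_norm, sub_sub_cancel_left, Real.norm_eq_abs, abs_neg, abs_of_pos hξ0]
    exact hξξ
  have hex : e * x ∈ Ioo (-ε) ε := by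
    rcases mul_self_eq_one_iff.1 he with rfl | rfl <;> constructor <;> linarith [hx.1, hx.2]
  have htube : ∀ θ, (e * x, r, θ) ∈ tube ε :=
    fun θ => ⟨hex, ⟨hrm.1, hrm.2.trans_le (min_le_left _ _)⟩, trivial⟩
  have l1 : IsLiftOn f (fun θ => tubeMap a (e * x, r, θ)) (Metric.ball (-(Real.pi / 2)) ξ')
      (fun θ => Ψ (e * x, r, θ)) :=
    hΨ.comp (ψ := fun θ => (e * x, r, θ)) (by fun_prop) fun θ _ => htube θ
  have l2 : IsLiftOn f (fun θ => tubeMap a (e * x, r, θ)) (Metric.ball (-(Real.pi / 2)) ξ')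
      (fun θ => S' (tubeMap a (e * x, r, θ))) := w.lift.comp hcθ.continuousOn hball
  have hc1 : (D.coord a.1 (tubeMap a (e * x, r, -(Real.pi / 2) + ξ)).1).im = r * Real.sin ξ := by
    rw [coord_tubeMap_im, neg_add_eq_sub, ← Real.cos_neg, neg_sub, Real.cos_pi_div_two_sub]
  have hc2 : (D.coord a.1 (tubeMap a (e * x, r, -(Real.pi / 2) - ξ)).1).im =
      -(r * Real.sin ξ) := by
    rw [coord_tubeMap_im, ← neg_add', Real.cos_neg, add_comm, Real.cos_add_pi_div_two, mul_neg]
  have hpos := mul_pos hrm.1 hsin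
  -- Just left of the lowest point both the tube lift and the wall chart equal σ, so they agree
  -- across the wall, and on its right the tube lift is g • σ.
  have heq := l2.eqOn hΓ (convex_ball _ _).isPreconnected l1 hmemp (by
    rw [hΨσ x hx r hrm _ ⟨by linarith, by linarith⟩,
      w.left _ (hball hmemp).1 (by rw [hc1]; exact hpos) _ (hball hmemp).2]) hmemm
  simp only at heq
  rw [w.right _ (hball hmemm).1 (by rw [hc2]; linarith) _ (hball hmemm).2] at heq
  have h3 := hper _ _ _ (htube (-(Real.pi / 2) - ξ))
  rw [hΨσ x hx r hrm _ ⟨by linarith, by linarith⟩, tubeMap_add_two_pi, heq, ← mul_smul] at h3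
  -- A full turn from the right of the wall leads through the visible points back to σ on the right,
  -- and it multiplies by the meridian. Thus the meridian times g is 1.
  have h4 := smul_injective_of_mem hΓ (one_mem Γ) (mul_mem (m.mem P hP) w.mem)
    (by rw [one_smul]; exact h3)
  exact eq_inv_of_mul_eq_one_right h4.symm

/-- A lift of the neighbourhood of a crossing arc crosses the wall below the overpass. -/
lemma IsSideLift.right_eq (hΓ : IsFiniteVolumeManifoldGroup Γ) (hσ : IsLiftOn f id D.visible σ)
    {o u : D.Param} (h : D.IsCrossing o u) (hou : (D.pt u).2 < (D.pt o).2) {κ : ℝ}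
    (hκ : IsArcNhd o u κ) {S : ℂ × ℝ → H3} (hS : IsSideLift f σ o u κ 1 S) :
    ∀ᶠ x in 𝓝[>] (0 : ℝ), ∀ g R, IsWall f σ o.1 (o.2 + 1 * x) g R →
      ∀ p ∈ spindle o u κ, 0 < -1 * (D.coord o.1 p.1).im → S p = g • σ p := by
  obtain ⟨g₀, hg₀, h₀⟩ := hκ.exists_smul (ρ := -1) h (by norm_num) hΓ hσ hS.2.1
  set mid := ((D.pt o).2 + (D.pt u).2) / 2 with hmid
  -- Close to the crossing the overpass stays above the middle of the crossing arc, so at that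
  -- height a wall chart and the double cone overlap.
  have hhigh : ∀ᶠ x in 𝓝[>] (0 : ℝ), mid < (D.seg o.1 (o.2 + 1 * x)).2 := by
    have hc : Continuous fun x : ℝ => (D.seg o.1 (o.2 + 1 * x)).2 :=
      continuous_snd.comp ((continuous_seg o.1).comp (by fun_prop))
    refine nhdsWithin_le_nhds (hc.tendsto 0 (isOpen_Ioi.mem_nhds ?_))
    simp only [mul_zero, add_zero, mem_Ioi, ← pt_eq_seg]
    linarith
  filter_upwards [eventually_regular h.mem_Ioo one_ne_zero, hhigh,
    h.eventually_mem_spindle hκ.pos (D.dir o.1)] with x ⟨hx1, hx2⟩ hx3 hx4 g R hg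
  obtain ⟨g', R', ε', y, S', w, hy⟩ := exists_isWallChart hΓ hσ (i := o.1) hx1 hx2 (sub_pos.2 hx3)
  obtain ⟨rfl, -⟩ := hg.unique hΓ ⟨_, _, _, w⟩
  have e0 : (D.pt o).1 + x * D.dir o.1 = (D.seg o.1 (o.2 + 1 * x)).1 := by
    rw [pt_eq_seg, seg_fst, seg_fst]; push_cast; ring
  rw [e0] at hx4
  have hx5 : ((D.seg o.1 (o.2 + 1 * x)).1, mid) ∈
      Metric.ball (D.seg o.1 (o.2 + 1 * x)).1 ε' ×ˢ Iio y :=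
    ⟨Metric.mem_ball_self w.pos, by simp only [mem_Iio]; linarith⟩
  obtain ⟨ξ, hξ, hball⟩ := Metric.isOpen_iff.1 ((isOpen_spindle o u κ).inter
    (Metric.isOpen_ball.prod isOpen_Iio)) _ ⟨hx4, hx5⟩
  obtain ⟨zl, hzl, zr, hzr, hl, hr⟩ := exists_left_right o.1 (o.2 + 1 * x) hξ
  have hmem : ∀ z ∈ Metric.ball (D.seg o.1 (o.2 + 1 * x)).1 ξ,
      (z, mid) ∈ Metric.ball ((D.seg o.1 (o.2 + 1 * x)).1, mid) ξ := by
    intro z hz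
    rw [Metric.mem_ball, Prod.dist_eq, dist_self]
    exact max_lt hz hξ
  have heq := (w.lift.mono fun p hp => (hball hp).2).eqOn hΓ (convex_ball _ _).isPreconnected
    (hS.2.1.mono fun p hp => (hball hp).1) (hmem zl hzl) (by
      rw [hS.2.2 _ (hball (hmem zl hzl)).1 (by rw [one_mul]; exact hl),
        w.left _ (hball (hmem zl hzl)).2.1 hl _ (hball (hmem zl hzl)).2.2]) (hmem zr hzr)
  rw [h₀ _ (hball (hmem zr hzr)).1 (by simp only; linarith),
    w.right _ (hball (hmem zr hzr)).2.1 hr _ (hball (hmem zr hzr)).2.2] at heq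
  rw [← smul_injective_of_mem hΓ hg₀ w.mem heq]
  exact h₀

/-- Going around the overpass from left to right is the meridian. -/
lemma IsSideLift.meridian_smul (hΓ : IsFiniteVolumeManifoldGroup Γ)
    (hσ : IsLiftOn f id D.visible σ) (hm : IsStandardMeridian f m)
    {o u : D.Param} (h : D.IsCrossing o u) (hou : (D.pt u).2 < (D.pt o).2) {κ : ℝ}
    (hκ : IsArcNhd o u κ) {S : ℂ × ℝ → H3} (hS : IsSideLift f σ o u κ 1 S) {P : OnePoint ℂ}
    (hP : IsCusp Γ P) (hSP : TendsToIdeal (𝓝[>] 0) (arc S o u) P) :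
    IsSideLift f σ o u κ (-1) fun p => m.meridian P • S p := by
  obtain ⟨x, h1, h2, h3, h4⟩ := ((hS.right_eq hΓ hσ h hou hκ).and
    (((hS.isSectorLift_over 1).wall_eq hΓ hσ hm h (by norm_num) hP hSP).and
      (eventually_regular h.mem_Ioo one_ne_zero))).exists
  obtain ⟨g, R, ε, y, S', w, -⟩ := exists_isWallChart hΓ hσ (i := o.1) h3 h4 one_pos
  have hg := h2 g R ⟨_, _, _, w⟩
  refine ⟨hS.1, hS.2.1.smul (m.mem P hP), fun p hp hp' => ?_⟩
  simp only
  rw [h1 g R ⟨_, _, _, w⟩ p hp hp', hg, smul_inv_smul]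

end LinkDiagram

end CuspedHyp

namespace CuspedHyp

namespace LinkDiagram

variable {D : LinkDiagram} {Γ : Subgroup PSL2} {f : Manifold Γ ≃ₜ D.Complement}
  {σ : ℂ × ℝ → H3} {m : MeridianSystem Γ} {K : IntermediateField ℚ ℂ} {A₀ : SL2}

/-! ## Rational crossing arcs -/

variable (f σ m K) in
/-- The standing assumptions: `σ` lifts the points of the complement that are visible from above,
and the field `K` contains the labels of the diagram. -/
structure IsLabelField : Prop where
  group : IsFiniteVolumeManifoldGroup Γ
  lift : IsLiftOn f id D.visible σ
  standard : IsStandardMeridian f m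
  essential : CrossingArcsEssential f
  crossing_mem : ∀ x ∈ crossingLabels f m, x ∈ K
  edge_mem : ∀ x ∈ edgeLabels f m, x ∈ K

variable (f σ m K A₀) in
/-- The lift of the crossing arc next to the sector at `a` joins two cusps `P`, `Q` such that the
frame at `P` with `Q` at `0` is equivalent to `A₀` over `K`. -/
def IsRationalSector (a b : D.Param) (e : ℝ) : Prop :=
  ∃ κ S P Q, IsSectorLift f σ a b κ e S ∧ Joins Γ (arc S a b) P Q ∧ IsRationalFlag K m A₀ P Q

variable (f σ m K A₀) in
/-- The same for one side of the overpass. -/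
def IsRationalSide (o u : D.Param) (ρ : ℝ) : Prop :=
  ∃ κ S P Q, IsSideLift f σ o u κ ρ S ∧ Joins Γ (arc S o u) P Q ∧ IsRationalFlag K m A₀ P Q

namespace IsLabelField

variable (H : IsLabelField f σ m K)
include H

lemma exists_joins {a b : D.Param} (h : D.IsCrossing a b) {κ : ℝ} (hκ : 0 < κ)
    {S : ℂ × ℝ → H3} (hS : IsLiftOn f id (spindle a b κ) S) :
    ∃ P Q, P ≠ Q ∧ Joins Γ (arc S a b) P Q :=
  H.essential _ _ _ (h.isCrossingLift_arc hκ hS)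

lemma ne_of_joins {a b : D.Param} {c : ℝ → H3} (h : IsCrossingLift f a b c) {P Q : OnePoint ℂ}
    (hc : Joins Γ c P Q) : P ≠ Q := by
  obtain ⟨P', Q', hne, hc'⟩ := H.essential _ _ _ h
  obtain ⟨rfl, rfl⟩ := hc.unique hc'
  exact hne

lemma swap_flag {a b : D.Param} {c : ℝ → H3} (h : IsCrossingLift f a b c) {P Q : OnePoint ℂ}
    (hc : Joins Γ c P Q) (hPQ : IsRationalFlag K m A₀ P Q) : IsRationalFlag K m A₀ Q P := by
  obtain ⟨w, hw⟩ := IsFlagFrame.exists_intercusp (m := m) hc.1 hc.2.1 (H.ne_of_joins h hc)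
  refine hPQ.swap ⟨w, hw, ?_⟩
  have := H.crossing_mem (-w) ⟨a, b, c, P, Q, w, h, hc, hw, rfl⟩
  simpa using neg_mem this

lemma sector_over_iff {o u : D.Param} (h : D.IsCrossing o u) (hou : (D.pt u).2 < (D.pt o).2)
    {e : ℝ} (he : e * e = 1) :
    IsRationalSector f σ m K A₀ o u e ↔ IsRationalSide f σ m K A₀ o u 1 := by
  constructor
  · rintro ⟨κ, S, P, Q, hS, hJ, hPQ⟩
    obtain ⟨κ₀, hκ₀⟩ := h.exists_isArcNhd hou
    have h0 : 0 < min κ κ₀ := lt_min hS.1 hκ₀.pos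
    exact ⟨_, S, P, Q, (hS.mono h0 (min_le_left _ _)).isSideLift_over he
      (hκ₀.mono h0 (min_le_right _ _)) h H.group H.lift, hJ, hPQ⟩
  · rintro ⟨κ, S, P, Q, hS, hJ, hPQ⟩
    exact ⟨κ, S, P, Q, hS.isSectorLift_over e, hJ, hPQ⟩

/-- The sectors before and after the crossing at the underpass lie on different sides of the
overpass, which side being decided by the orientation of the crossing. Reading the arc from the
underpass reverses the flag, and this costs the crossing label. -/
lemma sector_under_iff {o u : D.Param} (h : D.IsCrossing o u) (hou : (D.pt u).2 < (D.pt o).2)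
    {ρ e : ℝ} (he : e * e = 1) (hρ : ρ * ρ = 1)
    (hρe : 0 < ρ * (e * (D.dir u.1 / D.dir o.1).im)) :
    IsRationalSector f σ m K A₀ u o e ↔ IsRationalSide f σ m K A₀ o u ρ := by
  constructor
  · rintro ⟨κ, S, P, Q, hS, hJ, hPQ⟩
    obtain ⟨κ₀, hκ₀⟩ := h.exists_isArcNhd hou
    have h0 : 0 < min κ κ₀ := lt_min hS.1 hκ₀.pos
    refine ⟨_, S, Q, P, (hS.mono h0 (min_le_left _ _)).isSideLift_under h hρ he hρe
      (hκ₀.mono h0 (min_le_right _ _)) H.group H.lift, ?_, ?_⟩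
    · rw [arc_swap]; exact hJ.reverse
    · exact H.swap_flag (h.symm.isCrossingLift_arc hS.1 hS.2.1) hJ hPQ
  · rintro ⟨κ, S, P, Q, hS, hJ, hPQ⟩
    refine ⟨κ, S, Q, P, hS.isSectorLift_under h hρ he hρe, ?_, ?_⟩
    · rw [arc_swap]; exact hJ.reverse
    · exact H.swap_flag (h.isCrossingLift_arc hS.1 hS.2.1) hJ hPQ

/-- The lifts for the two sides of the overpass differ by the meridian at the cusp of the overpass,
and this meridian is represented over K as soon as the flag is rational. -/
lemma side_iff {o u : D.Param} (h : D.IsCrossing o u) (hou : (D.pt u).2 < (D.pt o).2) :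
    IsRationalSide f σ m K A₀ o u 1 ↔ IsRationalSide f σ m K A₀ o u (-1) := by
  obtain ⟨κ₀, hκ₀⟩ := h.exists_isArcNhd hou
  constructor
  · rintro ⟨κ, S, P, Q, hS, hJ, hPQ⟩
    have h0 : 0 < min κ κ₀ := lt_min hS.1 hκ₀.pos
    have hS' := hS.mono h0 (min_le_left _ _)
    have hκ := hκ₀.mono h0 (min_le_right _ _)
    exact ⟨_, _, _, _, hS'.meridian_smul H.group H.lift H.standard h hou hκ hJ.1 hJ.2.2.1,
      hJ.smul (m.mem P hJ.1), hPQ.smul hJ.1 (m.mem P hJ.1) hPQ.meridian_mem⟩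
  · rintro ⟨κ, S, P, Q, hS, hJ, hPQ⟩
    have h0 : 0 < min κ κ₀ := lt_min hS.1 hκ₀.pos
    have hS' := hS.mono h0 (min_le_left _ _)
    have hκ := hκ₀.mono h0 (min_le_right _ _)
    -- The given lift for the right side must be the meridian translate of a lift for the left side,
    -- by uniqueness of lifts. The inverse meridian then carries the rational flag back.
    obtain ⟨S₁, hS₁⟩ := hκ.exists_isSideLift (ρ := 1) h (by norm_num) H.group H.lift
    obtain ⟨P₁, Q₁, -, hJ₁⟩ := H.exists_joins h h0 hS₁.2.1
    have hS₂ := hS₁.meridian_smul H.group H.lift H.standard h hou hκ hJ₁.1 hJ₁.2.2.1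
    have hJ₂ := hJ₁.smul (m.mem P₁ hJ₁.1)
    obtain ⟨x, h1, h2⟩ := ((h.eventually_mem_spindle h0 ((-1 * Complex.I) * D.dir o.1)).and
      self_mem_nhdsWithin).exists
    have h2 : 0 < x := h2
    have h3 : 0 < -1 * (D.coord o.1 ((D.pt o).1 + x * (-1 * Complex.I * D.dir o.1))).im := by
      rw [← mul_assoc, coord_pt_add]
      simpa using h2
    have heq := hS₂.2.1.eqOn H.group (convex_spindle _ _ _).isPreconnected hS'.2.1 h1
      ((hS'.2.2 _ h1 h3).trans (hS₂.2.2 _ h1 h3).symm)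
    have hJ₃ : Joins Γ (fun τ => m.meridian P₁ • arc S₁ o u τ) P Q :=
      hJ.congr fun τ hτ => heq (h.lineMap_mem_spindle h0 hτ)
    obtain ⟨e1, e2⟩ := hJ₃.unique hJ₂
    rw [m.fixes P₁ hJ₁.1] at e1
    subst e1
    subst e2
    have hμ := hPQ.meridian_mem
    have h5 := hPQ.smul hJ₁.1 (inv_mem (m.mem P hJ₁.1)) (inv_mem hμ)
    rw [inv_smul_smul, inv_smul_eq_iff.2 (m.fixes P hJ₁.1).symm] at h5
    exact ⟨_, S₁, P, Q₁, hS₁, hJ₁, h5⟩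

lemma side_iff_sector {o u : D.Param} (h : D.IsCrossing o u) (hou : (D.pt u).2 < (D.pt o).2)
    {e : ℝ} (he : e * e = 1) :
    IsRationalSector f σ m K A₀ u o e ↔ IsRationalSide f σ m K A₀ o u 1 := by
  have h1 : e * (D.dir u.1 / D.dir o.1).im ≠ 0 :=
    mul_ne_zero (by rintro rfl; simp at he) h.im_ne_zero
  rcases lt_or_gt_of_ne h1 with h2 | h2
  · rw [H.sector_under_iff h hou (ρ := -1) he (by norm_num) (by linarith), H.side_iff h hou]
  · rw [H.sector_under_iff h hou (ρ := 1) he (by norm_num) (by linarith)]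

/-- Rationality does not depend on the sector of a crossing. -/
lemma sector_iff {a b : D.Param} (h : D.IsCrossing a b) {e e' : ℝ} (he : e * e = 1)
    (he' : e' * e' = 1) :
    IsRationalSector f σ m K A₀ a b e ↔ IsRationalSector f σ m K A₀ b a e' := by
  rcases lt_or_gt_of_ne h.snd_ne with h1 | h1
  · rw [H.side_iff_sector h.symm h1 he, H.sector_over_iff h.symm h1 he']
  · rw [H.side_iff_sector h h1 he', H.sector_over_iff h h1 he]

lemma exists_sectorLift {a b : D.Param} (h : D.IsCrossing a b) {e : ℝ} (he : e * e = 1) :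
    ∃ κ S P Q, P ≠ Q ∧ IsSectorLift f σ a b κ e S ∧ Joins Γ (arc S a b) P Q := by
  have key : ∃ κ S, IsSectorLift f σ a b κ e S := by
    rcases lt_or_gt_of_ne h.snd_ne with h1 | h1
    · obtain ⟨κ, hκ⟩ := h.symm.exists_isArcNhd h1
      have h2 : e * (D.dir a.1 / D.dir b.1).im ≠ 0 :=
        mul_ne_zero (by rintro rfl; simp at he) h.symm.im_ne_zero
      rcases lt_or_gt_of_ne h2 with h2 | h2
      · obtain ⟨S, hS⟩ := hκ.exists_isSideLift (ρ := -1) h.symm (by norm_num) H.group H.lift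
        exact ⟨κ, S, hS.isSectorLift_under h.symm (by norm_num) he (by linarith)⟩
      · obtain ⟨S, hS⟩ := hκ.exists_isSideLift (ρ := 1) h.symm (by norm_num) H.group H.lift
        exact ⟨κ, S, hS.isSectorLift_under h.symm (by norm_num) he (by linarith)⟩
    · obtain ⟨κ, hκ⟩ := h.exists_isArcNhd h1
      obtain ⟨S, hS⟩ := hκ.exists_isSideLift (ρ := 1) h (by norm_num) H.group H.lift
      exact ⟨κ, S, hS.isSectorLift_over e⟩
  obtain ⟨κ, S, hS⟩ := key
  obtain ⟨P, Q, hne, hJ⟩ := H.exists_joins h hS.1 hS.2.1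
  exact ⟨κ, S, P, Q, hne, hS, hJ⟩

end IsLabelField

/-! ## Paths along the boundary of a region -/

/-- The points over a region. -/
def overRegion (f : Manifold Γ ≃ₜ D.Complement) (R : Set ℂ) : Set H3 :=
  {x | ∃ z ∈ R, ∃ h : ℝ, cover f x = ((z, h) : ℂ × ℝ)}

/-- Paths whose interior points lie in `E`. -/
def JoinedThrough (E : Set H3) (x y : H3) : Prop :=
  ∃ γ : ℝ → H3, ContinuousOn γ (Icc 0 1) ∧ γ 0 = x ∧ γ 1 = y ∧ ∀ s ∈ Ioo (0 : ℝ) 1, γ s ∈ E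

lemma JoinedThrough.symm {E : Set H3} {x y : H3} (h : JoinedThrough E x y) :
    JoinedThrough E y x := by
  obtain ⟨γ, hγ, h0, h1, hE⟩ := h
  refine ⟨fun s => γ (1 - s), hγ.comp (by fun_prop) fun s hs => ⟨by linarith [hs.2],
    by linarith [hs.1]⟩, by simpa using h1, by simpa using h0, fun s hs => hE _ ⟨by linarith [hs.2],
    by linarith [hs.1]⟩⟩

lemma JoinedThrough.trans {E : Set H3} {x y z : H3} (h : JoinedThrough E x y)
    (h' : JoinedThrough E y z) (hy : y ∈ E) : JoinedThrough E x z := by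
  obtain ⟨γ, hγ, h0, h1, hE⟩ := h
  obtain ⟨γ', hγ', h0', h1', hE'⟩ := h'
  refine ⟨fun s => if s ≤ 1 / 2 then γ (2 * s) else γ' (2 * s - 1), ?_, ?_, ?_, ?_⟩
  · rw [← Icc_union_Icc_eq_Icc (show (0 : ℝ) ≤ 1 / 2 by norm_num) (by norm_num)]
    refine ContinuousOn.union_of_isClosed ?_ ?_ isClosed_Icc isClosed_Icc
    · refine (hγ.comp (f := fun s : ℝ => 2 * s) (by fun_prop)
        (t := Icc 0 1) (s := Icc 0 (1 / 2)) fun s hs => ⟨by linarith [hs.1], by linarith [hs.2]⟩).congr ?_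
      intro s hs
      simp only [Function.comp_apply, if_pos hs.2]
    · refine (hγ'.comp (f := fun s : ℝ => 2 * s - 1) (by fun_prop)
        (t := Icc 0 1) (s := Icc (1 / 2) 1) fun s hs => ⟨by linarith [hs.1], by linarith [hs.2]⟩).congr ?_
      intro s hs
      simp only [Function.comp_apply]
      split_ifs with hle
      · have : s = 1 / 2 := le_antisymm hle hs.1
        subst this
        norm_num
        rw [h0', h1]
      · rfl
  · norm_num; exact h0
  · norm_num; exact h1'
  · intro s hs
    simp only
    split_ifs with hle
    · rcases hle.eq_or_lt with rfl | hlt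
      · norm_num
        rw [h1]; exact hy
      · exact hE _ ⟨by linarith [hs.1], by linarith⟩
    · exact hE' _ ⟨by linarith, by linarith [hs.2]⟩

lemma IsRegion.isOpen {R : Set ℂ} (hR : D.IsRegion R) : IsOpen R := by
  obtain ⟨z, hz, rfl⟩ := hR
  exact isOpen_compl_shadow.connectedComponentIn

lemma IsRegion.isConnected {R : Set ℂ} (hR : D.IsRegion R) : IsConnected R := by
  obtain ⟨z, hz, rfl⟩ := hR
  exact isConnected_connectedComponentIn_iff.2 hz

/-- Points over a region are joined through the lift of the visible points. -/
lemma IsRegion.joinedThrough (hσ : IsLiftOn f id D.visible σ) {R : Set ℂ} (hR : D.IsRegion R)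
    {p q : ℂ × ℝ} (hp : p.1 ∈ R) (hq : q.1 ∈ R) :
    JoinedThrough (overRegion f R) (σ p) (σ q) := by
  have hpc : IsPathConnected (R ×ˢ (univ : Set ℝ)) :=
    ((hR.isOpen.prod isOpen_univ).isConnected_iff_isPathConnected).1
      (hR.isConnected.prod isConnected_univ)
  obtain ⟨γ, hγ⟩ := hpc.joinedIn p ⟨hp, trivial⟩ q ⟨hq, trivial⟩
  have hmem : ∀ s, γ.extend s ∈ R ×ˢ (univ : Set ℝ) := fun s => hγ _
  have hv : ∀ s, γ.extend s ∈ D.visible :=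
    fun s => visible_of_not_mem_shadow (hR.disjoint_shadow (hmem s).1)
  refine ⟨fun s => σ (γ.extend s), hσ.1.comp γ.continuous_extend.continuousOn fun s _ => hv s,
    by simp, by simp, fun s _ => ⟨(γ.extend s).1, (hmem s).1, (γ.extend s).2, hσ.2 _ (hv s)⟩⟩

lemma convex_sector (i : Fin D.n) (t δ e : ℝ) :
    Convex ℝ {z | (D.coord i z).im < δ * (e * ((D.coord i z).re - t))} := by
  intro z hz w hw a b ha hb hab
  simp only [Set.mem_ofPred_eq] at hz hw ⊢
  have e : D.coord i (a • z + b • w) = a * D.coord i z + b * D.coord i w := by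
    have hab' : (a : ℂ) + b = 1 := by exact_mod_cast hab
    have hd := dir_ne_zero i
    simp only [coord, Complex.real_smul]
    field_simp
    linear_combination (D.vert i).1 * hab'
  rw [e]
  simp only [Complex.add_im, Complex.im_ofReal_mul, Complex.add_re, Complex.re_ofReal_mul]
  obtain rfl : b = 1 - a := by linarith
  rcases ha.eq_or_lt with rfl | ha'
  · simpa using hw
  · nlinarith [mul_lt_mul_of_pos_left hz ha', mul_le_mul_of_nonneg_left hw.le hb]

/-- A lift of a crossing arc is joined to the lift of the region on the left of the strand. -/
lemma IsSectorLift.joinedThrough {a b : D.Param} (h : D.IsCrossing a b) {κ e : ℝ}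
    {S : ℂ × ℝ → H3} (hS : IsSectorLift f σ a b κ e S) (he : e * e = 1) {R : Set ℂ}
    (hR : ∀ᶠ x in 𝓝[>] (0 : ℝ), ∃ g, IsWall f σ a.1 (a.2 + e * x) g R) :
    ∃ p : ℂ × ℝ, p.1 ∈ R ∧ JoinedThrough (overRegion f R) (arc S a b (1 / 2)) (σ p) := by
  obtain ⟨hκ, hSl, δ, hδ, hSσ⟩ := hS
  obtain ⟨δ', hδ', hratio⟩ := h.exists_sector_ratio
  obtain ⟨η, hη, hnear⟩ := h.exists_nhd
  have hdir : 0 < ‖D.dir a.1‖ := norm_pos_iff.2 (dir_ne_zero a.1)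
  -- The slope δ ensures that S agrees with σ in the wedge, and δ' keeps the wedge away from the
  -- strand `b`.
  set δ₁ := min δ δ' with hδ₁
  have hδ₁0 : 0 < δ₁ := lt_min hδ hδ'
  set Wd := Metric.ball (D.pt a).1 η ∩ ({z | 0 < 1 * (D.coord a.1 z).im} ∩
    {z | (D.coord a.1 z).im < δ₁ * (e * ((D.coord a.1 z).re - a.2))}) with hWd
  have hWdc : Convex ℝ Wd :=
    (convex_ball _ _).inter ((convex_side a.1 1).inter (convex_sector a.1 a.2 δ₁ e))
  have hee : |e| = 1 := by
    rcases mul_self_eq_one_iff.1 he with rfl | rfl <;> simp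
  have hWds : ∀ z ∈ Wd, z ∉ D.shadow := by
    rintro z ⟨hz1, hz2, hz3⟩ hz
    rw [Set.mem_ofPred_eq, one_mul] at hz2
    rw [Set.mem_ofPred_eq] at hz3
    obtain ⟨k, τ, hτ, rfl⟩ := mem_shadow_iff.1 hz
    rcases hnear k τ hτ (mem_ball_iff_norm.1 hz1) with rfl | rfl
    · rw [coord_seg, Complex.ofReal_im] at hz2
      exact lt_irrefl _ hz2
    · rw [h.coord_eq, coord_seg, ← Complex.ofReal_sub] at hz2 hz3
      simp only [Complex.add_im, Complex.ofReal_im, zero_add, Complex.im_ofReal_mul,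
        Complex.add_re, Complex.ofReal_re, Complex.re_ofReal_mul, add_sub_cancel_left] at hz2 hz3
      set ν := D.dir b.1 / D.dir a.1
      set t := τ - b.2
      have h1 : e * (t * ν.re) ≤ |t| * |ν.re| := by
        have := le_abs_self (e * (t * ν.re))
        rwa [abs_mul, hee, one_mul, abs_mul] at this
      have h2 : δ₁ * (e * (t * ν.re)) ≤ δ' * (|t| * |ν.re|) :=
        (mul_le_mul_of_nonneg_left h1 hδ₁0.le).trans
          (mul_le_mul_of_nonneg_right (min_le_right _ _) (by positivity))
      have h3 : |t| * (δ' * |ν.re|) ≤ |t| * |ν.im| :=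
        mul_le_mul_of_nonneg_left hratio (abs_nonneg t)
      have h4 : |t| * |ν.im| = t * ν.im := by rw [← abs_mul, abs_of_pos hz2]
      linarith
  -- The wedge is convex, avoids the diagram, and contains points immediately to the left of the
  -- strand, where a wall chart shows that the region is R.
  have hWdR : Wd ⊆ R := by
    have hsmall : ∀ᶠ x in 𝓝[>] (0 : ℝ),
        (D.seg a.1 (a.2 + e * x)).1 ∈ Metric.ball (D.pt a).1 η := by
      have hc : Continuous fun x : ℝ => (D.seg a.1 (a.2 + e * x)).1 :=
        continuous_fst.comp ((continuous_seg a.1).comp (by fun_prop))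
      refine nhdsWithin_le_nhds (hc.tendsto 0 (Metric.isOpen_ball.mem_nhds ?_))
      simp only [mul_zero, add_zero, ← pt_eq_seg]
      exact Metric.mem_ball_self hη
    obtain ⟨x, ⟨g, ε', y, S', w⟩, hx1, hx2⟩ :=
      (hR.and (hsmall.and self_mem_nhdsWithin)).exists
    have hx2 : 0 < x := hx2
    have hopen : IsOpen (Metric.ball (D.pt a).1 η ∩
        {z | (D.coord a.1 z).im < δ₁ * (e * ((D.coord a.1 z).re - a.2))}) := by
      have hc := continuous_coord a.1
      exact Metric.isOpen_ball.inter (isOpen_lt (Complex.continuous_im.comp hc)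
        (continuous_const.mul (continuous_const.mul
          ((Complex.continuous_re.comp hc).sub continuous_const))))
    obtain ⟨ξ, hξ, hball⟩ := Metric.isOpen_iff.1 hopen (D.seg a.1 (a.2 + e * x)).1 ⟨hx1, by
      rw [Set.mem_ofPred_eq, coord_seg, Complex.ofReal_im, Complex.ofReal_re, add_sub_cancel_left,
        ← mul_assoc e, he, one_mul]
      exact mul_pos hδ₁0 hx2⟩
    obtain ⟨zl, hzl, -, -, hl, -⟩ := exists_left_right a.1 (a.2 + e * x) (lt_min hξ w.pos)
    have h1 := hball (Metric.ball_subset_ball (min_le_left _ _) hzl)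
    exact w.region.subset_of_isPreconnected hWdc.isPreconnected hWds
      (w.mem_region zl (Metric.ball_subset_ball (min_le_right _ _) hzl) hl)
      ⟨h1.1, by rwa [Set.mem_ofPred_eq, one_mul], h1.2⟩
  set v : ℂ := (e + (δ₁ / 2 : ℝ) * Complex.I) * D.dir a.1 with hv
  have hsmall : ∀ᶠ x : ℝ in 𝓝[>] 0, (D.pt a).1 + x * v ∈ Metric.ball (D.pt a).1 η := by
    have hc : Continuous fun x : ℝ => (D.pt a).1 + x * v := by fun_prop
    refine nhdsWithin_le_nhds (hc.tendsto 0 (Metric.isOpen_ball.mem_nhds ?_))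
    rw [Complex.ofReal_zero, zero_mul, add_zero]
    exact Metric.mem_ball_self hη
  obtain ⟨x₀, hx₀, hx₀s⟩ := mem_nhdsGT_iff_exists_Ioc_subset.1
    ((h.eventually_mem_spindle hκ v).and hsmall)
  have hx₀ : 0 < x₀ := hx₀
  have hsec : ∀ x : ℝ, 0 < x → 0 < (D.coord a.1 ((D.pt a).1 + x * v)).im ∧
      (D.coord a.1 ((D.pt a).1 + x * v)).im <
        δ₁ * (e * ((D.coord a.1 ((D.pt a).1 + x * v)).re - a.2)) := by
    intro x hx
    rw [hv, ← mul_assoc, coord_pt_add]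
    have h3 : e * (x * e) = x := by linear_combination x * he
    simp
    rw [h3]
    constructor
    · positivity
    · nlinarith [mul_pos hx hδ₁0]
  have hin : ∀ x ∈ Ioc 0 x₀, (D.pt a).1 + x * v ∈ R := fun x hx => by
    obtain ⟨h1, h2⟩ := hsec x hx.1
    exact hWdR ⟨(hx₀s hx).2, by rwa [Set.mem_ofPred_eq, one_mul], h2⟩
  set mid := ((D.pt a).2 + (D.pt b).2) / 2 with hmid
  have hmid' : AffineMap.lineMap (D.pt a) (D.pt b) (1 / 2 : ℝ) = ((D.pt a).1, mid) := by
    rw [h.lineMap_eq, hmid]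
    congr 1
    ring
  have hsp : ∀ s ∈ Icc (0 : ℝ) 1, ((D.pt a).1 + (s * x₀ : ℝ) * v, mid) ∈ spindle a b κ := by
    intro s hs
    rcases hs.1.eq_or_lt with rfl | h0
    · rw [zero_mul, Complex.ofReal_zero, zero_mul, add_zero, ← hmid']
      exact h.lineMap_mem_spindle hκ ⟨by norm_num, by norm_num⟩
    · exact (hx₀s ⟨mul_pos h0 hx₀, by nlinarith [hs.2]⟩).1
  refine ⟨((D.pt a).1 + x₀ * v, mid), hin x₀ ⟨hx₀, le_rfl⟩,
    fun s => S ((D.pt a).1 + (s * x₀ : ℝ) * v, mid), hSl.1.comp (by fun_prop) hsp, ?_, ?_, ?_⟩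
  · simp only [zero_mul, Complex.ofReal_zero, add_zero, arc, hmid']
  · simp only [one_mul]
    obtain ⟨h1, h2⟩ := hsec x₀ hx₀
    refine hSσ _ (hx₀s ⟨hx₀, le_rfl⟩).1 h1 (h2.trans_le ?_)
    have h3 : 0 ≤ e * ((D.coord a.1 ((D.pt a).1 + x₀ * v)).re - a.2) := by
      by_contra! hneg
      nlinarith
    exact mul_le_mul_of_nonneg_right (min_le_left _ _) h3
  · intro s hs
    exact ⟨_, hin _ ⟨mul_pos hs.1 hx₀, by nlinarith [hs.2]⟩, mid, hSl.2 _ (hsp s ⟨hs.1.le, hs.2.le⟩)⟩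

lemma walk_eventually_right {a : D.Param} (ha : a.2 ∈ Ico (0 : ℝ) 1) :
    ∀ᶠ x in 𝓝[>] (0 : ℝ), D.walk a x = (a.1, a.2 + 1 * x) := by
  have := walk_right (a := a) (s := 0) (by linarith [ha.1])
  rw [walk_zero ha] at this
  filter_upwards [this] with x hx
  rw [hx, sub_zero, one_mul]

lemma walk_eventually_left {a : D.Param} {r : ℝ} (h : 0 ≤ a.2 + r) (h0 : 0 < (D.walk a r).2) :
    ∀ᶠ x in 𝓝[>] (0 : ℝ), D.walk a (r - x) = ((D.walk a r).1, (D.walk a r).2 + -1 * x) := by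
  have ht : Tendsto (fun x : ℝ => r - x) (𝓝[>] 0) (𝓝[<] r) := by
    refine tendsto_nhdsWithin_iff.2 ⟨?_, ?_⟩
    · have : Continuous fun x : ℝ => r - x := by fun_prop
      have := this.tendsto 0
      rw [sub_zero] at this
      exact this.mono_left nhdsWithin_le_nhds
    · filter_upwards [self_mem_nhdsWithin] with x hx
      have : (0 : ℝ) < x := hx
      simp only [mem_Iio]; linarith
  filter_upwards [ht (walk_left h h0)] with x hx
  have hx : D.walk a (r - x) = _ := hx
  rw [hx, sub_sub_cancel_left, neg_one_mul]

/-- The lifts of the crossing arcs at the ends of an edge run from the same cusp. -/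
lemma IsLabelField.exists_edgeLabel (H : IsLabelField f σ m K) {a b b' : D.Param} {r : ℝ}
    (h : D.IsCrossing a b) (hr : 0 < r) (h' : D.IsCrossing (D.walk a r) b')
    (hreg : ∀ s ∈ Ioo 0 r, ¬ D.IsDouble (D.walk a s)) {κ κ' : ℝ} {S S' : ℂ × ℝ → H3}
    (hS : IsSectorLift f σ a b κ 1 S) (hS' : IsSectorLift f σ (D.walk a r) b' κ' (-1) S')
    {P Q P' Q' : OnePoint ℂ} (hJ : Joins Γ (arc S a b) P Q)
    (hJ' : Joins Γ (arc S' (D.walk a r) b') P' Q') :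
    P = P' ∧ ∃ u ∈ K, IsTranslationParameter m Q P Q' u := by
  have ha := h.mem_Ioo
  obtain ⟨g, R, hw⟩ := exists_isWall_edge H.group H.lift ha.1.le hr hreg
  have w1 : ∀ᶠ x in 𝓝[>] (0 : ℝ), IsWall f σ a.1 (a.2 + 1 * x) g R := by
    filter_upwards [walk_eventually_right h.1, Ioo_mem_nhdsGT hr,
      eventually_regular ha one_ne_zero] with x h1 h2 h3
    have := hw x h2
    rw [h1] at this
    exact this h3.1.1.ne'
  have w2 : ∀ᶠ x in 𝓝[>] (0 : ℝ),
      IsWall f σ (D.walk a r).1 ((D.walk a r).2 + -1 * x) g R := by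
    filter_upwards [walk_eventually_left (by linarith [ha.1]) h'.mem_Ioo.1, Ioo_mem_nhdsGT hr,
      eventually_regular h'.mem_Ioo (neg_ne_zero.2 one_ne_zero)] with x h1 h2 h3
    have := hw (r - x) ⟨by linarith [h2.2], by linarith [h2.1]⟩
    rw [h1] at this
    exact this h3.1.1.ne'
  have e1 : g = (m.meridian P)⁻¹ := by
    obtain ⟨x, h1, h2⟩ := (w1.and (hS.wall_eq H.group H.lift H.standard h (by norm_num) hJ.1
      hJ.2.2.1)).exists
    exact h2 g R h1
  have e2 : g = (m.meridian P')⁻¹ := by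
    obtain ⟨x, h1, h2⟩ := (w2.and (hS'.wall_eq H.group H.lift H.standard h' (by norm_num) hJ'.1
      hJ'.2.2.1)).exists
    exact h2 g R h1
  -- The wall is the same at both ends of the edge, so the two cusps have the same meridian and
  -- therefore coincide.
  have hPP : P = P' := meridian_injOn hJ.1 hJ'.1 (inv_injective (e1.symm.trans e2))
  subst hPP
  have hRreg : D.IsRegion R := by
    obtain ⟨x, ε, y, S, w⟩ := w1.exists
    exact w.region
  refine ⟨rfl, ?_⟩
  obtain ⟨u, hu⟩ := IsTranslationParameter.exists (m := m) hJ.1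
    (H.ne_of_joins (h.isCrossingLift_arc hS.1 hS.2.1) hJ)
    (H.ne_of_joins (h'.isCrossingLift_arc hS'.1 hS'.2.1) hJ')
  refine ⟨u, H.edge_mem u ⟨a, r, R, b, b', _, _, P, Q, Q',
    ⟨hr, ⟨b, h⟩, ⟨b', h'⟩, hreg⟩, hRreg, isSide_of_isWall ha.1.le hw,
    h.isCrossingLift_arc hS.1 hS.2.1, h'.isCrossingLift_arc hS'.1 hS'.2.1, ?_, hJ, hJ', hu⟩, hu⟩
  obtain ⟨p, hp, hpR⟩ := hS.joinedThrough h (by norm_num) (w1.mono fun x hx => ⟨g, hx⟩)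
  obtain ⟨p', hp', hpR'⟩ := hS'.joinedThrough h' (by norm_num) (w2.mono fun x hx => ⟨g, hx⟩)
  have hmem : ∀ q : ℂ × ℝ, q.1 ∈ R → σ q ∈ overRegion f R := fun q hq =>
    ⟨q.1, hq, q.2, H.lift.2 _ (visible_of_not_mem_shadow (hRreg.disjoint_shadow hq))⟩
  obtain ⟨γ, hγ, h0, h1, hE⟩ := (hpR.trans (hRreg.joinedThrough H.lift hp hp') (hmem p hp)).trans
    hpR'.symm (hmem p' hp')
  exact ⟨γ, hγ, ⟨1 / 2, ⟨by norm_num, by norm_num⟩, h0⟩, ⟨1 / 2, ⟨by norm_num, by norm_num⟩, h1⟩, hE⟩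

/-- Rationality spreads along the edges of the diagram. -/
lemma IsLabelField.sector_walk_iff (H : IsLabelField f σ m K) {a b b' : D.Param} {r : ℝ}
    (h : D.IsCrossing a b) (hr : 0 < r) (h' : D.IsCrossing (D.walk a r) b')
    (hreg : ∀ s ∈ Ioo 0 r, ¬ D.IsDouble (D.walk a s)) :
    IsRationalSector f σ m K A₀ a b 1 ↔ IsRationalSector f σ m K A₀ (D.walk a r) b' (-1) := by
  constructor
  · rintro ⟨κ, S, P, Q, hS, hJ, hPQ⟩
    obtain ⟨κ', S', P', Q', -, hS', hJ'⟩ := H.exists_sectorLift h' (e := -1) (by norm_num)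
    obtain ⟨rfl, u, huK, hu⟩ := H.exists_edgeLabel h hr h' hreg hS hS' hJ hJ'
    exact ⟨κ', S', P, Q', hS', hJ', hPQ.turn ⟨u, hu, huK⟩⟩
  · rintro ⟨κ', S', P', Q', hS', hJ', hPQ⟩
    obtain ⟨κ, S, P, Q, -, hS, hJ⟩ := H.exists_sectorLift h (e := 1) (by norm_num)
    obtain ⟨rfl, u, huK, A, hA, x, y, hx, hy, rfl⟩ := H.exists_edgeLabel h hr h' hreg hS hS' hJ hJ'
    exact ⟨κ, S, P, Q, hS, hJ, hPQ.turn ⟨x - y, ⟨A, hA, y, x, hy, hx, rfl⟩, by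
      simpa using neg_mem huK⟩⟩

/-- Walls next to rational crossing arcs. -/
lemma IsRationalSector.wall_mem (H : IsLabelField f σ m K) {a b : D.Param} {e : ℝ}
    (hab : IsRationalSector f σ m K A₀ a b e) (h : D.IsCrossing a b) (he : e * e = 1) :
    ∀ᶠ x in 𝓝[>] (0 : ℝ), ∀ g R, IsWall f σ a.1 (a.2 + e * x) g R →
      g ∈ rationalSubgroup K A₀ := by
  obtain ⟨κ, S, P, Q, hS, hJ, hPQ⟩ := hab
  filter_upwards [hS.wall_eq H.group H.lift H.standard h he hJ.1 hJ.2.2.1] with x hx g R hg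
  rw [hx g R hg]
  exact inv_mem hPQ.meridian_mem

end LinkDiagram

end CuspedHyp

namespace CuspedHyp

namespace LinkDiagram

variable {D : LinkDiagram} {Γ : Subgroup PSL2} {f : Manifold Γ ≃ₜ D.Complement}
  {σ : ℂ × ℝ → H3} {m : MeridianSystem Γ} {K : IntermediateField ℚ ℂ} {A₀ : SL2}

/-! ## Rationality of all walls -/

lemma finite_isDouble_walk {a : D.Param} (ha : 0 ≤ a.2) (r : ℝ) :
    {s ∈ Icc 0 r | D.IsDouble (D.walk a s)}.Finite := by
  have hsub : {s ∈ Icc 0 r | D.IsDouble (D.walk a s)} ⊆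
      ⋃ k ∈ Iic ⌈a.2 + r⌉₊, {s : ℝ | D.IsDouble ((D.next ^ k) a.1, a.2 + s - k)} := by
    rintro s ⟨hs, hd⟩
    obtain ⟨k, τ, hτ, e, hw⟩ := walk_decomp a (r := s) (by linarith [hs.1])
    rw [hw] at hd
    simp only [mem_iUnion]
    refine ⟨k, ?_, ?_⟩
    · have h1 : (k : ℝ) ≤ a.2 + r := by linarith [hτ.1, hs.2]
      exact_mod_cast h1.trans (Nat.le_ceil _)
    · rw [Set.mem_ofPred_eq]
      convert hd using 2
      linarith
  refine Finite.subset ((finite_Iic _).biUnion fun k _ => ?_) hsub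
  refine Finite.preimage (f := fun s : ℝ => (((D.next ^ k) a.1, a.2 + s - k) : D.Param)) ?_
    (finite_isDouble D)
  refine Function.Injective.injOn fun x y hxy => ?_
  have := congrArg Prod.snd hxy
  simpa using this

variable (f σ m K A₀) in
/-- Double points at which the crossing arc is rational. -/
def IsRationalDouble (a : D.Param) : Prop :=
  ∃ b, D.IsCrossing a b ∧ IsRationalSector f σ m K A₀ a b 1

namespace IsLabelField

variable (H : IsLabelField f σ m K)
include H

lemma isRationalDouble_iff {a b : D.Param} (h : D.IsCrossing a b) {e : ℝ} (he : e * e = 1) :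
    IsRationalDouble f σ m K A₀ a ↔ IsRationalSector f σ m K A₀ a b e := by
  have h1 : IsRationalSector f σ m K A₀ a b 1 ↔ IsRationalSector f σ m K A₀ a b e :=
    (H.sector_iff h (by norm_num) (e' := 1) (by norm_num)).trans
      (H.sector_iff h.symm (by norm_num) he)
  rw [← h1]
  constructor
  · rintro ⟨b', h', hr⟩
    rwa [h.unique h']
  · exact fun hr => ⟨b, h, hr⟩

lemma isRationalDouble_swap {a b : D.Param} (h : D.IsCrossing a b) :
    IsRationalDouble f σ m K A₀ a ↔ IsRationalDouble f σ m K A₀ b := by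
  rw [H.isRationalDouble_iff h (e := 1) (by norm_num),
    H.isRationalDouble_iff h.symm (e := 1) (by norm_num), H.sector_iff h (e' := 1) (by norm_num) (by norm_num)]

lemma isRationalDouble_walk {a : D.Param} (h : D.IsDouble a) {r : ℝ} (hr : 0 < r)
    (h' : D.IsDouble (D.walk a r)) :
    IsRationalDouble f σ m K A₀ a ↔ IsRationalDouble f σ m K A₀ (D.walk a r) := by
  obtain ⟨b, hab⟩ := h
  have ha := hab.mem_Ioo
  by_contra hne
  set T := {s ∈ Icc 0 r | D.IsDouble (D.walk a s)} with hT
  have hTf : T.Finite := finite_isDouble_walk ha.1.le r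
  -- Take the first double point on the walk at which the equivalence fails, and the last double
  -- point before it. Between them lies an edge, along which `sector_walk_iff` applies.
  obtain ⟨s₁, ⟨⟨hs₁T, hs₁0⟩, hs₁n⟩, hs₁⟩ := exists_min_image
    {s | (s ∈ T ∧ 0 < s) ∧ ¬ (IsRationalDouble f σ m K A₀ a ↔
      IsRationalDouble f σ m K A₀ (D.walk a s))} id
    (hTf.subset fun s hs => hs.1.1) ⟨r, ⟨⟨⟨hr.le, le_rfl⟩, h'⟩, hr⟩, hne⟩
  obtain ⟨s₀, ⟨hs₀T, hs₀1⟩, hs₀⟩ := exists_max_image {s | s ∈ T ∧ s < s₁} id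
    (hTf.subset fun s hs => hs.1) ⟨0, ⟨⟨le_rfl, hr.le⟩, by
      rw [walk_zero (Ioo_subset_Ico_self ha)]; exact ⟨b, hab⟩⟩, hs₁0⟩
  have hs₀0 : 0 ≤ s₀ := hs₀T.1.1
  have hiff : IsRationalDouble f σ m K A₀ a ↔ IsRationalDouble f σ m K A₀ (D.walk a s₀) := by
    rcases hs₀0.eq_or_lt with h0 | h0
    · rw [← h0, walk_zero (Ioo_subset_Ico_self ha)]
    · by_contra hn
      exact absurd (hs₁ s₀ ⟨⟨hs₀T, h0⟩, hn⟩) (not_le.2 hs₀1)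
  apply hs₁n
  rw [hiff]
  have hww : ∀ s, 0 ≤ s → D.walk (D.walk a s₀) s = D.walk a (s₀ + s) :=
    fun s hs => walk_walk (by linarith [ha.1]) hs
  have e1 : D.walk (D.walk a s₀) (s₁ - s₀) = D.walk a s₁ := by
    rw [hww _ (by linarith), add_sub_cancel]
  obtain ⟨b₀, h₀⟩ := hs₀T.2
  obtain ⟨b₁, h₁⟩ := hs₁T.2
  have := H.sector_walk_iff (A₀ := A₀) h₀ (r := s₁ - s₀) (by linarith) (b' := b₁) (by rwa [e1]) (by
    intro s hs hd
    rw [hww s hs.1.le] at hd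
    have h5 := hs₀ (s₀ + s) ⟨⟨⟨by linarith [hs.1], by linarith [hs.2, hs₁T.1.2]⟩, hd⟩,
      by linarith [hs.2]⟩
    simp only [id] at h5
    linarith [hs.1])
  rw [e1] at this
  rw [H.isRationalDouble_iff h₀ (e := 1) (by norm_num),
    H.isRationalDouble_iff h₁ (e := -1) (by norm_num), this]

omit H in
lemma exists_walk_eq {i j : Fin D.n} (h : D.next.SameCycle i j) {t t' : ℝ}
    (ht : t ∈ Ico (0 : ℝ) 1) (ht' : t' ∈ Ico (0 : ℝ) 1) :
    ∃ r > 0, D.walk (i, t) r = (j, t') := by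
  obtain ⟨k, hk0, -, hk⟩ := h.exists_pow_eq''
  have hk1 : (1 : ℝ) ≤ k := by exact_mod_cast hk0
  refine ⟨k + t' - t, by linarith [ht.2, ht'.1], ?_⟩
  rw [walk_eq (k := k) ht' (by simp only; ring), hk]

lemma isRationalDouble_of_sameCycle {a a' : D.Param} (h : D.next.SameCycle a.1 a'.1)
    (ha : IsRationalDouble f σ m K A₀ a) (ha' : D.IsDouble a') :
    IsRationalDouble f σ m K A₀ a' := by
  obtain ⟨b, hab, hr⟩ := ha
  obtain ⟨b', hab'⟩ := ha'
  obtain ⟨r, hr0, e⟩ := exists_walk_eq (t := a.2) (t' := a'.2) h hab.1 hab'.1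
  have := (H.isRationalDouble_walk (A₀ := A₀) (a := a) ⟨b, hab⟩ hr0 (by
    rw [e]; exact ⟨b', hab'⟩)).1 ⟨b, hab, hr⟩
  rwa [e] at this

/-- If the diagram is connected every component has a rational double point. -/
lemma exists_sameCycle (hD : IsPreconnected D.shadow) {a₀ : D.Param}
    (h₀ : IsRationalDouble f σ m K A₀ a₀) (i : Fin D.n) :
    ∃ a, D.next.SameCycle i a.1 ∧ IsRationalDouble f σ m K A₀ a := by
  by_contra hi
  set G : Set (Fin D.n) := {i | ∃ a, D.next.SameCycle i a.1 ∧ IsRationalDouble f σ m K A₀ a}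
  have hnext : ∀ j, j ∈ G ↔ D.next j ∈ G := fun j => by
    simp only [G, Set.mem_ofPred_eq, Equiv.Perm.sameCycle_apply_left]
  have hclosed : ∀ B : Set (Fin D.n), IsClosed (⋃ j ∈ B, (fun t => (D.seg j t).1) '' Icc 0 1) := by
    intro B
    refine (B.toFinite.isCompact_biUnion fun j _ => isCompact_Icc.image ?_).isClosed
    exact continuous_fst.comp (continuous_seg j)
  have hcover : D.shadow ⊆ (⋃ j ∈ G, (fun t => (D.seg j t).1) '' Icc 0 1) ∪
      ⋃ j ∈ Gᶜ, (fun t => (D.seg j t).1) '' Icc 0 1 := by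
    intro z hz
    obtain ⟨j, t, ht, rfl⟩ := mem_shadow_iff.1 hz
    by_cases hj : j ∈ G
    · exact Or.inl (mem_biUnion hj ⟨t, ht, rfl⟩)
    · exact Or.inr (mem_biUnion (show j ∈ Gᶜ from hj) ⟨t, ht, rfl⟩)
  have hmem : ∀ (B : Set (Fin D.n)) (j : Fin D.n), j ∈ B →
      (D.shadow ∩ ⋃ j ∈ B, (fun t => (D.seg j t).1) '' Icc 0 1).Nonempty := fun B j hj =>
    ⟨(D.seg j 0).1, mem_shadow_iff.2 ⟨j, 0, ⟨le_rfl, zero_le_one⟩, rfl⟩,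
      mem_biUnion hj ⟨0, ⟨le_rfl, zero_le_one⟩, rfl⟩⟩
  have ha₀ : a₀.1 ∈ G := ⟨a₀, Equiv.Perm.SameCycle.refl _ _, h₀⟩
  obtain ⟨z, -, h1, h2⟩ := isPreconnected_closed_iff.1 hD _ _ (hclosed G) (hclosed Gᶜ) hcover
    (hmem G a₀.1 ha₀) (hmem Gᶜ i hi)
  simp only [mem_iUnion] at h1 h2
  obtain ⟨j, hj, t, ht, hz⟩ := h1
  obtain ⟨k, hk, s, hs, hz'⟩ := h2
  obtain ⟨a, ha, hae, haj⟩ := exists_pt_eq_seg j ht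
  obtain ⟨b, hb, hbe, hbk⟩ := exists_pt_eq_seg k hs
  have haG : a.1 ∈ G := by
    rcases haj with rfl | rfl
    · exact hj
    · exact (hnext j).1 hj
  have hbG : b.1 ∉ G := by
    rcases hbk with rfl | rfl
    · exact hk
    · exact fun h => hk ((hnext k).2 h)
  -- Consecutive segments belong to the same component, so a common point of a good and a bad
  -- segment cannot be just a common vertex; it is a crossing, and rationality passes from one
  -- strand to the other.
  have hcross : D.IsCrossing a b := by
    refine ⟨ha, hb, fun hab => hbG (hab ▸ haG), ?_⟩
    rw [hae, hbe]
    exact hz.trans hz'.symm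
  obtain ⟨a', haa', hra'⟩ := haG
  have hra := H.isRationalDouble_of_sameCycle haa'.symm hra' ⟨b, hcross⟩
  exact hbG ⟨b, Equiv.Perm.SameCycle.refl _ _, (H.isRationalDouble_swap hcross).1 hra⟩

/-- All walls are rational. -/
lemma wall_mem (hD : IsPreconnected D.shadow) {a₀ : D.Param}
    (h₀ : IsRationalDouble f σ m K A₀ a₀) {i : Fin D.n} {t : ℝ} (ht : t ∈ Ioo (0 : ℝ) 1)
    {g : PSL2} {R : Set ℂ} (hg : IsWall f σ i t g R) :
    g ∈ rationalSubgroup K A₀ := by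
  obtain ⟨a', hcyc, hra'⟩ := H.exists_sameCycle hD h₀ i
  have htI := Ioo_subset_Ico_self ht
  obtain ⟨b', hab', -⟩ := id hra'
  obtain ⟨r₀, hr₀, er₀⟩ := exists_walk_eq (t := t) (t' := a'.2) hcyc htI hab'.1
  -- Follow the link from the wall to the first double point. The wall does not change on the way,
  -- and at the end it is the inverse of a rational meridian.
  obtain ⟨r, ⟨⟨hr1, hr2⟩, hr0⟩, hrmin⟩ := exists_min_image
    {s | s ∈ {s ∈ Icc 0 r₀ | D.IsDouble (D.walk (i, t) s)} ∧ 0 < s} id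
    ((finite_isDouble_walk (a := (i, t)) ht.1.le r₀).subset fun s hs => hs.1)
    ⟨r₀, ⟨⟨hr₀.le, le_rfl⟩, by rw [er₀]; exact ⟨b', hab'⟩⟩, hr₀⟩
  have hreg : ∀ s ∈ Ioo 0 r, ¬ D.IsDouble (D.walk (i, t) s) := fun s hs hd =>
    absurd (hrmin s ⟨⟨⟨hs.1.le, hs.2.le.trans hr1.2⟩, hd⟩, hs.1⟩) (not_le.2 hs.2)
  obtain ⟨b, hb⟩ := hr2
  have hrat : IsRationalDouble f σ m K A₀ (D.walk (i, t) r) := by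
    refine H.isRationalDouble_of_sameCycle ?_ hra' ⟨b, hb⟩
    refine hcyc.symm.trans ?_
    exact (Equiv.Perm.SameCycle.refl _ _).pow_right
  obtain ⟨g', R', hw⟩ := exists_isWall_edge H.group H.lift (a := (i, t)) ht.1.le hr0 hreg
  have hIoo : ∀ᶠ x in 𝓝[>] (0 : ℝ), x ∈ Ioo 0 r := Ioo_mem_nhdsGT hr0
  have e1 : g = g' := by
    have hc : Tendsto (fun x : ℝ => t + 1 * x) (𝓝[>] 0) (𝓝 t) := by
      have : Continuous fun x : ℝ => t + 1 * x := by fun_prop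
      have := this.tendsto 0
      simp only [mul_zero, add_zero] at this
      exact this.mono_left nhdsWithin_le_nhds
    obtain ⟨x, h1, h2, h3⟩ := ((walk_eventually_right (a := (i, t)) htI).and
      (hIoo.and (hc.eventually hg.eventually))).exists
    have h4 := hw x h2
    rw [h1] at h4
    exact (h3.unique H.group (h4 (by simp only; linarith [h2.1, ht.1]))).1
  rw [e1]
  obtain ⟨x, h1, h2, h3, h4⟩ := ((((H.isRationalDouble_iff hb (e := -1) (by norm_num)).1
    hrat).wall_mem H hb (by norm_num)).and
    ((walk_eventually_left (a := (i, t)) (r := r) (by simp only; linarith [ht.1]) hb.mem_Ioo.1).and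
    (hIoo.and (eventually_regular hb.mem_Ioo (neg_ne_zero.2 one_ne_zero))))).exists
  refine h1 g' R' ?_
  have h5 := hw (r - x) ⟨by linarith [h3.2], by linarith [h3.1]⟩
  rw [h2] at h5
  exact h5 h4.1.1.ne'

end IsLabelField

end LinkDiagram

end CuspedHyp

namespace CuspedHyp

/-! ## Removing sets of codimension two -/

lemma one_lt_rank_complex : 1 < Module.rank ℝ ℂ := by
  rw [Complex.rank_real_complex]; norm_num

/-- A disc is homeomorphic to the plane, and a real vector space of dimension at least 2 stays
connected when countably many points are removed. -/
lemma isPreconnected_ball_diff (c : ℂ) {r : ℝ} (hr : 0 < r) {Z : Set ℂ} (hZ : Z.Finite) :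
    IsPreconnected (Metric.ball c r \ Z) := by
  set e := OpenPartialHomeomorph.univBall c r
  have hsource : e.source = univ := OpenPartialHomeomorph.univBall_source c r
  have htarget : e.target = Metric.ball c r := OpenPartialHomeomorph.univBall_target c hr
  have hinj : Function.Injective e := by
    have := e.injOn
    rwa [hsource, injOn_univ] at this
  have h1 : (e ⁻¹' Z)ᶜ.Nonempty ∧ IsPreconnected (e ⁻¹' Z)ᶜ :=
    (hZ.preimage hinj.injOn).countable.isConnected_compl_of_one_lt_rank one_lt_rank_complex
  convert h1.2.image e (OpenPartialHomeomorph.continuous_univBall c r).continuousOn using 1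
  ext z
  constructor
  · rintro ⟨hz, hzZ⟩
    rw [← htarget] at hz
    exact ⟨e.symm z, by rwa [mem_compl_iff, mem_preimage, e.right_inv hz], e.right_inv hz⟩
  · rintro ⟨w, hw, rfl⟩
    exact ⟨htarget ▸ e.map_source (hsource ▸ mem_univ w), hw⟩

lemma isPreconnected_exterior (r : ℝ) : IsPreconnected {z : ℂ | r < ‖z‖} := by
  have h : {z : ℂ | r < ‖z‖} =
      (fun q : ℝ × ℝ => (q.1 : ℂ) * Complex.exp (q.2 * Complex.I)) '' (Ioi r ×ˢ univ) := by
    ext z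
    constructor
    · intro hz
      exact ⟨(‖z‖, z.arg), ⟨hz, trivial⟩, Complex.norm_mul_exp_arg_mul_I z⟩
    · rintro ⟨⟨ρ, θ⟩, ⟨hρ, -⟩, rfl⟩
      have hρ : r < ρ := hρ
      simp only [Set.mem_ofPred_eq, norm_mul, Complex.norm_exp_ofReal_mul_I, mul_one,
        Complex.norm_real, Real.norm_eq_abs]
      exact hρ.trans_le (le_abs_self ρ)
  rw [h]
  exact (isPreconnected_Ioi.prod isPreconnected_univ).image _ (by fun_prop)

/-- Points of `S³` have small neighbourhoods which are not disconnected by finitely many vertical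
lines. -/
lemma exists_isPreconnected_nhd {Z : Set ℂ} (hZ : Z.Finite) {V : Set (OnePoint (ℂ × ℝ))}
    (hV : IsOpen V) {q : OnePoint (ℂ × ℝ)} (hq : q ∈ V) : ∃ W ⊆ V, IsOpen W ∧ q ∈ W ∧
      IsPreconnected {p : ℂ × ℝ | (p : OnePoint (ℂ × ℝ)) ∈ W ∧ p.1 ∉ Z} := by
  induction q using OnePoint.rec with
  | infty =>
    obtain ⟨-, hVo⟩ := (OnePoint.isOpen_iff_of_mem hq).1 hV
    obtain ⟨r₁, hr₁⟩ := hVo.isBounded.subset_closedBall 0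
    obtain ⟨r₂, hr₂⟩ := hZ.isBounded.subset_closedBall 0
    set r := max (max r₁ r₂) 0
    have hr : 0 ≤ r := le_max_right _ _
    have hZr : ∀ z ∈ Z, ‖z‖ ≤ r := fun z hz =>
      (mem_closedBall_zero_iff.1 (hr₂ hz)).trans ((le_max_right _ _).trans (le_max_left _ _))
    refine ⟨((fun p : ℂ × ℝ => (p : OnePoint (ℂ × ℝ))) '' Metric.closedBall (0 : ℂ × ℝ) r)ᶜ, ?_,
      OnePoint.isOpen_compl_image_coe.2 ⟨Metric.isClosed_closedBall, isCompact_closedBall _ _⟩,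
      OnePoint.infty_notMem_image_coe, ?_⟩
    · intro y hy
      induction y using OnePoint.rec with
      | infty => exact hq
      | coe p =>
        by_contra hp
        refine hy ⟨p, Metric.closedBall_subset_closedBall
          ((le_max_left _ _).trans (le_max_left _ _)) (hr₁ hp), rfl⟩
    · have hZc : IsPreconnected Zᶜ :=
        (hZ.countable.isConnected_compl_of_one_lt_rank one_lt_rank_complex).isPreconnected
      -- The norm is a maximum, so the outside of the ball is the union of a top, a side and a
      -- bottom part. The vertical lines over Z miss the side part, which meets the other two.
      have h1 : IsPreconnected (Zᶜ ×ˢ Ioi r ∪ {z : ℂ | r < ‖z‖} ×ˢ univ) := by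
        refine IsPreconnected.union' ?_ (hZc.prod isPreconnected_Ioi)
          ((isPreconnected_exterior r).prod isPreconnected_univ)
        have h2 : r < ‖((r + 1 : ℝ) : ℂ)‖ := by
          rw [Complex.norm_real, Real.norm_eq_abs, abs_of_pos (by linarith)]; linarith
        exact ⟨((r + 1 : ℝ), r + 1), ⟨fun hz => absurd (hZr _ hz) (not_le.2 h2),
          by simp only [mem_Ioi]; linarith⟩, h2, trivial⟩
      have h2 : IsPreconnected
          ((Zᶜ ×ˢ Ioi r ∪ {z : ℂ | r < ‖z‖} ×ˢ univ) ∪ Zᶜ ×ˢ Iio (-r)) := by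
        refine IsPreconnected.union' ?_ h1 (hZc.prod isPreconnected_Iio)
        have h2 : r < ‖((r + 1 : ℝ) : ℂ)‖ := by
          rw [Complex.norm_real, Real.norm_eq_abs, abs_of_pos (by linarith)]; linarith
        exact ⟨((r + 1 : ℝ), -r - 1), Or.inr ⟨h2, trivial⟩,
          fun hz => absurd (hZr _ hz) (not_le.2 h2), by simp only [mem_Iio]; linarith⟩
      convert h2 using 1
      ext ⟨z, h⟩
      rw [Set.mem_ofPred_eq, mem_compl_iff,
        OnePoint.isOpenEmbedding_coe.injective.mem_set_image, mem_closedBall_zero_iff, Prod.norm_mk,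
        max_le_iff, Real.norm_eq_abs, abs_le]
      simp only [mem_union, mem_prod, mem_compl_iff, mem_Ioi, mem_Iio, Set.mem_ofPred_eq, mem_univ,
        and_true]
      constructor
      · rintro ⟨h3, h4⟩
        by_cases h5 : ‖z‖ ≤ r
        · by_cases h6 : h ≤ r
          · refine Or.inr ⟨h4, not_le.1 fun h7 => h3 ⟨h5, h7, h6⟩⟩
          · exact Or.inl (Or.inl ⟨h4, not_le.1 h6⟩)
        · exact Or.inl (Or.inr (not_le.1 h5))
      · rintro ((⟨h3, h4⟩ | h3) | ⟨h3, h4⟩)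
        · exact ⟨fun h5 => absurd h5.2.2 (not_le.2 h4), h3⟩
        · exact ⟨fun h5 => absurd h5.1 (not_le.2 h3), fun hz => absurd (hZr z hz) (not_le.2 h3)⟩
        · exact ⟨fun h5 => absurd h5.2.1 (not_le.2 h4), h3⟩
  | coe p =>
    obtain ⟨ε, hε, hball⟩ := Metric.isOpen_iff.1 (hV.preimage OnePoint.continuous_coe) p hq
    refine ⟨(↑) '' Metric.ball p ε, by rintro _ ⟨p', hp', rfl⟩; exact hball hp',
      OnePoint.isOpenEmbedding_coe.isOpenMap _ Metric.isOpen_ball,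
      ⟨p, Metric.mem_ball_self hε, rfl⟩, ?_⟩
    convert (isPreconnected_ball_diff p.1 hε hZ).prod (convex_ball p.2 ε).isPreconnected using 1
    ext p'
    rw [Set.mem_ofPred_eq, OnePoint.isOpenEmbedding_coe.injective.mem_set_image, mem_prod, Set.mem_sdiff,
      ← ball_prod_same, mem_prod]
    tauto

/-- A dense set is connected if it does not separate the space locally. -/
lemma isPreconnected_of_locally {X : Type*} [TopologicalSpace X] [PreconnectedSpace X] {G : Set X}
    (hG : Dense G) (h : ∀ x, ∃ N, IsOpen N ∧ x ∈ N ∧ IsPreconnected (N ∩ G)) :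
    IsPreconnected G := by
  intro U V hU hV hGUV ⟨u, huG, huU⟩ ⟨v, hvG, hvV⟩
  by_contra hne
  rw [not_nonempty_iff_eq_empty] at hne
  -- Enlarge the two pieces of G to unions of open sets whose traces on G lie in one piece. By the
  -- local hypothesis they cover X, so they meet, and density gives a point of G in both pieces.
  set U' : Set X := ⋃₀ {N | IsOpen N ∧ N ∩ G ⊆ U}
  set V' : Set X := ⋃₀ {N | IsOpen N ∧ N ∩ G ⊆ V}
  have hU' : IsOpen U' := isOpen_sUnion fun N hN => hN.1
  have hV' : IsOpen V' := isOpen_sUnion fun N hN => hN.1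
  have hcov : (univ : Set X) ⊆ U' ∪ V' := by
    intro x _
    obtain ⟨N, hN, hx, hNG⟩ := h x
    rcases isPreconnected_iff_subset_of_disjoint.1 hNG U V hU hV (inter_subset_right.trans hGUV)
      (by
        rw [← subset_empty_iff, ← hne]
        exact inter_subset_inter_left _ inter_subset_right) with h1 | h1
    · exact Or.inl ⟨N, ⟨hN, h1⟩, hx⟩
    · exact Or.inr ⟨N, ⟨hN, h1⟩, hx⟩
  obtain ⟨x, -, ⟨N, ⟨hN, hNU⟩, hxN⟩, ⟨N', ⟨hN', hNV⟩, hxN'⟩⟩ :=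
    isPreconnected_univ U' V' hU' hV' hcov
      ⟨u, trivial, U, ⟨hU, inter_subset_left⟩, huU⟩ ⟨v, trivial, V, ⟨hV, inter_subset_left⟩, hvV⟩
  obtain ⟨y, ⟨hy, hy'⟩, hyG⟩ := hG.inter_open_nonempty _ (hN.inter hN') ⟨x, hxN, hxN'⟩
  have : y ∈ G ∩ (U ∩ V) := ⟨hyG, hNU ⟨hy, hyG⟩, hNV ⟨hy', hyG⟩⟩
  rw [hne] at this
  exact this

namespace LinkDiagram

variable {D : LinkDiagram} {Γ : Subgroup PSL2} {f : Manifold Γ ≃ₜ D.Complement}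
  {σ : ℂ × ℝ → H3} {m : MeridianSystem Γ}

variable (D) in
/-- The projections of the double points and vertices. -/
def singularPoints : Set ℂ :=
  (fun a => (D.pt a).1) '' {a | D.IsDouble a} ∪ range fun i => (D.vert i).1

lemma finite_singularPoints : (singularPoints D).Finite :=
  ((finite_isDouble D).image _).union (finite_range _)

/-- The points over the complement of the shadow are dense. -/
lemma dense_compl_shadow : Dense D.shadowᶜ := by
  have h : ∀ i : Fin D.n, IsOpen {z | (D.coord i z).im ≠ 0} ∧ Dense {z | (D.coord i z).im ≠ 0} := by
    intro i
    refine ⟨isOpen_ne_fun (Complex.continuous_im.comp (continuous_coord i)) continuous_const, ?_⟩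
    rw [Metric.dense_iff]
    intro z r hr
    by_cases hz : (D.coord i z).im = 0
    · obtain ⟨zl, hzl, -, -, hl, -⟩ := exists_left_right i (D.coord i z).re hr
      have e : (D.seg i (D.coord i z).re).1 = z := by
        apply coord_injective i
        rw [coord_seg]
        exact Complex.ext (by simp) (by simp [hz])
      rw [e] at hzl
      exact ⟨zl, hzl, hl.ne'⟩
    · exact ⟨z, Metric.mem_ball_self hr, hz⟩
  refine (dense_iInter_of_isOpen (fun i => (h i).1) fun i => (h i).2).mono ?_
  intro z hz hzs
  obtain ⟨i, t, ht, rfl⟩ := mem_shadow_iff.1 hzs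
  have := mem_iInter.1 hz i
  rw [Set.mem_ofPred_eq, coord_seg, Complex.ofReal_im] at this
  exact this rfl

lemma isOpenMap_proj (hΓ : IsFiniteVolumeManifoldGroup Γ) : IsOpenMap (proj f) :=
  (isQuotientCoveringMap_proj f hΓ).isCoveringMap.isLocalHomeomorph.isOpenMap

variable (D) in
lemma isOpen_complement : IsOpen ((fun x : ℂ × ℝ => (x : OnePoint (ℂ × ℝ))) '' D.link)ᶜ :=
  OnePoint.isOpen_compl_image_coe.2 ⟨(isCompact_link D).isClosed, isCompact_link D⟩

lemma dense_cover (hΓ : IsFiniteVolumeManifoldGroup Γ) :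
    Dense {x : H3 | ∃ p : ℂ × ℝ, cover f x = p ∧ p.1 ∉ D.shadow} := by
  rw [dense_iff_inter_open]
  intro U hU hne
  have h1 : IsOpen (Subtype.val '' (proj f '' U)) :=
    (isOpen_complement D).isOpenMap_subtype_val _ (isOpenMap_proj hΓ U hU)
  obtain ⟨_, hq, p, rfl⟩ := OnePoint.denseRange_coe.inter_open_nonempty _ h1
    ((hne.image _).image _)
  have h2 : IsOpen (Prod.fst '' ((fun p : ℂ × ℝ => (p : OnePoint (ℂ × ℝ))) ⁻¹'
      (Subtype.val '' (proj f '' U)))) :=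
    isOpenMap_fst _ (h1.preimage OnePoint.continuous_coe)
  obtain ⟨_, ⟨p', ⟨_, ⟨x, hx, rfl⟩, e⟩, rfl⟩, hp'⟩ :=
    dense_compl_shadow.inter_open_nonempty _ h2 ⟨p.1, p, hq, rfl⟩
  exact ⟨x, hx, p', e, hp'⟩

/-- The points of `H3` away from the vertical lines over the double points and vertices. -/
def regularPoints (f : Manifold Γ ≃ₜ D.Complement) : Set H3 :=
  {x | ∃ p : ℂ × ℝ, cover f x = p ∧ p.1 ∉ singularPoints D}

lemma singularPoints_subset : singularPoints D ⊆ D.shadow := by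
  rintro _ (⟨a, ⟨b, h⟩, rfl⟩ | ⟨i, rfl⟩)
  · exact pt_mem_shadow h.1
  · exact mem_shadow_iff.2 ⟨i, 0, ⟨le_rfl, zero_le_one⟩, by rw [seg_zero]⟩

/-- What is removed lies over finitely many vertical lines and the point ∞, which do not separate S³
locally. The covering is a local homeomorphism, so they do not separate H3 locally either. -/
lemma isPreconnected_regularPoints (hΓ : IsFiniteVolumeManifoldGroup Γ) :
    IsPreconnected (regularPoints f) := by
  refine isPreconnected_of_locally ((dense_cover (f := f) hΓ).mono ?_) fun x => ?_
  · rintro x ⟨p, hp, hps⟩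
    exact ⟨p, hp, fun h => hps (singularPoints_subset h)⟩
  · obtain ⟨e, hx, he⟩ := (isQuotientCoveringMap_proj f hΓ).isCoveringMap.isLocalHomeomorph x
    have hV : IsOpen (Subtype.val '' e.target) :=
      (isOpen_complement D).isOpenMap_subtype_val _ e.open_target
    obtain ⟨W, hWV, hW, hxW, hWc⟩ := exists_isPreconnected_nhd
      (finite_singularPoints (D := D)) hV ⟨e x, e.map_source hx, rfl⟩
    set G : Set D.Complement := {q | q.1 ∈ W ∧ ∃ p : ℂ × ℝ, q.1 = p ∧ p.1 ∉ singularPoints D}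
    have hG : IsPreconnected G := by
      refine (IsInducing.isPreconnected_image (f := (Subtype.val : D.Complement → _))
        IsInducing.subtypeVal).1 ?_
      convert hWc.image _ OnePoint.continuous_coe.continuousOn using 1
      ext q
      constructor
      · rintro ⟨q, ⟨h1, p, hp, hps⟩, rfl⟩
        exact ⟨p, ⟨hp ▸ h1, hps⟩, hp.symm⟩
      · rintro ⟨p, ⟨h1, h2⟩, rfl⟩
        obtain ⟨q, -, hq⟩ := hWV h1
        exact ⟨q, ⟨by rwa [hq], p, hq, h2⟩, hq⟩
    have hGt : G ⊆ e.target := by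
      rintro q ⟨h1, -⟩
      obtain ⟨q', hq', hqq⟩ := hWV h1
      rwa [← Subtype.ext hqq]
    refine ⟨e.source ∩ e ⁻¹' (Subtype.val ⁻¹' W), e.isOpen_inter_preimage
      (hW.preimage continuous_subtype_val), ⟨hx, hxW⟩, ?_⟩
    convert hG.image e.symm (e.continuousOn_symm.mono hGt) using 1
    have he' : ∀ y, (proj f y).1 = (e y).1 := fun y => by rw [he]
    ext y
    constructor
    · rintro ⟨⟨hy, hyW⟩, p, hp, hps⟩
      refine ⟨e y, ⟨hyW, p, ?_, hps⟩, e.left_inv hy⟩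
      rw [← he', ← hp]; rfl
    · rintro ⟨q, hq, rfl⟩
      obtain ⟨h1, p, hp, hps⟩ := id hq
      have hr := e.right_inv (hGt hq)
      refine ⟨⟨e.map_target (hGt hq), ?_⟩, p, ?_, hps⟩
      · rw [mem_preimage, hr]; exact h1
      · rw [cover_eq, he', hr, hp]

end LinkDiagram

end CuspedHyp

namespace CuspedHyp

namespace LinkDiagram

variable {D : LinkDiagram} {Γ : Subgroup PSL2} {f : Manifold Γ ≃ₜ D.Complement}
  {σ : ℂ × ℝ → H3} {m : MeridianSystem Γ} {K : IntermediateField ℚ ℂ} {A₀ : SL2}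

/-! ## The group is generated by the walls -/

/-- Near a point every point is given by the lift. -/
lemma IsLiftOn.eventually_eq (hΓ : IsFiniteVolumeManifoldGroup Γ) {U : Set (ℂ × ℝ)} (hU : IsOpen U)
    {S : ℂ × ℝ → H3} (hS : IsLiftOn f id U S) {p : ℂ × ℝ} (hp : p ∈ U) :
    ∀ᶠ y in 𝓝 (S p), ∀ q : ℂ × ℝ, cover f y = q → q ∈ U ∧ y = S q := by
  obtain ⟨e, hx, he⟩ := (isQuotientCoveringMap_proj f hΓ).isCoveringMap.isLocalHomeomorph (S p)
  have h1 : U ∩ S ⁻¹' e.source ∈ 𝓝 p :=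
    inter_mem (hU.mem_nhds hp) ((hS.1.continuousAt (hU.mem_nhds hp)) (e.open_source.mem_nhds hx))
  have h2 : (fun p : ℂ × ℝ => (p : OnePoint (ℂ × ℝ))) '' (U ∩ S ⁻¹' e.source) ∈
      𝓝 (cover f (S p)) := by
    rw [hS.2 p hp]
    exact OnePoint.isOpenEmbedding_coe.isOpenMap.image_mem_nhds h1
  filter_upwards [(continuous_cover f hΓ).continuousAt h2, e.open_source.mem_nhds hx] with
    y hy hys q hq
  obtain ⟨q', ⟨hq'U, hq's⟩, hq'⟩ := hy
  obtain rfl : q' = q := OnePoint.coe_injective (hq'.trans hq)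
  refine ⟨hq'U, e.injOn hys hq's ?_⟩
  rw [← he]
  refine Subtype.ext ?_
  rw [← cover_eq, ← cover_eq, hq, hS.2 _ hq'U]
  rfl

/-- Near a regular point, the visible points lie in the translates of the image of `σ` by a coset of
the group generated by the walls. -/
lemma exists_coset (hΓ : IsFiniteVolumeManifoldGroup Γ) (hσ : IsLiftOn f id D.visible σ)
    {Λ : Subgroup PSL2}
    (hΛ : ∀ i, ∀ t ∈ Ioo (0 : ℝ) 1, ∀ g R, IsWall f σ i t g R → g ∈ Λ) {x : H3}
    (hx : x ∈ regularPoints f) : ∃ γ ∈ Γ, ∀ᶠ y in 𝓝 x, ∀ q ∈ D.visible, cover f y = (q : ℂ × ℝ) →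
      ∃ g ∈ Λ, γ * g ∈ Γ ∧ y = (γ * g) • σ q := by
  obtain ⟨p, hxp, hps⟩ := hx
  by_cases hpv : p ∈ D.visible
  · obtain ⟨g, hg, hgx⟩ := exists_smul_eq_of_cover_eq f ((hσ.2 p hpv).trans hxp.symm)
    refine ⟨g, hg, ?_⟩
    have := (hσ.smul hg).eventually_eq hΓ (isOpen_visible D) hpv
    rw [← hgx] at this
    filter_upwards [this] with y hy q hq hyq
    exact ⟨1, one_mem Λ, by rwa [mul_one], by rw [mul_one]; exact (hy q hyq).2⟩
  · simp only [visible, Set.mem_ofPred_eq, not_forall, not_lt] at hpv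
    obtain ⟨i, t, ht, e, hle⟩ := hpv
    have hlt : p.2 < (D.seg i t).2 := by
      refine lt_of_le_of_ne hle fun h => not_mem_link_of_cover_eq f hxp ?_
      exact mem_link_iff.2 ⟨i, t, ht, Prod.ext e h.symm⟩
    have ht' : t ∈ Ioo (0 : ℝ) 1 := by
      refine ⟨lt_of_le_of_ne ht.1 ?_, lt_of_le_of_ne ht.2 ?_⟩
      · rintro rfl
        rw [seg_zero] at e
        exact hps (Or.inr ⟨i, e⟩)
      · rintro rfl
        rw [seg_one, seg_zero] at e
        exact hps (Or.inr ⟨_, e⟩)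
    have hreg : ¬ D.IsDouble (i, t) := fun h => hps (Or.inl ⟨(i, t), h, e⟩)
    obtain ⟨g, R, ε, h, S, w, hh⟩ := exists_isWallChart hΓ hσ ht' hreg (sub_pos.2 hlt)
    set U := (Metric.ball (D.seg i t).1 ε ×ˢ Iio h) ∩ {q | (D.coord i q.1).re ∈ Ioo (0 : ℝ) 1}
    have hU : IsOpen U := (Metric.isOpen_ball.prod isOpen_Iio).inter
      (isOpen_Ioo.preimage (Complex.continuous_re.comp ((continuous_coord i).comp continuous_fst)))
    have hpU : p ∈ U := by
      refine ⟨⟨by rw [← e]; exact Metric.mem_ball_self w.pos, ?_⟩, ?_⟩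
      · simp only [mem_Iio]; linarith
      · rw [Set.mem_ofPred_eq, ← e, coord_seg, Complex.ofReal_re]; exact ht'
    have hS : IsLiftOn f id U S := w.lift.mono inter_subset_left
    obtain ⟨γ, hγ, hγx⟩ := exists_smul_eq_of_cover_eq f ((hS.2 p hpU).trans hxp.symm)
    have := (hS.smul hγ).eventually_eq hΓ hU hpU
    rw [← hγx] at this
    refine ⟨γ, hγ, ?_⟩
    filter_upwards [this] with y hy q hq hyq
    obtain ⟨⟨⟨hq1, hq2⟩, hq3⟩, rfl⟩ := hy q hyq
    rcases lt_trichotomy (D.coord i q.1).im 0 with h0 | h0 | h0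
    · exact ⟨g, hΛ i t ht' g R ⟨_, _, _, w⟩, mul_mem hγ w.mem, by
        rw [mul_smul, ← w.right _ hq1 h0 _ hq2]⟩
    · exfalso
      -- A visible point of the chart in the plane of the wall would lie above the strand, but the
      -- chart is a half-infinite cylinder downwards, so it would contain the point of the link
      -- below.
      set τ := (D.coord i q.1).re
      have e1 : (D.seg i τ).1 = q.1 := by
        apply coord_injective i
        rw [coord_seg]
        exact Complex.ext (by simp [τ]) (by simp [h0])
      have h1 := hq i τ (Ioo_subset_Icc_self hq3) e1
      have h2 : D.seg i τ ∈ Metric.ball (D.seg i t).1 ε ×ˢ Iio h :=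
        ⟨by rw [e1]; exact hq1, h1.trans hq2⟩
      exact not_mem_link_of_cover_eq f (w.lift.2 _ h2)
        (mem_link_iff.2 ⟨i, τ, Ioo_subset_Icc_self hq3, rfl⟩)
    · exact ⟨1, one_mem Λ, by rwa [mul_one], by rw [mul_one, ← w.left _ hq1 h0 _ hq2]⟩

/-- The covering group is generated by the walls. -/
lemma le_of_isWall_mem (hΓ : IsFiniteVolumeManifoldGroup Γ) (hσ : IsLiftOn f id D.visible σ)
    {Λ : Subgroup PSL2}
    (hΛ : ∀ i, ∀ t ∈ Ioo (0 : ℝ) 1, ∀ g R, IsWall f σ i t g R → g ∈ Λ) : Γ ≤ Λ := by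
  intro γ₀ hγ₀
  by_contra hγΛ
  -- Away from the diagram each point of H3 lies on a unique sheet g • σ with g in Γ. The sets O and
  -- O' record locally whether g belongs to Λ; `exists_coset` shows that they cover the connected
  -- set of regular points. Membership in Γ is kept apart because Λ need not lie in Γ, and only Γ
  -- acts freely.
  set O : Set H3 := {x | ∀ᶠ y in 𝓝 x, ∀ q ∈ D.visible, cover f y = (q : ℂ × ℝ) →
    ∃ g ∈ Γ, g ∈ Λ ∧ y = g • σ q}
  set O' : Set H3 := {x | ∀ᶠ y in 𝓝 x, ∀ q ∈ D.visible, cover f y = (q : ℂ × ℝ) →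
    ∃ g ∈ Γ, g ∉ Λ ∧ y = g • σ q}
  have hO : IsOpen O := isOpen_iff_mem_nhds.2 fun x hx => eventually_eventually_nhds.2 hx
  have hO' : IsOpen O' := isOpen_iff_mem_nhds.2 fun x hx => eventually_eventually_nhds.2 hx
  have hcov : regularPoints f ⊆ O ∪ O' := by
    intro x hx
    obtain ⟨γ, hγ, h⟩ := exists_coset hΓ hσ hΛ hx
    by_cases hγΛ : γ ∈ Λ
    · refine Or.inl (h.mono fun y hy q hq hyq => ?_)
      obtain ⟨g, hg, hgΓ, e⟩ := hy q hq hyq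
      exact ⟨γ * g, hgΓ, mul_mem hγΛ hg, e⟩
    · refine Or.inr (h.mono fun y hy q hq hyq => ?_)
      obtain ⟨g, hg, hgΓ, e⟩ := hy q hq hyq
      exact ⟨γ * g, hgΓ, fun h => hγΛ ((Subgroup.mul_mem_cancel_right Λ hg).1 h), e⟩
  obtain ⟨z, hz⟩ := dense_compl_shadow.nonempty (X := ℂ) (s := D.shadowᶜ)
  have hv : ((z, 0) : ℂ × ℝ) ∈ D.visible := visible_of_not_mem_shadow hz
  have hmem : ∀ g ∈ Γ, g • σ (z, 0) ∈ regularPoints f := fun g hg =>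
    ⟨(z, 0), (hσ.smul hg).2 _ hv, fun h => hz (singularPoints_subset h)⟩
  obtain ⟨x, -, hxO, hxO'⟩ := isPreconnected_regularPoints hΓ O O' hO hO' hcov
    ⟨(1 : PSL2) • σ (z, 0), hmem 1 (one_mem Γ), by
      filter_upwards [(hσ.smul (one_mem Γ)).eventually_eq hΓ (isOpen_visible D) hv] with y hy q _ hq
      exact ⟨1, one_mem Γ, one_mem Λ, (hy q hq).2⟩⟩
    ⟨γ₀ • σ (z, 0), hmem γ₀ hγ₀, by
      filter_upwards [(hσ.smul hγ₀).eventually_eq hΓ (isOpen_visible D) hv] with y hy q _ hq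
      exact ⟨γ₀, hγ₀, hγΛ, (hy q hq).2⟩⟩
  obtain ⟨V, hV, hVo, hxV⟩ := eventually_nhds_iff.1 (hxO.and hxO')
  obtain ⟨y, hyV, q, hyq, hqs⟩ := (dense_cover (f := f) hΓ).inter_open_nonempty V hVo ⟨x, hxV⟩
  have hqv : q ∈ D.visible := visible_of_not_mem_shadow hqs
  obtain ⟨g, hg, hgΛ, e⟩ := (hV y hyV).1 q hqv hyq
  obtain ⟨g', hg', hgΛ', e'⟩ := (hV y hyV).2 q hqv hyq
  exact hgΛ' (smul_injective_of_mem hΓ hg hg' (e.symm.trans e') ▸ hgΛ)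

/-! ### The labels of a link diagram generate the invariant trace field -/

lemma adjoin_labels (hΓ : IsFiniteVolumeManifoldGroup Γ) (f : Manifold Γ ≃ₜ D.Complement)
    (m : MeridianSystem Γ)
    (hD : D.IsReduced) (hess : CrossingArcsEssential f) (hm : IsStandardMeridian f m) :
    IntermediateField.adjoin ℚ (edgeLabels f m ∪ crossingLabels f m) = invariantTraceField Γ := by
  refine le_antisymm (IntermediateField.adjoin_le_iff.2 ?_) ?_
  · rintro x (⟨a, r, R, b, b', c, c', P, Q, Q', -, -, -, -, -, -, hJ, hJ', hu⟩ |
      ⟨a, b, c, P, Q, w, -, hJ, hw, rfl⟩)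
    · exact translationParameter_mem hu hJ.2.1 hJ.1 hJ'.2.1
    · exact intercuspParameter_mem hw hJ.1 hJ.2.1
  · set K := IntermediateField.adjoin ℚ (edgeLabels f m ∪ crossingLabels f m)
    obtain ⟨σ, hσ⟩ := exists_visibleLift hΓ f
    have H : IsLabelField f σ m K := ⟨hΓ, hσ, hm, hess,
      fun x hx => IntermediateField.subset_adjoin _ _ (Or.inr hx),
      fun x hx => IntermediateField.subset_adjoin _ _ (Or.inl hx)⟩
    obtain ⟨a, b, h⟩ := hD.crossing
    obtain ⟨κ, S, P, Q, hne, hS, hJ⟩ := H.exists_sectorLift h (e := 1) (by norm_num)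
    -- The base frame belongs to the lifted arc of one crossing, which makes this crossing rational
    -- from the start.
    obtain ⟨A₀, hA₀⟩ := IsFlagFrame.exists (m := m) hJ.1 hne
    have hrat : IsRationalDouble f σ m K A₀ a := ⟨b, h, κ, S, P, Q, hS, hJ, A₀, hA₀, by
      rw [inv_mul_cancel]; exact one_mem _⟩
    exact invariantTraceField_le (le_of_isWall_mem hΓ hσ fun i t ht g R hg =>
      H.wall_mem hD.connected hrat ht hg)

end LinkDiagram

end CuspedHyp

end

theorem proposition4p1 (Γ : Subgroup CuspedHyp.PSL2)
    (hΓ : CuspedHyp.IsFiniteVolumeManifoldGroup Γ) (m : CuspedHyp.MeridianSystem Γ) :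
    (∀ T : CuspedHyp.IdealTriangulation Γ,
      IntermediateField.adjoin ℚ (T.zickertParameters m) = CuspedHyp.invariantTraceField Γ) ∧
    (∀ (D : CuspedHyp.LinkDiagram) (f : CuspedHyp.Manifold Γ ≃ₜ D.Complement),
      D.IsReduced → CuspedHyp.LinkDiagram.CrossingArcsEssential f →
      CuspedHyp.LinkDiagram.IsStandardMeridian f m →
      IntermediateField.adjoin ℚ (CuspedHyp.LinkDiagram.edgeLabels f m ∪
        CuspedHyp.LinkDiagram.crossingLabels f m) = CuspedHyp.invariantTraceField Γ) :=
  ⟨fun T => T.adjoin_zickertParameters, fun _ f hD hess hm =>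
    CuspedHyp.LinkDiagram.adjoin_labels hΓ f m hD hess hm⟩
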